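/- Let $p$ be an odd prime, $G=\mathbb{Z}/p\mathbb{Z}$, and consider the untwisted Dijkgraaf–Witten theory with gauge group $G$, i.e. the abelian 3d TQFT with discriminant group $D=G\oplus G^*$, $G^*=\hom(G,\mathbb{Q}/\mathbb{Z})$, and quadratic form $q(a,\alpha)=\alpha(a)$, with the Neumann boundary condition given by the Lagrangian subgroup $\mathfrak{L}=G\oplus 0\subset D$. By a pair $(A,\ell)$ we mean a finitely generated abelian group $A$ with a non-degenerate symmetric bilinear form $\ell:\operatorname{Tor}A\times\operatorname{Tor}A\to\mathbb{Q}/\mathbb{Z}$; two pairs are equivalent if an isomorphism of the groups carries one form to the other. For $f\in\hom(\mathbb{Z}^g,A)\cong A^g$ and $c\in\mathfrak{L}^g$, the partition function $Z(A,\ell,f;D,q;c)$ is given by the surgery formula $$Z(A,\ell,f;D,q;c)=\frac{1}{|D|^{(m+1)/2}}\sum_{x\in\mathbb{Z}^m\otimes D}\exp\left[-2\pi i\,(L\otimes q)(x\oplus c)\right],$$ where $L=\begin{pmatrix}J&F\\F^T&J'\end{pmatrix}$ is any symmetric integer matrix of size $m+g$ such that $A\cong\operatorname{coker}J$, the form $\ell$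 is the one induced by $J^{-1}$ mod $\mathbb{Z}$ on $\operatorname{Tor}\operatorname{coker}J$, and $f$ is $F$ followed by the projection $\mathbb{Z}^m\to\operatorname{coker}J\cong A$. Here $L\otimes q$ is the quadratic form on $\mathbb{Z}^{m+g}\otimes D=D^{m+g}$ given by $(L\otimes q)(z)=\sum_i L_{ii}\,q(z_i)+\sum_{i<j}L_{ij}\,b_q(z_i,z_j)$ with $b_q(x,y)=q(x+y)-q(x)-q(y)$. The connected gravitational partition function of genus $g\ge 0$ with respect to the measure $\mu$ is $$\mathcal{Z}_g(D,q;\mathfrak{L};\mu)=\sum_{(A,\ell)/\sim}\ \sum_{f\in\hom(\mathbb{Z}^g,A)}\mu(A,\ell,f)\sum_{c\in\mathfrak{L}^g}Z(A,\ell,f;D,q;c).$$ Let $$\mu(A,\ell,f)=\lambda^{\operatorname{rank}A}\,|\operatorname{Tor}A|^{-s}\prod_{i=1}^g\nu(f_i),$$ where $\nu$ is the indicator function of $\operatorname{Tor}A\subset A$, and where $\lambda,s\in\mathbb{R}$ satisfy $0\le\lambda<|D|^{-1/2}$ and $s>g+1$. Let $\Xi(u)=\sum_{n\ge1}a(n)\,n^{-u}$,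 where $a(n)$ is the number of equivalence classes of pairs $(A,\ell)$ with $A$ finite of order $n$. Then the sum defining $\mathcal{Z}_g$ converges absolutely (as a sum over all triples $(A,\ell,f)$), the series $\Xi(s-g)$ and the infinite product below converge, and $$\mathcal{Z}_g(D,q;\mathfrak{L};\mu)=\frac{\Xi(s-g)}{1-\lambda|D|^{1/2}}\left(p^{-1}(p^g-1)+p^{-1}\prod_{m\ge1}\frac{1+p^{1-m(s-g)}}{1-p^{1-m(s-g)}}\cdot\frac{1-p^{-m(s-g)}}{1+p^{-m(s-g)}}\right).$$ -/

import Mathlib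

noncomputable section

namespace AbelianTQFT

/-- The group `ℚ/ℤ`. -/
abbrev QZ : Type := AddCircle (1 : ℚ)

theorem exp_periodic :
    Function.Periodic (fun r : ℚ => Complex.exp (2 * Real.pi * Complex.I * (r : ℂ))) 1 := by
  intro r
  have h : 2 * (Real.pi : ℂ) * Complex.I * ((r + 1 : ℚ) : ℂ)
      = 2 * Real.pi * Complex.I * (r : ℂ) + 2 * Real.pi * Complex.I := by
    push_cast
    ring
  change Complex.exp _ = Complex.exp _
  rw [h, Complex.exp_add, Complex.exp_two_pi_mul_I, mul_one]

/-- The character `t ↦ exp (2 π i t)` of `ℚ/ℤ`. -/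
def e (t : QZ) : ℂ := exp_periodic.lift t

/-! ### Linking forms on finitely generated abelian groups -/

/-- A finitely generated abelian group `A` with a non-degenerate symmetric bilinear form
`ℓ : Tor A × Tor A → ℚ/ℤ` on its torsion subgroup. -/
structure LinkedGroup : Type 1 where
  A : Type
  [grp : AddCommGroup A]
  fg : AddGroup.FG A
  form : AddCommGroup.torsion A →+ AddCommGroup.torsion A →+ QZ
  symm : ∀ x y, form x y = form y x
  nondeg : ∀ x, (∀ y, form x y = 0) → x = 0

attribute [instance] LinkedGroup.grp

namespace LinkedGroup

/-- Two pairs `(A, ℓ)`, `(A', ℓ')` are equivalent if some isomorphism `A ≃ A'` carries `ℓ` to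
`ℓ'`. -/
def Equivalent (X Y : LinkedGroup) : Prop :=
  ∃ φ : X.A ≃+ Y.A, ∀ (x y : AddCommGroup.torsion X.A) (x' y' : AddCommGroup.torsion Y.A),
    (x' : Y.A) = φ x → (y' : Y.A) = φ y → Y.form x' y' = X.form x y

theorem mem_torsion_map {A B : Type} [AddCommGroup A] [AddCommGroup B] (φ : A ≃+ B)
    {x : A} (hx : x ∈ AddCommGroup.torsion A) : φ x ∈ AddCommGroup.torsion B :=
  AddMonoidHom.isOfFinAddOrder φ.toAddMonoidHom hx

theorem equivalent_refl (X : LinkedGroup) : Equivalent X X := by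
  refine ⟨AddEquiv.refl _, fun x y x' y' hx hy => ?_⟩
  rw [show x' = x from Subtype.ext hx, show y' = y from Subtype.ext hy]

theorem Equivalent.symm' {X Y : LinkedGroup} (h : Equivalent X Y) : Equivalent Y X := by
  obtain ⟨φ, hφ⟩ := h
  refine ⟨φ.symm, fun x y x' y' hx hy => (hφ x' y' x y ?_ ?_).symm⟩
  · rw [hx, AddEquiv.apply_symm_apply]
  · rw [hy, AddEquiv.apply_symm_apply]

theorem Equivalent.trans' {X Y Z : LinkedGroup} (h : Equivalent X Y) (h' : Equivalent Y Z) :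
    Equivalent X Z := by
  obtain ⟨φ, hφ⟩ := h
  obtain ⟨ψ, hψ⟩ := h'
  refine ⟨φ.trans ψ, fun x y x' y' hx hy => ?_⟩
  rw [hψ ⟨φ x, mem_torsion_map φ x.2⟩ ⟨φ y, mem_torsion_map φ y.2⟩ x' y' hx hy]
  exact hφ x y _ _ rfl rfl

instance setoid : Setoid LinkedGroup :=
  ⟨Equivalent, equivalent_refl, Equivalent.symm', Equivalent.trans'⟩

end LinkedGroup

/-- Equivalence classes of pairs `(A, ℓ)`. -/
def LinkedClass : Type 1 := Quotient LinkedGroup.setoid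

/-- A chosen representative of an equivalence class of pairs `(A, ℓ)`. -/
def LinkedClass.rep (X : LinkedClass) : LinkedGroup := Quotient.out X

/-- The number `a(n)` of equivalence classes of pairs `(A, ℓ)` with `A` finite of order `n`
(for `n ≥ 1`). -/
def numForms (n : ℕ) : ℕ := Nat.card {X : LinkedClass // Nat.card X.rep.A = n}

/-- The general term of the generating Dirichlet series `Ξ(s) = ∑_{n ≥ 1} a(n) n^{-s}`. -/
def xiTerm (s : ℝ) (n : ℕ+) : ℝ := (numForms n : ℝ) * ((n : ℕ) : ℝ) ^ (-s)

/-- The generating Dirichlet series `Ξ(s) = ∑_{n ≥ 1} a(n) n^{-s}`. -/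
def xi (s : ℝ) : ℝ := ∑' n : ℕ+, xiTerm s n

/-! ### The partition function of the abelian TQFT `(D, q)` -/

section TQFT

variable {D : Type} [AddCommGroup D]

/-- The bilinear form `b_q` associated with `q`. -/
def polar (q : D → QZ) (x y : D) : QZ := q (x + y) - q x - q y

/-- For a symmetric integer matrix `L`, the quadratic form `L ⊗ q` on `ℤⁿ ⊗ D = Dⁿ`. -/
def tensorForm {n : ℕ} (L : Matrix (Fin n) (Fin n) ℤ) (q : D → QZ) (z : Fin n → D) : QZ :=
  ∑ i, L i i • q (z i) + ∑ i, ∑ j ∈ Finset.Ioi i, L i j • polar q (z i) (z j)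

/-- Surgery data for a triple `(A, ℓ, f)`, where `f : ℤ^g → A` is given by the images `f i` of the
basis vectors: the linking matrix `L` of a framed link in `S³` whose first `m` components form
the surgery link of a closed connected oriented 3-manifold `Y` and whose last `g` components become
a `g`-component framed link in `Y`. The first block `J` of `L` presents `H₁(Y) = coker J`, which
is identified with `A` by `proj`; the off-diagonal block gives the homology classes of the `g`
link components, and the linking form of `Y` is `J⁻¹ mod ℤ`, that is, `ℓ([u], [v]) = (w ⬝ v) / n`
whenever `J w = n u` with `n ≠ 0`. -/
structure SurgeryPresentation (X : LinkedGroup) {g : ℕ} (f : Fin g → X.A) where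
  m : ℕ
  L : Matrix (Fin (m + g)) (Fin (m + g)) ℤ
  isSymm : L.IsSymm
  proj : (Fin m → ℤ) →+ X.A
  surj : Function.Surjective proj
  ker_eq : ∀ u : Fin m → ℤ, proj u = 0 ↔
    ∃ w : Fin m → ℤ, (L.submatrix (Fin.castAdd g) (Fin.castAdd g)).mulVec w = u
  link_eq : ∀ k : Fin g, proj (fun i => L (Fin.castAdd g i) (Fin.natAdd m k)) = f k
  form_eq : ∀ (x y : AddCommGroup.torsion X.A) (u v w : Fin m → ℤ) (n : ℤ),
    proj u = x → proj v = y → n ≠ 0 →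
    (L.submatrix (Fin.castAdd g) (Fin.castAdd g)).mulVec w = n • u →
    X.form x y = (((w ⬝ᵥ v : ℤ) / n : ℚ) : QZ)

/-- The surgery formula
`Z = |D|^{-(m+1)/2} ∑_{x ∈ D^m} exp (- 2 π i (L ⊗ q)(x ⊕ c))`. -/
def SurgeryPresentation.partitionFunction {X : LinkedGroup} {g : ℕ} {f : Fin g → X.A}
    (P : SurgeryPresentation X f) (q : D → QZ) (c : Fin g → D) : ℂ :=
  ((Real.sqrt (Nat.card D) ^ (P.m + 1) : ℝ) : ℂ)⁻¹ *
    ∑ᶠ x : Fin P.m → D, e (-tensorForm P.L q (Fin.append x c))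

open Classical in
/-- The partition function `Z(A, ℓ, f; D, q; c)`: the value of the surgery formula on a surgery
presentation of the triple `(A, ℓ, f)`. -/
def partitionFunction (X : LinkedGroup) {g : ℕ} (f : Fin g → X.A) (q : D → QZ)
    (c : Fin g → D) : ℂ :=
  if h : Nonempty (SurgeryPresentation X f) then h.some.partitionFunction q c else 0

/-- The contribution `μ(A, ℓ, f) ∑_{c ∈ 𝔏^g} Z(A, ℓ, f; D, q; c)` of a triple. -/
def tripleTerm (q : D → QZ) (Lag : AddSubgroup D) (g : ℕ)
    (μ : (X : LinkedGroup) → (Fin g → X.A) → ℝ) (X : LinkedGroup) (f : Fin g → X.A) : ℂ :=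
  (μ X f : ℂ) * ∑ᶠ c : Fin g → Lag, partitionFunction X f q (fun i => (c i : D))

/-- The connected gravitational partition function
`𝒵_g(D, q; 𝔏; μ) = ∑_{(A, ℓ)} ∑_{f ∈ hom(ℤ^g, A)} μ(A, ℓ, f) ∑_{c ∈ 𝔏^g} Z(A, ℓ, f; D, q; c)`. -/
def connectedZ (q : D → QZ) (Lag : AddSubgroup D) (g : ℕ)
    (μ : (X : LinkedGroup) → (Fin g → X.A) → ℝ) : ℂ :=
  ∑' X : LinkedClass, ∑' f : Fin g → X.rep.A, tripleTerm q Lag g μ X.rep f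

end TQFT

open Classical in
/-- The measure `μ(A, ℓ, f) = λ^{rank A} |Tor A|^{-s} ∏ᵢ ν(fᵢ)`, with `ν` the indicator function of
`Tor A`. -/
def torsionMeasure (lam s : ℝ) {g : ℕ} (X : LinkedGroup) (f : Fin g → X.A) : ℝ :=
  lam ^ Module.finrank ℤ X.A * (Nat.card (AddCommGroup.torsion X.A) : ℝ) ^ (-s) *
    ∏ i, if f i ∈ AddCommGroup.torsion X.A then 1 else 0

/-! ### Untwisted Dijkgraaf–Witten theory -/

/-- The discriminant group `D = G ⊕ G*`, where `G* = hom(G, ℚ/ℤ)`. -/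
abbrev DWGroup (G : Type) [AddCommGroup G] : Type := G × (G →+ QZ)

/-- The quadratic form `q(a, α) = α(a)` on `G ⊕ G*`. -/
def dwForm (G : Type) [AddCommGroup G] (x : DWGroup G) : QZ := x.2 x.1

/-- The Lagrangian subgroup `G ⊕ 0` of the Neumann boundary condition. -/
def neumann (G : Type) [AddCommGroup G] : AddSubgroup (DWGroup G) := AddSubgroup.prod ⊤ ⊥

end AbelianTQFT

end

/-!
The function `e` being a character, the Dijkgraaf–Witten phase `(L ⊗ q)(x ⊕ c)` is, for fixed
`G*`-components `α` of `x`, linear in `c` and in the `G`-components of `x`. Summing over those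
first (`sum_phases`), orthogonality of characters leaves the number of `α` killed by the rows of the
linking matrix that meet the surgery link, and these `α` are the homomorphisms `A → G*` that vanish
on `f`. So `∑_c Z(A, ℓ, f; c)` does not depend on the surgery presentation: it is `p ^ (g - 1)`
times the number of such homomorphisms (`sum_partitionFunction`). A surgery presentation does
exist, which matters because the partition function is defined through one: linking forms are orthogonal sums of
cyclic forms and even binary forms over `ℤ / 2ᵏ` (`FormClass.induction_pieces`), and these are
presented by linear plumbings, that is, by continued fractions, and by matrices of size `2` and `3`.

Because of `ν`, only torsion `f` contribute. A nonzero homomorphism to a group of order `p` has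
kernel of index `p`, so the sum over `f` is elementary (`hasSum_tripleWeight`): a pair of rank `r`
with finite linking form `x` contributes
`(λ p) ^ r |x| ^ (-(s - g)) (p⁻¹ (p ^ g - 1) + p⁻¹ |hom(x, G*)|)`.
Pairs up to equivalence are the same as ranks together with isometry classes of finite linking forms
(`linkedClassEquiv`). The rank gives a geometric series, the first summand gives `Ξ(s - g)`, and it
remains to compare the sum of `|x| ^ (-u) |hom(x, G*)|` with the sum of `|x| ^ (-u)`.

Isometry classes form a commutative monoid `FormClass` under orthogonal sum, on which order, number
of homomorphisms to a fixed group and normalised Gauss sums are multiplicative. At the odd prime `p`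
a form is in a unique way a sum of pieces `x y / pᵐ` with any multiplicities, of pieces `r x y / pᵐ`
(`r` a nonresidue) with multiplicities at most one, and of a form of order prime to `p`
(`bijective_primaryForm_add`): existence holds because two pieces `r x y / pᵐ` are isometric to two
pieces `x y / pᵐ`, and uniqueness because a Gauss sum takes opposite values, of absolute
value strictly between `0` and `1`, on the two pieces of order `pᵐ`. Therefore both sums
have a local factor `∏ (1 + y m) / (1 - y m)` at `p`, where `y m` is the weight of a piece of order
`pᵐ`, namely `p ^ (1 - m u)` and `p ^ (-m u)`, and the same factor away from `p`
(`hasSum_homWeight`). Their quotient is the infinite product. Convergence for `u > 1` holds because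
the forms are generated by pieces whose orders have a summable `-u`-th power (`summable_card`).
-/

noncomputable section

namespace AbelianTQFT

/-! ### The character of `ℚ/ℤ` -/

theorem e_coe (r : ℚ) : e (r : QZ) = Complex.exp (2 * Real.pi * Complex.I * (r : ℂ)) := rfl

theorem e_zero : e 0 = 1 := by
  have := e_coe 0
  simpa using this

theorem e_add (s t : QZ) : e (s + t) = e s * e t := by
  induction s using QuotientAddGroup.induction_on with | H s => ?_
  induction t using QuotientAddGroup.induction_on with | H t => ?_
  change e (((s + t : ℚ)) : QZ) = e (s : QZ) * e (t : QZ)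
  rw [e_coe, e_coe, e_coe, ← Complex.exp_add]
  push_cast
  ring_nf

theorem e_eq_one_iff (t : QZ) : e t = 1 ↔ t = 0 := by
  refine ⟨fun h => ?_, fun h => h ▸ e_zero⟩
  induction t using QuotientAddGroup.induction_on with | H t => ?_
  change e (t : QZ) = 1 at h
  rw [e_coe, Complex.exp_eq_one_iff] at h
  obtain ⟨n, hn⟩ := h
  refine (AddCircle.coe_eq_zero_iff (1 : ℚ)).2 ⟨n, ?_⟩
  have h2 : (2 * Real.pi * Complex.I) ≠ 0 := Complex.two_pi_I_ne_zero
  have h3 : (t : ℂ) = n := by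
    apply mul_left_cancel₀ h2
    rw [hn, mul_comm]
  have h4 : t = n := by exact_mod_cast h3
  simp [h4]

theorem e_mul_e_neg (t : QZ) : e t * e (-t) = 1 := by
  rw [← e_add, add_neg_cancel, e_zero]

theorem norm_e (t : QZ) : ‖e t‖ = 1 := by
  induction t using QuotientAddGroup.induction_on with | H t => ?_
  rw [e_coe]
  have : (2 * Real.pi * Complex.I * (t : ℂ)) = ((2 * Real.pi * t : ℝ) : ℂ) * Complex.I := by
    push_cast; ring
  rw [this, Complex.norm_exp_ofReal_mul_I]

theorem star_e (t : QZ) : (starRingEnd ℂ) (e t) = e (-t) := by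
  have h := e_mul_e_neg t
  have h1 : e t * (starRingEnd ℂ) (e t) = 1 := by
    rw [Complex.mul_conj, Complex.normSq_eq_norm_sq, norm_e]; simp
  have h0 : e t ≠ 0 := left_ne_zero_of_mul_eq_one h
  exact mul_left_cancel₀ h0 (h1.trans h.symm)

open Classical in
/-- Orthogonality of characters: the sum of a character of a finite group vanishes unless the
character is trivial. -/
theorem sum_e {G : Type*} [AddCommGroup G] [Fintype G] (β : G →+ QZ) :
    ∑ a, e (β a) = if β = 0 then (Fintype.card G : ℂ) else 0 := by
  split_ifs with h
  · simp [h, e_zero]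
  · obtain ⟨b, hb⟩ : ∃ b, β b ≠ 0 := by
      by_contra! hc
      exact h (AddMonoidHom.ext hc)
    have h1 : e (β b) ≠ 1 := fun h => hb ((e_eq_one_iff _).1 h)
    have h2 : e (β b) * ∑ a, e (β a) = ∑ a, e (β a) := by
      rw [Finset.mul_sum]
      refine Fintype.sum_equiv (Equiv.addLeft b) _ _ fun a => ?_
      simp [e_add]
    have h3 : (e (β b) - 1) * ∑ a, e (β a) = 0 := by rw [sub_mul, h2]; ring
    exact (mul_eq_zero.1 h3).resolve_left (sub_ne_zero.2 h1)

/-! ### Cyclic groups inside `ℚ/ℤ` -/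

/-- The embedding `ℤ/n → ℚ/ℤ`, `x ↦ x / n`. -/
def cyc (n : ℕ) [NeZero n] : ZMod n →+ QZ :=
  ZMod.lift n ⟨zmultiplesHom QZ (((1 / n : ℚ)) : QZ), by
    have : (n : ℚ) ≠ 0 := by exact_mod_cast NeZero.ne n
    rw [zmultiplesHom_apply, ← AddCircle.coe_zsmul, AddCircle.coe_eq_zero_iff]
    refine ⟨1, ?_⟩
    simp [this]⟩

theorem cyc_intCast (n : ℕ) [NeZero n] (k : ℤ) : cyc n (k : ZMod n) = ((k / n : ℚ) : QZ) := by
  rw [cyc, ZMod.lift_coe]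
  simp only [zmultiplesHom_apply, ← AddCircle.coe_zsmul]
  congr 1
  simp [div_eq_mul_inv]

theorem coe_div_eq_zero_iff {n : ℤ} (hn : n ≠ 0) (k : ℤ) : ((k / n : ℚ) : QZ) = 0 ↔ n ∣ k := by
  have : (n : ℚ) ≠ 0 := by exact_mod_cast hn
  rw [AddCircle.coe_eq_zero_iff]
  constructor
  · rintro ⟨m, hm⟩
    refine ⟨m, ?_⟩
    rw [eq_div_iff this] at hm
    simp only [zsmul_eq_mul, mul_one] at hm
    have : ((m * n : ℤ) : ℚ) = (k : ℤ) := by push_cast; exact hm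
    rw [mul_comm]
    exact_mod_cast this.symm
  · rintro ⟨m, rfl⟩
    refine ⟨m, ?_⟩
    push_cast
    field_simp
    simp

theorem coe_intCast_eq_zero (k : ℤ) : ((k : ℚ) : QZ) = 0 := by
  simpa only [Int.cast_one, div_one] using (coe_div_eq_zero_iff one_ne_zero k).2 (one_dvd k)

theorem cyc_injective (n : ℕ) [NeZero n] : Function.Injective (cyc n) := by
  rw [injective_iff_map_eq_zero]
  intro a ha
  obtain ⟨k, rfl⟩ := ZMod.intCast_surjective a
  rw [cyc_intCast] at ha
  have := (coe_div_eq_zero_iff (n := n) (by exact_mod_cast NeZero.ne n) k).1 (by exact_mod_cast ha)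
  exact (ZMod.intCast_zmod_eq_zero_iff_dvd k n).2 this

theorem cyc_eq_zero_iff (n : ℕ) [NeZero n] (x : ZMod n) : cyc n x = 0 ↔ x = 0 :=
  map_eq_zero_iff _ (cyc_injective n)

/-- The `n`-torsion of `ℚ/ℤ` is `(1/n)ℤ/ℤ`. -/
theorem exists_cyc_eq (n : ℕ) [NeZero n] (t : QZ) (ht : n • t = 0) : ∃ x, cyc n x = t := by
  have hn : (n : ℚ) ≠ 0 := by exact_mod_cast NeZero.ne n
  induction t using QuotientAddGroup.induction_on with | H t => ?_
  change n • (t : QZ) = 0 at ht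
  rw [← AddCircle.coe_nsmul, AddCircle.coe_eq_zero_iff] at ht
  obtain ⟨k, hk⟩ := ht
  refine ⟨k, ?_⟩
  rw [cyc_intCast]
  change _ = (t : QZ)
  congr 1
  simp at hk
  field_simp
  rw [hk]

/-- Homomorphisms out of `ℤ/n` are determined by the image of `1`, which is any `n`-torsion
element. -/
def homZModEquiv (n : ℕ) (C : Type*) [AddCommGroup C] :
    (ZMod n →+ C) ≃ {c : C // n • c = 0} where
  toFun φ := ⟨φ 1, by rw [← map_nsmul]; simp⟩
  invFun c := ZMod.lift n ⟨zmultiplesHom C c.1, by simpa using c.2⟩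
  left_inv φ := by
    ext x
    obtain ⟨k, rfl⟩ := ZMod.intCast_surjective x
    rw [ZMod.lift_coe]
    simp [← map_zsmul]
  right_inv c := by
    ext
    simpa using ZMod.lift_coe n ⟨zmultiplesHom C c.1, by simpa using c.2⟩ 1

theorem card_dual_zmod (n : ℕ) [NeZero n] : Nat.card (ZMod n →+ QZ) = n := by
  rw [Nat.card_congr (homZModEquiv n QZ)]
  rw [← Nat.card_congr (Equiv.ofBijective
    (fun x : ZMod n => (⟨cyc n x, by rw [← map_nsmul]; simp⟩ : {c : QZ // n • c = 0})) ⟨?_, ?_⟩)]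
  · simp
  · intro x y h
    exact cyc_injective n (congrArg Subtype.val h)
  · rintro ⟨t, ht⟩
    obtain ⟨x, hx⟩ := exists_cyc_eq n t ht
    exact ⟨x, Subtype.ext hx⟩

theorem nsmul_dual_zmod (n : ℕ) (β : ZMod n →+ QZ) : n • β = 0 := by
  ext
  simp [← map_nsmul]

/-! ### The monoid of finite linking forms -/

/-- A finite abelian group with a non-degenerate symmetric bilinear form valued in `ℚ/ℤ`. -/
structure FiniteForm : Type 1 where
  T : Type
  [grp : AddCommGroup T]
  [fin : Finite T]
  form : T →+ T →+ QZ
  symm : ∀ x y, form x y = form y x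
  nondeg : ∀ x, (∀ y, form x y = 0) → x = 0

attribute [instance] FiniteForm.grp FiniteForm.fin

namespace FiniteForm

/-- Isometry of finite linking forms. -/
def Iso (X Y : FiniteForm) : Prop :=
  ∃ φ : X.T ≃+ Y.T, ∀ x y, Y.form (φ x) (φ y) = X.form x y

theorem Iso.refl (X : FiniteForm) : Iso X X := ⟨AddEquiv.refl _, fun _ _ => rfl⟩

theorem Iso.symm' {X Y : FiniteForm} : Iso X Y → Iso Y X := by
  rintro ⟨φ, h⟩
  exact ⟨φ.symm, fun x y => by rw [← h]; simp⟩

theorem Iso.trans' {X Y Z : FiniteForm} : Iso X Y → Iso Y Z → Iso X Z := by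
  rintro ⟨φ, h⟩ ⟨ψ, h'⟩
  exact ⟨φ.trans ψ, fun x y => by simp [h', h]⟩

instance setoid : Setoid FiniteForm := ⟨Iso, Iso.refl, Iso.symm', Iso.trans'⟩

/-- The orthogonal sum of two finite linking forms. -/
def prod (X Y : FiniteForm) : FiniteForm where
  T := X.T × Y.T
  form := AddMonoidHom.mk' (fun x => (X.form x.1).comp (AddMonoidHom.fst X.T Y.T) +
      (Y.form x.2).comp (AddMonoidHom.snd X.T Y.T)) (by
    intro a b
    refine AddMonoidHom.ext fun c => ?_
    simp only [Prod.fst_add, Prod.snd_add, map_add, AddMonoidHom.add_apply, AddMonoidHom.comp_apply]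
    abel)
  symm x y := by
    change X.form x.1 y.1 + Y.form x.2 y.2 = X.form y.1 x.1 + Y.form y.2 x.2
    rw [X.symm, Y.symm]
  nondeg x h := by
    change ∀ y : X.T × Y.T, X.form x.1 y.1 + Y.form x.2 y.2 = 0 at h
    refine Prod.ext (X.nondeg _ fun y => ?_) (Y.nondeg _ fun y => ?_)
    · simpa using h (y, 0)
    · simpa using h (0, y)

/-- The form on the trivial group. -/
def zero : FiniteForm where
  T := Unit
  form := 0
  symm _ _ := rfl
  nondeg _ _ := rfl

theorem Iso.prod {X X' Y Y' : FiniteForm} : Iso X X' → Iso Y Y' → Iso (X.prod Y) (X'.prod Y') := by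
  rintro ⟨φ, h⟩ ⟨ψ, h'⟩
  refine ⟨φ.prodCongr ψ, fun x y => ?_⟩
  change X'.form (φ x.1) (φ y.1) + Y'.form (ψ x.2) (ψ y.2) = X.form x.1 y.1 + Y.form x.2 y.2
  rw [h, h']

end FiniteForm

open FiniteForm

/-- Isometry classes of finite linking forms. Under orthogonal sum they form a commutative
monoid, and all enumeration below takes place in this monoid. -/
def FormClass : Type 1 := Quotient FiniteForm.setoid

/-- The isometry class of a finite linking form. -/
def FiniteForm.cls (X : FiniteForm) : FormClass := Quotient.mk _ X

namespace FormClass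

theorem cls_eq_iff {X Y : FiniteForm} : X.cls = Y.cls ↔ Iso X Y := Quotient.eq

@[elab_as_elim]
theorem ind {P : FormClass → Prop} (x : FormClass) (h : ∀ X : FiniteForm, P X.cls) : P x :=
  Quotient.ind h x

instance : Add FormClass := ⟨Quotient.map₂ FiniteForm.prod fun _ _ h _ _ h' => Iso.prod h h'⟩

instance : Zero FormClass := ⟨FiniteForm.zero.cls⟩

theorem cls_prod (X Y : FiniteForm) : (X.prod Y).cls = X.cls + Y.cls := rfl

theorem comm_aux (x y : FormClass) : x + y = y + x := by
  induction x using ind with | h X => ?_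
  induction y using ind with | h Y => ?_
  exact cls_eq_iff.2 ⟨AddEquiv.prodComm, fun a b => add_comm _ _⟩

theorem zero_aux (x : FormClass) : 0 + x = x := by
  induction x using ind with | h X => ?_
  refine cls_eq_iff.2 ⟨(AddEquiv.uniqueProd : Unit × X.T ≃+ X.T), fun a b => ?_⟩
  change X.form a.2 b.2 = (0 : QZ) + X.form a.2 b.2
  rw [zero_add]

instance : AddCommMonoid FormClass where
  add_assoc x y z := by
    induction x using ind with | h X => ?_
    induction y using ind with | h Y => ?_
    induction z using ind with | h Z => ?_
    exact cls_eq_iff.2 ⟨AddEquiv.prodAssoc, fun a b => (add_assoc _ _ _).symm⟩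
  zero_add := zero_aux
  add_zero x := by rw [comm_aux, zero_aux]
  add_comm := comm_aux
  nsmul := nsmulRec

/-- A form whose group has one element represents the class `0`. -/
theorem cls_eq_zero_of_subsingleton (X : FiniteForm) [Subsingleton X.T] : X.cls = 0 := by
  refine cls_eq_iff.2 ⟨⟨⟨fun _ => (), fun _ => 0, fun _ => Subsingleton.elim _ _, fun _ => rfl⟩,
    fun _ _ => rfl⟩, fun x y => ?_⟩
  change (0 : QZ) = _
  rw [Subsingleton.elim x 0]
  simp

/-! ### Multiplicative invariants -/

/-- A function on an additive monoid that turns sums into products. -/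
structure IsMult {M R : Type*} [AddCommMonoid M] [CommMonoid R] (w : M → R) : Prop where
  zero : w 0 = 1
  add : ∀ x y, w (x + y) = w x * w y

namespace IsMult

variable {M R : Type*} [AddCommMonoid M] [CommMonoid R] {w : M → R}

theorem nsmul (hw : IsMult w) (n : ℕ) (x : M) : w (n • x) = w x ^ n := by
  induction n with
  | zero => simp [hw.zero]
  | succ n ih => rw [succ_nsmul, hw.add, ih, pow_succ]

theorem sum (hw : IsMult w) {ι : Type*} (s : Finset ι) (f : ι → M) :
    w (∑ i ∈ s, f i) = ∏ i ∈ s, w (f i) := by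
  classical
  induction s using Finset.induction_on with
  | empty => simp [hw.zero]
  | insert a s ha ih => rw [Finset.sum_insert ha, Finset.prod_insert ha, hw.add, ih]

end IsMult

/-- The order of the underlying group. -/
def card (x : FormClass) : ℕ :=
  Quotient.lift (fun X : FiniteForm => Nat.card X.T)
    (fun X Y h => by obtain ⟨φ, -⟩ := h; exact Nat.card_congr φ.toEquiv) x

theorem card_cls (X : FiniteForm) : card X.cls = Nat.card X.T := rfl

theorem isMult_card : IsMult card where
  zero := by change Nat.card Unit = 1; simp
  add x y := by
    induction x using ind with | h X => ?_
    induction y using ind with | h Y => ?_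
    exact Nat.card_prod _ _

theorem card_ne_zero (x : FormClass) : card x ≠ 0 := by
  induction x using ind with | h X => ?_
  exact Nat.card_pos.ne'

/-- The number of homomorphisms from the underlying group to a fixed group `C`. -/
def homCard (C : Type) [AddCommGroup C] (x : FormClass) : ℕ :=
  Quotient.lift (fun X : FiniteForm => Nat.card (X.T →+ C))
    (fun X Y h => by
      obtain ⟨φ, -⟩ := h
      refine Nat.card_congr ⟨fun f => f.comp φ.symm.toAddMonoidHom,
        fun f => f.comp φ.toAddMonoidHom, fun f => ?_, fun f => ?_⟩ <;> ext <;> simp) x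

theorem homCard_cls (C : Type) [AddCommGroup C] (X : FiniteForm) :
    homCard C X.cls = Nat.card (X.T →+ C) := rfl

theorem isMult_homCard (C : Type) [AddCommGroup C] : IsMult (homCard C) where
  zero := by
    change Nat.card (Unit →+ C) = 1
    have : Unique (Unit →+ C) := ⟨⟨0⟩, fun f => AddMonoidHom.ext fun x => map_zero f⟩
    simp
  add x y := by
    induction x using ind with | h X => ?_
    induction y using ind with | h Y => ?_
    change Nat.card (X.T × Y.T →+ C) = Nat.card (X.T →+ C) * Nat.card (Y.T →+ C)
    rw [← Nat.card_prod]
    refine Nat.card_congr ⟨fun f => (f.comp (AddMonoidHom.inl _ _), f.comp (AddMonoidHom.inr _ _)),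
      fun f => f.1.coprod f.2, fun f => ?_, fun f => ?_⟩
    · exact AddMonoidHom.coprod_unique f
    · exact Prod.ext (AddMonoidHom.coprod_comp_inl _ _) (AddMonoidHom.coprod_comp_inr _ _)

/-- The normalised Gauss sum `|T|⁻¹ ∑_x exp (2 π i c ℓ(x, x))`. -/
def gauss (c : ℕ) (x : FormClass) : ℂ :=
  Quotient.lift (fun X : FiniteForm => (Nat.card X.T : ℂ)⁻¹ * ∑ᶠ x, e (c • X.form x x))
    (fun X Y h => by
      obtain ⟨φ, hφ⟩ := h
      rw [Nat.card_congr φ.toEquiv]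
      congr 1
      refine finsum_eq_of_bijective φ φ.bijective fun x => ?_
      rw [hφ]) x

theorem gauss_cls (c : ℕ) (X : FiniteForm) :
    gauss c X.cls = (Nat.card X.T : ℂ)⁻¹ * ∑ᶠ x, e (c • X.form x x) := rfl

theorem isMult_gauss (c : ℕ) : IsMult (gauss c) where
  zero := by
    change (Nat.card Unit : ℂ)⁻¹ * ∑ᶠ x : Unit, e (c • (0 : QZ)) = 1
    rw [finsum_unique]
    simp [e_zero]
  add x y := by
    induction x using ind with | h X => ?_
    induction y using ind with | h Y => ?_
    rw [← cls_prod, gauss_cls, gauss_cls, gauss_cls]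
    let := Fintype.ofFinite X.T
    let := Fintype.ofFinite Y.T
    let : Fintype (X.prod Y).T := inferInstanceAs (Fintype (X.T × Y.T))
    rw [finsum_eq_sum_of_fintype, finsum_eq_sum_of_fintype, finsum_eq_sum_of_fintype,
      show Nat.card (X.prod Y).T = Nat.card X.T * Nat.card Y.T from Nat.card_prod _ _]
    rw [Nat.cast_mul, mul_inv, mul_mul_mul_comm, Finset.sum_mul_sum, ← Finset.sum_product']
    congr 1
    refine Finset.sum_congr rfl fun a _ => ?_
    change e (c • (X.form a.1 a.1 + Y.form a.2 a.2)) = _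
    rw [smul_add, e_add]

/-! ### Cancellation for coprime orders -/

/-- An isometry of orthogonal sums restricts to the first summands: its mixed components vanish,
because the orders are coprime. -/
theorem iso_of_prod_iso {P Q P' Q' : FiniteForm} (h : Iso (P.prod Q) (P'.prod Q'))
    (h1 : (Nat.card P.T).Coprime (Nat.card Q'.T)) (h2 : (Nat.card P'.T).Coprime (Nat.card Q.T)) :
    Iso P P' := by
  have key : ∀ {A B : Type} [AddCommGroup A] [AddCommGroup B] [Finite A] [Finite B],
      (Nat.card A).Coprime (Nat.card B) → ∀ f : A →+ B, ∀ x, f x = 0 := by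
    intro A B _ _ _ _ h f x
    have hA : Nat.card A • f x = 0 := by rw [← map_nsmul, card_nsmul_eq_zero', map_zero]
    have hB : Nat.card B • f x = 0 := card_nsmul_eq_zero'
    rw [← AddMonoid.addOrderOf_eq_one_iff, ← Nat.dvd_one, ← h]
    exact Nat.dvd_gcd (addOrderOf_dvd_of_nsmul_eq_zero hA) (addOrderOf_dvd_of_nsmul_eq_zero hB)
  obtain ⟨φ, hφ⟩ := h
  change P.T × Q.T ≃+ P'.T × Q'.T at φ
  have a1 : ∀ x : P.T, (φ (x, 0)).2 = 0 := key h1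
    ((AddMonoidHom.snd P'.T Q'.T).comp (φ.toAddMonoidHom.comp (AddMonoidHom.inl P.T Q.T)))
  have a2 : ∀ x : P'.T, (φ.symm (x, 0)).2 = 0 := key h2
    ((AddMonoidHom.snd P.T Q.T).comp (φ.symm.toAddMonoidHom.comp (AddMonoidHom.inl P'.T Q'.T)))
  have b1 : ∀ x : P.T, φ (x, 0) = ((φ (x, 0)).1, 0) := fun x => Prod.ext rfl (a1 x)
  have b2 : ∀ x : P'.T, φ.symm (x, 0) = ((φ.symm (x, 0)).1, 0) := fun x => Prod.ext rfl (a2 x)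
  refine ⟨⟨⟨fun x => (φ (x, 0)).1, fun x => (φ.symm (x, 0)).1, fun x => ?_, fun x => ?_⟩,
    fun x y => ?_⟩, fun x y => ?_⟩
  · simp only [← b1, AddEquiv.symm_apply_apply]
  · simp only [← b2, AddEquiv.apply_symm_apply]
  · change (φ (x + y, 0)).1 = (φ (x, 0)).1 + (φ (y, 0)).1
    rw [← Prod.fst_add, ← map_add]
    simp
  · change P'.form (φ (x, 0)).1 (φ (y, 0)).1 = _
    have h := hφ (x, 0) (y, 0)
    change P'.form (φ (x, 0)).1 (φ (y, 0)).1 + Q'.form (φ (x, 0)).2 (φ (y, 0)).2 =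
      P.form x y + Q.form 0 0 at h
    rw [a1, a1] at h
    simpa using h

/-- A class decomposes in at most one way as a sum of classes whose orders are coprime in the
sense of the hypotheses. -/
theorem add_eq_add_of_coprime {P Q P' Q' : FormClass} (h : P + Q = P' + Q')
    (h1 : (card P).Coprime (card Q')) (h2 : (card P').Coprime (card Q)) : P = P' ∧ Q = Q' := by
  induction P using ind with | h P => ?_
  induction Q using ind with | h Q => ?_
  induction P' using ind with | h P' => ?_
  induction Q' using ind with | h Q' => ?_
  refine ⟨cls_eq_iff.2 (iso_of_prod_iso (cls_eq_iff.1 h) h1 h2), ?_⟩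
  rw [add_comm, add_comm P'.cls] at h
  exact cls_eq_iff.2 (iso_of_prod_iso (cls_eq_iff.1 h) h2.symm h1.symm)

end FormClass

open FormClass

/-! ### Cyclic and binary forms -/

/-- The form `(x, y) ↦ a x y / n` on `ℤ/n`, for a unit `a`. -/
abbrev cyclic (n : ℕ) [NeZero n] (a : (ZMod n)ˣ) : FiniteForm where
  T := ZMod n
  form := AddMonoidHom.mk' (fun x => (cyc n).comp (AddMonoidHom.mulLeft (a * x))) (by
    intro x y
    refine AddMonoidHom.ext fun z => ?_
    simp [mul_add, add_mul])
  symm x y := by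
    change cyc n (a * x * y) = cyc n (a * y * x)
    ring_nf
  nondeg x h := by
    change ∀ y : ZMod n, cyc n (a * x * y) = 0 at h
    simpa [cyc_eq_zero_iff] using h 1

/-- The form on `(ℤ/n)²` with Gram matrix `(α β; β γ) / n`, of unit determinant. -/
abbrev binary (n : ℕ) [NeZero n] (α β γ : ZMod n) (h : IsUnit (α * γ - β ^ 2)) : FiniteForm where
  T := ZMod n × ZMod n
  form := AddMonoidHom.mk' (fun x => (cyc n).comp
    ((AddMonoidHom.mulLeft (α * x.1 + β * x.2)).coprod
      (AddMonoidHom.mulLeft (β * x.1 + γ * x.2)))) (by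
    intro x y
    refine AddMonoidHom.ext fun z => ?_
    simp only [AddMonoidHom.comp_apply, AddMonoidHom.coprod_apply, AddMonoidHom.add_apply,
      AddMonoidHom.coe_mulLeft, Prod.fst_add, Prod.snd_add, ← map_add]
    ring_nf)
  symm x y := by
    change cyc n ((α * x.1 + β * x.2) * y.1 + (β * x.1 + γ * x.2) * y.2) =
      cyc n ((α * y.1 + β * y.2) * x.1 + (β * y.1 + γ * y.2) * x.2)
    ring_nf
  nondeg x h' := by
    change ∀ y : ZMod n × ZMod n,
      cyc n ((α * x.1 + β * x.2) * y.1 + (β * x.1 + γ * x.2) * y.2) = 0 at h'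
    have h1 : α * x.1 + β * x.2 = 0 := (cyc_eq_zero_iff n _).1 (by simpa using h' (1, 0))
    have h2 : β * x.1 + γ * x.2 = 0 := (cyc_eq_zero_iff n _).1 (by simpa using h' (0, 1))
    refine Prod.ext ?_ ?_
    · refine (h.mul_right_eq_zero).1 ?_
      linear_combination γ * h1 - β * h2
    · refine (h.mul_right_eq_zero).1 ?_
      linear_combination α * h2 - β * h1

theorem cyclic_form (n : ℕ) [NeZero n] (a : (ZMod n)ˣ) (x y : ZMod n) :
    (cyclic n a).form x y = cyc n (a * x * y) := rfl

theorem binary_form (n : ℕ) [NeZero n] (α β γ : ZMod n) (h : IsUnit (α * γ - β ^ 2))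
    (x y : ZMod n × ZMod n) : (binary n α β γ h).form x y =
      cyc n ((α * x.1 + β * x.2) * y.1 + (β * x.1 + γ * x.2) * y.2) := rfl

theorem card_cyclic (n : ℕ) [NeZero n] (a : (ZMod n)ˣ) : card (cyclic n a).cls = n :=
  Nat.card_zmod n

theorem card_binary (n : ℕ) [NeZero n] (α β γ : ZMod n) (h : IsUnit (α * γ - β ^ 2)) :
    card (binary n α β γ h).cls = n ^ 2 := by
  change Nat.card (ZMod n × ZMod n) = _
  rw [Nat.card_prod, Nat.card_zmod, sq]

/-! ### Splitting off non-degenerate subgroups -/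

/-- An isometrically embedded form is an orthogonal summand as soon as every element of the
ambient group has an orthogonal projection to it. -/
theorem exists_cls_eq_add (P X : FiniteForm) (i : P.T →+ X.T)
    (hi : ∀ x y, X.form (i x) (i y) = P.form x y)
    (hs : ∀ y, ∃ h, ∀ h', X.form (y - i h) (i h') = 0) :
    ∃ Y : FiniteForm, X.cls = P.cls + Y.cls := by
  let S : AddSubgroup X.T :=
    { carrier := {y | ∀ h', X.form y (i h') = 0}
      zero_mem' := fun h' => by simp
      add_mem' := fun {a b} ha hb h' => by
        rw [map_add, AddMonoidHom.add_apply, ha h', hb h', add_zero]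
      neg_mem' := fun {a} ha h' => by rw [map_neg, AddMonoidHom.neg_apply, ha h', neg_zero] }
  have hS : ∀ y : S, ∀ h', X.form y (i h') = 0 := fun y => y.2
  have hS' : ∀ y : S, ∀ h', X.form (i h') y = 0 := fun y h' => by rw [X.symm, hS]
  let Y : FiniteForm :=
    { T := S
      form := (X.form.comp S.subtype).compr₂ (AddMonoidHom.id QZ) |>.flip.comp S.subtype |>.flip
      symm := fun x y => X.symm _ _
      nondeg := fun x hx => by
        refine Subtype.ext (X.nondeg _ fun z => ?_)
        obtain ⟨h, hh⟩ := hs z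
        have h1 : X.form x (z - i h) = 0 := hx ⟨z - i h, hh⟩
        rw [map_sub, hS, sub_zero] at h1
        exact h1 }
  have hY : ∀ x y : S, Y.form x y = X.form x y := fun x y => rfl
  refine ⟨Y, Eq.symm (cls_eq_iff.2 ⟨AddEquiv.ofBijective (i.coprod S.subtype : P.T × S →+ X.T)
    ⟨?_, fun y => ?_⟩, ?_⟩)⟩
  · refine (injective_iff_map_eq_zero (i.coprod S.subtype : P.T × S →+ X.T)).2 ?_
    rintro ⟨h, s⟩ h0
    change i h + s = 0 at h0
    have h1 : h = 0 := by
      refine P.nondeg _ fun h' => ?_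
      have := congrArg (fun x => X.form x (i h')) h0
      simp only [map_add, AddMonoidHom.add_apply, hS, hi, add_zero, map_zero,
        AddMonoidHom.zero_apply] at this
      exact this
    subst h1
    rw [map_zero, zero_add] at h0
    exact Prod.ext rfl (Subtype.ext h0)
  · obtain ⟨h, hh⟩ := hs y
    exact ⟨(h, ⟨y - i h, hh⟩), add_sub_cancel _ _⟩
  · intro a b
    change X.form (i a.1 + a.2) (i b.1 + b.2) = P.form a.1 b.1 + X.form a.2 b.2
    simp only [map_add, AddMonoidHom.add_apply, hS, hS', hi]
    abel

/-- The homomorphism `ℤ/n → T` sending `1` to an `n`-torsion element `x`. -/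
def zmodHom {T : Type*} [AddCommGroup T] (n : ℕ) (x : T) (hx : n • x = 0) : ZMod n →+ T :=
  ZMod.lift n ⟨zmultiplesHom T x, by simpa using hx⟩

theorem zmodHom_intCast {T : Type*} [AddCommGroup T] (n : ℕ) (x : T) (hx : n • x = 0) (k : ℤ) :
    zmodHom n x hx k = k • x := by
  rw [zmodHom, ZMod.lift_coe]
  rfl

theorem map_zmodHom {T : Type*} [AddCommGroup T] (n : ℕ) [NeZero n] (x : T) (hx : n • x = 0)
    (χ : T →+ QZ) {c : ZMod n} (hc : χ x = cyc n c) (h : ZMod n) :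
    χ (zmodHom n x hx h) = cyc n (c * h) := by
  obtain ⟨k, rfl⟩ := ZMod.intCast_surjective h
  rw [zmodHom_intCast, map_zsmul, hc, ← map_zsmul, zsmul_eq_mul, mul_comm]

theorem exists_form_eq_cyc (X : FiniteForm) (n : ℕ) [NeZero n] {x : X.T} (hx : n • x = 0)
    (y : X.T) : ∃ a, X.form x y = cyc n a := by
  obtain ⟨a, ha⟩ := exists_cyc_eq n (X.form x y) (by
    rw [← AddMonoidHom.nsmul_apply, ← map_nsmul, hx]; simp)
  exact ⟨a, ha.symm⟩

/-- An element of order dividing `n` whose norm is a unit over `n` splits off a cyclic form. -/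
theorem exists_cls_eq_cyclic_add (X : FiniteForm) (n : ℕ) [NeZero n] (x : X.T) (hx : n • x = 0)
    (a : (ZMod n)ˣ) (ha : X.form x x = cyc n a) :
    ∃ Y : FiniteForm, X.cls = (cyclic n a).cls + Y.cls := by
  refine exists_cls_eq_add (cyclic n a) X (zmodHom n x hx) (fun h h' => ?_) fun y => ?_
  · change ZMod n at h h'
    rw [cyclic_form, map_zmodHom (c := (a : ZMod n) * h)]
    rw [X.symm, map_zmodHom (c := a) _ _ _ _ ha]
  · obtain ⟨b, hb⟩ := exists_form_eq_cyc X n hx y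
    refine ⟨((a⁻¹ : (ZMod n)ˣ) : ZMod n) * b, fun h' => ?_⟩
    rw [map_zmodHom (c := 0), zero_mul, map_zero]
    rw [map_zero, map_sub, AddMonoidHom.sub_apply, X.symm _ x, X.symm _ x, hb,
      map_zmodHom (c := a) _ _ _ _ ha]
    simp

theorem exists_cls_eq_binary_add (X : FiniteForm) (n : ℕ) [NeZero n] (u w : X.T) (hu : n • u = 0)
    (hw : n • w = 0) (α β γ : ZMod n) (h : IsUnit (α * γ - β ^ 2)) (huu : X.form u u = cyc n α)
    (huw : X.form u w = cyc n β) (hww : X.form w w = cyc n γ) :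
    ∃ Y : FiniteForm, X.cls = (binary n α β γ h).cls + Y.cls := by
  have hwu : X.form w u = cyc n β := by rw [X.symm, huw]
  have e1 : ∀ x : ZMod n × ZMod n, X.form u ((zmodHom n u hu).coprod (zmodHom n w hw) x) =
      cyc n (α * x.1 + β * x.2) := by
    intro x
    rw [AddMonoidHom.coprod_apply, map_add, map_zmodHom (c := α) _ _ _ _ huu,
      map_zmodHom (c := β) _ _ _ _ huw, map_add]
  have e2 : ∀ x : ZMod n × ZMod n, X.form w ((zmodHom n u hu).coprod (zmodHom n w hw) x) =
      cyc n (β * x.1 + γ * x.2) := by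
    intro x
    rw [AddMonoidHom.coprod_apply, map_add, map_zmodHom (c := β) _ _ _ _ hwu,
      map_zmodHom (c := γ) _ _ _ _ hww, map_add]
  have e3 : ∀ (y : X.T) (r s : ZMod n), X.form u y = cyc n r → X.form w y = cyc n s →
      ∀ x : ZMod n × ZMod n, X.form y ((zmodHom n u hu).coprod (zmodHom n w hw) x) =
      cyc n (r * x.1 + s * x.2) := by
    intro y r s hr hs x
    rw [AddMonoidHom.coprod_apply, map_add, map_zmodHom (c := r) _ _ _ _ (by rw [X.symm, hr]),
      map_zmodHom (c := s) _ _ _ _ (by rw [X.symm, hs]), map_add]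
  refine exists_cls_eq_add (binary n α β γ h) X ((zmodHom n u hu).coprod (zmodHom n w hw))
    (fun x x' => ?_) fun y => ?_
  · rw [binary_form]
    exact e3 _ _ _ (e1 _) (e2 _) _
  · obtain ⟨r, hr⟩ := exists_form_eq_cyc X n hu y
    obtain ⟨s, hs⟩ := exists_form_eq_cyc X n hw y
    have hh := h
    obtain ⟨D, hD⟩ := hh
    have hD' : (α * γ - β ^ 2) * (D⁻¹ : (ZMod n)ˣ) = 1 := by rw [← hD]; simp
    refine ⟨(((D⁻¹ : (ZMod n)ˣ) : ZMod n) * (γ * r - β * s),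
      ((D⁻¹ : (ZMod n)ˣ) : ZMod n) * (α * s - β * r)), fun h' => ?_⟩
    refine (e3 _ 0 0 ?_ ?_ h').trans (by simp)
    · rw [map_sub, hr, e1, ← map_sub]
      congr 1
      linear_combination (-r) * hD'
    · rw [map_sub, hs, e2, ← map_sub]
      congr 1
      linear_combination (-s) * hD'

/-! ### Residues modulo prime powers -/

theorem zmod_isUnit_or {q k : ℕ} [Fact q.Prime] (a : ZMod (q ^ k)) : IsUnit a ∨ ∃ b, a = q * b := by
  have : NeZero (q ^ k) := ⟨pow_ne_zero _ (Fact.out : q.Prime).ne_zero⟩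
  obtain ⟨m, rfl⟩ := ZMod.natCast_zmod_surjective a
  by_cases h : q ∣ m
  · obtain ⟨b, rfl⟩ := h
    exact Or.inr ⟨b, by push_cast; rfl⟩
  · refine Or.inl ((ZMod.isUnit_iff_coprime m _).2 ?_)
    exact Nat.Coprime.pow_right _ (((Nat.Prime.coprime_iff_not_dvd Fact.out).2 h).symm)

theorem zmod_pow_pred_mul {q k : ℕ} (hk : k ≠ 0) (b : ZMod (q ^ k)) :
    (q : ZMod (q ^ k)) ^ (k - 1) * (q * b) = 0 := by
  rw [← mul_assoc, ← pow_succ, Nat.sub_add_cancel (Nat.pos_of_ne_zero hk), ← Nat.cast_pow,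
    ZMod.natCast_self, zero_mul]

theorem zmod_isUnit_iff {q k : ℕ} [Fact q.Prime] (hk : k ≠ 0) (a : ZMod (q ^ k)) :
    IsUnit a ↔ (q : ZMod (q ^ k)) ^ (k - 1) * a ≠ 0 := by
  constructor
  · intro h h0
    rw [h.mul_left_eq_zero, ← Nat.cast_pow, ZMod.natCast_eq_zero_iff] at h0
    have := (Nat.pow_dvd_pow_iff_le_right (Fact.out : q.Prime).one_lt).1 h0
    omega
  · intro h
    rcases zmod_isUnit_or a with h1 | ⟨b, rfl⟩
    · exact h1
    · exact absurd (zmod_pow_pred_mul hk b) h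

/-! ### Decomposition into cyclic and binary forms -/

theorem zmod_two_pow_even_or_odd {k : ℕ} (a : ZMod (2 ^ k)) :
    (∃ b, a = 2 * b) ∨ ∃ b, a = 1 + 2 * b := by
  obtain ⟨m, rfl⟩ := ZMod.intCast_surjective a
  rcases Int.even_or_odd' m with ⟨b, rfl | rfl⟩
  · exact Or.inl ⟨b, by push_cast; rfl⟩
  · exact Or.inr ⟨b, by push_cast; ring⟩

theorem zmod_isUnit_one_add_two_mul {k : ℕ} (b : ZMod (2 ^ k)) : IsUnit (1 + 2 * b) := by
  have h2 : IsNilpotent (2 * b) := by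
    refine (Commute.all _ _).isNilpotent_mul_right ⟨k, ?_⟩
    exact_mod_cast ZMod.natCast_self (2 ^ k)
  exact h2.isUnit_one_add

/-- Quadratic equations with odd linear and even constant coefficient are solvable modulo powers
of two: `x ↦ a x² + x` is injective, hence surjective, on even residues. -/
theorem exists_quadratic_root {k : ℕ} (a c : ZMod (2 ^ k)) : ∃ t, a * t ^ 2 + t + 2 * c = 0 := by
  let E := {x : ZMod (2 ^ k) // ∃ b, x = 2 * b}
  let f : E → E := fun x => ⟨a * x.1 ^ 2 + x.1, by
    obtain ⟨x, b, rfl⟩ := x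
    exact ⟨a * (2 * b ^ 2) + b, by ring⟩⟩
  have hf : Function.Injective f := by
    rintro ⟨_, x, rfl⟩ ⟨_, y, rfl⟩ h
    have h1 : a * (2 * x) ^ 2 + 2 * x = a * (2 * y) ^ 2 + 2 * y := congrArg Subtype.val h
    refine Subtype.ext ?_
    change 2 * x = 2 * y
    rw [← sub_eq_zero]
    refine (zmod_isUnit_one_add_two_mul (a * (x + y))).mul_right_eq_zero.1 ?_
    linear_combination h1
  obtain ⟨⟨t, ht⟩, h⟩ := (Finite.injective_iff_surjective.1 hf) ⟨2 * (-c), -c, rfl⟩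
  have h1 : a * t ^ 2 + t = 2 * (-c) := congrArg Subtype.val h
  exact ⟨t, by linear_combination h1⟩

instance (k : ℕ) : NeZero (2 ^ k) := ⟨by positivity⟩

theorem isUnit_hyperbolic (k : ℕ) : IsUnit ((0 : ZMod (2 ^ k)) * 0 - 1 ^ 2) := by
  simp

theorem isUnit_det_two_one_two (k : ℕ) : IsUnit ((2 : ZMod (2 ^ k)) * 2 - 1 ^ 2) := by
  have := zmod_isUnit_one_add_two_mul (1 : ZMod (2 ^ k))
  convert this using 1
  ring

/-- The two even binary forms on `(ℤ/2ᵏ)²`, with Gram matrices `(0 1; 1 0) / 2ᵏ` and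
`(2 1; 1 2) / 2ᵏ`. -/
def evenForm (k : ℕ) : Bool → FiniteForm
  | false => binary (2 ^ k) 0 1 0 (isUnit_hyperbolic k)
  | true => binary (2 ^ k) 2 1 2 (isUnit_det_two_one_two k)

theorem card_evenForm (k : ℕ) (b : Bool) : card (evenForm k b).cls = (2 ^ k) ^ 2 := by
  cases b
  · exact card_binary _ 0 1 0 (isUnit_hyperbolic k)
  · exact card_binary _ 2 1 2 (isUnit_det_two_one_two k)

/-- An isotropic vector paired to a unit with a vector of even norm splits off a hyperbolic
plane. -/
theorem exists_cls_eq_hyperbolic_add {k : ℕ} (X : FiniteForm) (u w : X.T) (hu : 2 ^ k • u = 0)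
    (hw : 2 ^ k • w = 0) {b c : ZMod (2 ^ k)} (hb : IsUnit b) (huu : X.form u u = 0)
    (huw : X.form u w = cyc (2 ^ k) b) (hww : X.form w w = cyc (2 ^ k) (2 * c)) :
    ∃ Y : FiniteForm, X.cls = (evenForm k false).cls + Y.cls := by
  obtain ⟨b, rfl⟩ := hb
  obtain ⟨m, hm⟩ := ZMod.intCast_surjective ((b⁻¹ : (ZMod (2 ^ k))ˣ) : ZMod (2 ^ k))
  obtain ⟨d, hd⟩ := ZMod.intCast_surjective (((b⁻¹ : (ZMod (2 ^ k))ˣ) : ZMod (2 ^ k)) ^ 2 * c)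
  have hbm : (b : ZMod (2 ^ k)) * (m : ZMod (2 ^ k)) = 1 := by rw [hm]; simp
  rw [← hm] at hd
  refine exists_cls_eq_binary_add X (2 ^ k) u (m • w - d • u) hu ?_ 0 1 0
    (isUnit_hyperbolic k) (by simpa using huu)
    ?_ ?_
  · rw [smul_sub, smul_comm, hw, smul_comm, hu]; simp
  · rw [map_sub, map_zsmul, map_zsmul, huu, huw, ← map_zsmul, smul_zero, sub_zero]
    congr 1
    rw [zsmul_eq_mul]
    linear_combination hbm
  · simp only [map_sub, map_zsmul, AddMonoidHom.sub_apply, AddMonoidHom.zsmul_apply, huu, huw, hww,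
      X.symm w u]
    simp only [← map_zsmul, ← map_sub, smul_zero, sub_zero, zsmul_eq_mul]
    congr 1
    linear_combination (-2 * (d : ZMod (2 ^ k))) * hbm - 2 * hd

/-- The same for a vector `u` of norm `2` and a vector of norm twice a unit: they split off the
form `(2 1; 1 2)`. -/
theorem exists_cls_eq_two_one_two_add {k : ℕ} (X : FiniteForm) (u w : X.T) (hu : 2 ^ k • u = 0)
    (hw : 2 ^ k • w = 0) {b c : ZMod (2 ^ k)} (hb : IsUnit b)
    (huu : X.form u u = cyc (2 ^ k) 2) (huw : X.form u w = cyc (2 ^ k) b)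
    (hww : X.form w w = cyc (2 ^ k) (2 * (1 + 2 * c))) :
    ∃ Y : FiniteForm, X.cls = (evenForm k true).cls + Y.cls := by
  obtain ⟨b, rfl⟩ := hb
  obtain ⟨r, hr⟩ := ZMod.intCast_surjective ((b⁻¹ : (ZMod (2 ^ k))ˣ) : ZMod (2 ^ k))
  have hbr : (b : ZMod (2 ^ k)) * (r : ZMod (2 ^ k)) = 1 := by rw [hr]; simp
  -- The vector `r w` has norm `2 d` with `d = r² (1 + 2 c)` odd.
  obtain ⟨d, hd⟩ : ∃ d : ZMod (2 ^ k), (r : ZMod (2 ^ k)) ^ 2 * (1 + 2 * c) = 1 + 2 * d := by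
    rcases zmod_two_pow_even_or_odd ((r : ZMod (2 ^ k)) ^ 2 * (1 + 2 * c)) with ⟨d, hd⟩ | h
    · obtain ⟨v, hv⟩ := (zmod_isUnit_one_add_two_mul c).exists_right_inv
      have h1 : (1 : ZMod (2 ^ k)) = 2 * (d * b ^ 2 * v) := by
        linear_combination (b ^ 2 * v : ZMod (2 ^ k)) * hd -
          (1 + (b : ZMod (2 ^ k)) * r) * (1 + 2 * c) * v * hbr - hv
      refine ⟨(r : ZMod (2 ^ k)) ^ 2 * (1 + 2 * c) * (d * b ^ 2 * v) - d * b ^ 2 * v, ?_⟩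
      linear_combination ((r : ZMod (2 ^ k)) ^ 2 * (1 + 2 * c) - 1) * h1
    · exact h
  -- With `w' = (1 - 2 s) r w + s u` the norm condition is a quadratic equation for `s`.
  obtain ⟨D, hD⟩ := (zmod_isUnit_one_add_two_mul (1 + 4 * d)).exists_right_inv
  obtain ⟨s', hs'⟩ := exists_quadratic_root (-1) (-d * D)
  obtain ⟨s, rfl⟩ := ZMod.intCast_surjective s'
  have hs : (1 + 2 * (1 + 4 * d)) * ((s : ZMod (2 ^ k)) ^ 2 - s) = - 2 * d := by
    linear_combination (-(1 + 2 * (1 + 4 * d))) * hs' - 2 * d * hD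
  refine exists_cls_eq_binary_add X (2 ^ k) u (((1 - 2 * s) * r) • w + s • u) hu ?_ 2 1 2
    (isUnit_det_two_one_two k) huu
    ?_ ?_
  · rw [smul_add, smul_comm, hw, smul_comm, hu]; simp
  · rw [map_add, map_zsmul, map_zsmul, huu, huw, ← map_zsmul, ← map_zsmul, ← map_add]
    congr 1
    simp only [zsmul_eq_mul]
    push_cast
    linear_combination (1 - 2 * (s : ZMod (2 ^ k))) * hbr
  · simp only [map_add, map_zsmul, AddMonoidHom.add_apply, AddMonoidHom.zsmul_apply, huu, huw, hww,
      X.symm w u]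
    simp only [← map_zsmul, ← map_add, zsmul_eq_mul]
    congr 1
    push_cast
    linear_combination 2 * (1 - 2 * (s : ZMod (2 ^ k))) ^ 2 * hd +
      2 * (1 - 2 * (s : ZMod (2 ^ k))) * s * hbr + 2 * hs

/-- Two elements of order dividing `2ᵏ`, of even norms and with pairing a unit, split off one of
the two even binary forms. -/
theorem exists_cls_eq_evenForm_add {k : ℕ} (X : FiniteForm) (z y : X.T) (hz : 2 ^ k • z = 0)
    (hy : 2 ^ k • y = 0) {a b c : ZMod (2 ^ k)} (hb : IsUnit b)
    (hzz : X.form z z = cyc (2 ^ k) (2 * a)) (hzy : X.form z y = cyc (2 ^ k) b)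
    (hyy : X.form y y = cyc (2 ^ k) (2 * c)) :
    ∃ (ε : Bool) (Y : FiniteForm), X.cls = (evenForm k ε).cls + Y.cls := by
  obtain ⟨b, rfl⟩ := hb
  obtain ⟨m, hm⟩ := ZMod.intCast_surjective ((b⁻¹ : (ZMod (2 ^ k))ˣ) : ZMod (2 ^ k))
  have hbm : (b : ZMod (2 ^ k)) * (m : ZMod (2 ^ k)) = 1 := by rw [hm]; simp
  -- Scaling `z` makes the pairing equal to `1 / 2ᵏ`.
  obtain ⟨z', hz', hzz', hzy'⟩ : ∃ z' : X.T, 2 ^ k • z' = 0 ∧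
      X.form z' z' = cyc (2 ^ k) (2 * (m ^ 2 * a)) ∧ X.form z' y = cyc (2 ^ k) 1 := by
    refine ⟨m • z, by rw [smul_comm, hz, smul_zero], ?_, ?_⟩
    · simp only [map_zsmul, AddMonoidHom.zsmul_apply, hzz]
      simp only [← map_zsmul, zsmul_eq_mul]
      ring_nf
    · simp only [map_zsmul, AddMonoidHom.zsmul_apply, hzy]
      simp only [← map_zsmul, zsmul_eq_mul]
      rw [mul_comm, hbm]
  generalize (m : ZMod (2 ^ k)) ^ 2 * a = a' at hzz'
  -- The vector `u = t z' + y`, its norm and its pairing with `z'`.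
  have key : ∀ t : ℤ, 2 ^ k • (t • z' + y) = 0 ∧
      X.form (t • z' + y) (t • z' + y) = cyc (2 ^ k) (2 * (a' * t ^ 2 + t + c)) ∧
      X.form (t • z' + y) z' = cyc (2 ^ k) (1 + 2 * (a' * t)) := by
    intro t
    refine ⟨by rw [smul_add, smul_comm, hz', hy]; simp, ?_, ?_⟩
    · simp only [map_add, map_zsmul, AddMonoidHom.add_apply, AddMonoidHom.zsmul_apply, hzz', hzy',
        hyy, X.symm y z']
      simp only [← map_zsmul, ← map_add, zsmul_eq_mul]
      ring_nf
    · simp only [map_add, map_zsmul, AddMonoidHom.add_apply, AddMonoidHom.zsmul_apply, hzz', hzy',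
        X.symm y z']
      simp only [← map_zsmul, ← map_add, zsmul_eq_mul]
      ring_nf
  rcases zmod_two_pow_even_or_odd c with ⟨c', rfl⟩ | ⟨c', rfl⟩
  · obtain ⟨t', ht⟩ := exists_quadratic_root a' c'
    obtain ⟨t, rfl⟩ := ZMod.intCast_surjective t'
    obtain ⟨h1, h2, h3⟩ := key t
    rw [ht, mul_zero, map_zero] at h2
    exact ⟨false, exists_cls_eq_hyperbolic_add X _ z' h1 hz' (zmod_isUnit_one_add_two_mul _)
      h2 h3 hzz'⟩
  · rcases zmod_two_pow_even_or_odd a' with ⟨a', rfl⟩ | ⟨a', rfl⟩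
    · -- Exchange the roles of the two vectors.
      obtain ⟨t', ht⟩ := exists_quadratic_root (1 + 2 * c') a'
      obtain ⟨t, rfl⟩ := ZMod.intCast_surjective t'
      refine ⟨false, exists_cls_eq_hyperbolic_add X (t • y + z') y (b := 1 + 2 * ((1 + 2 * c') * t))
        ?_ hy (zmod_isUnit_one_add_two_mul _) ?_ ?_ hyy⟩
      · rw [smul_add, smul_comm, hz', hy]; simp
      · simp only [map_add, map_zsmul, AddMonoidHom.add_apply, AddMonoidHom.zsmul_apply, hzz', hzy',
          hyy, X.symm y z']
        simp only [← map_zsmul, ← map_add, zsmul_eq_mul]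
        rw [cyc_eq_zero_iff]
        linear_combination 2 * ht
      · simp only [map_add, map_zsmul, AddMonoidHom.add_apply, AddMonoidHom.zsmul_apply, hzy',
          hyy]
        simp only [← map_zsmul, ← map_add, zsmul_eq_mul]
        ring_nf
    · obtain ⟨t', ht⟩ := exists_quadratic_root (1 + 2 * a') c'
      obtain ⟨t, rfl⟩ := ZMod.intCast_surjective t'
      obtain ⟨h1, h2, h3⟩ := key t
      refine ⟨true, exists_cls_eq_two_one_two_add X _ z' h1 hz' (zmod_isUnit_one_add_two_mul _)
        ?_ h3 hzz'⟩
      rw [h2]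
      congr 1
      linear_combination 2 * ht

instance (q k : ℕ) [Fact q.Prime] : NeZero (q ^ k) :=
  ⟨pow_ne_zero _ (Fact.out : q.Prime).ne_zero⟩

/-- In the `q`-primary part there are two elements whose pairing has order the exponent `qᵏ`
of that part. -/
theorem exists_pairing_of_max_order (X : FiniteForm) (q : ℕ) [hq : Fact q.Prime]
    (hX : q ∣ Nat.card X.T) : ∃ (k : ℕ) (z y : X.T), k ≠ 0 ∧ q ^ k • z = 0 ∧ q ^ k • y = 0 ∧
      q ^ (k - 1) • X.form z y ≠ 0 := by
  classical
  obtain ⟨N, n', hn', hN⟩ := Nat.exists_eq_pow_mul_and_not_dvd (Nat.card_pos (α := X.T)).ne' q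
    hq.out.ne_one
  have hex : ∃ k, ∀ y : X.T, q ^ N • y = 0 → q ^ k • y = 0 := ⟨N, fun y h => h⟩
  have hk := Nat.find_spec hex
  set k := Nat.find hex with hk_def
  have hk0 : k ≠ 0 := by
    intro h0
    rw [h0] at hk
    obtain ⟨x, hx⟩ := exists_prime_addOrderOf_dvd_card' q hX
    have hqx : q • x = 0 := by rw [← hx]; exact addOrderOf_nsmul_eq_zero x
    have hN0 : N ≠ 0 := by
      rintro rfl
      rw [hN] at hX
      exact hn' (by simpa using hX)
    have : q ^ N • x = 0 := by
      obtain ⟨M, rfl⟩ := Nat.exists_eq_succ_of_ne_zero hN0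
      rw [pow_succ, mul_smul, hqx, smul_zero]
    have hx0 := hk x this
    simp only [pow_zero, one_smul] at hx0
    rw [hx0, addOrderOf_zero] at hx
    exact hq.out.ne_one hx.symm
  have hlt := Nat.find_min hex (m := k - 1) (by omega)
  push Not at hlt
  obtain ⟨z, hz, hz'⟩ := hlt
  obtain ⟨y, hy⟩ : ∃ y, X.form (q ^ (k - 1) • z) y ≠ 0 := by
    by_contra! h
    exact hz' (X.nondeg _ h)
  have hz0 := hk z hz
  refine ⟨k, z, n' • y, hk0, hz0, hk _ ?_, fun h => hy ?_⟩
  · rw [← mul_smul, ← hN, card_nsmul_eq_zero']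
  · have h1 : n' • X.form (q ^ (k - 1) • z) y = 0 := by
      rw [map_nsmul, AddMonoidHom.nsmul_apply, smul_comm, ← map_nsmul (X.form z)]
      exact h
    have h2 : q • X.form (q ^ (k - 1) • z) y = 0 := by
      rw [← AddMonoidHom.nsmul_apply, ← map_nsmul, ← mul_smul, ← pow_succ',
        Nat.sub_add_cancel (Nat.pos_of_ne_zero hk0), hz0]
      simp
    have h3 := Nat.dvd_gcd (addOrderOf_dvd_of_nsmul_eq_zero h2) (addOrderOf_dvd_of_nsmul_eq_zero h1)
    rw [(Nat.Prime.coprime_iff_not_dvd hq.out).2 hn'] at h3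
    exact AddMonoid.addOrderOf_eq_one_iff.1 (Nat.dvd_one.1 h3)

/-- A nontrivial form splits off a cyclic form of prime power order or an even binary form. -/
theorem exists_cls_eq_piece_add (X : FiniteForm) (q : ℕ) [hq : Fact q.Prime]
    (hX : q ∣ Nat.card X.T) : ∃ Y : FiniteForm,
      (∃ (k : ℕ) (a : (ZMod (q ^ k))ˣ), k ≠ 0 ∧ X.cls = (cyclic (q ^ k) a).cls + Y.cls) ∨
      (∃ (k : ℕ) (ε : Bool), k ≠ 0 ∧ X.cls = (evenForm k ε).cls + Y.cls) := by
  obtain ⟨k, z, y, hk, hz, hy, hzy⟩ := exists_pairing_of_max_order X q hX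
  have key : ∀ {x w : X.T} (a : ZMod (q ^ k)), X.form x w = cyc (q ^ k) a →
      (q ^ (k - 1) • X.form x w ≠ 0 ↔ IsUnit a) := by
    intro x w a h
    rw [zmod_isUnit_iff hk, h, ← map_nsmul, Ne, cyc_eq_zero_iff]
    simp
  by_cases hc : ∃ x : X.T, q ^ k • x = 0 ∧ q ^ (k - 1) • X.form x x ≠ 0
  · obtain ⟨x, hx, hxx⟩ := hc
    obtain ⟨a, ha⟩ := exists_form_eq_cyc X (q ^ k) hx x
    obtain ⟨a, rfl⟩ := (key a ha).1 hxx
    obtain ⟨Y, hY⟩ := exists_cls_eq_cyclic_add X (q ^ k) x hx a ha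
    exact ⟨Y, Or.inl ⟨k, a, hk, hY⟩⟩
  · push Not at hc
    obtain rfl : q = 2 := by
      by_contra hq2
      -- Polarisation: `2 ℓ(z, y)` has full order when `q` is odd.
      have h := hc (z + y) (by rw [smul_add, hz, hy, add_zero])
      simp only [map_add, AddMonoidHom.add_apply, smul_add, hc z hz, hc y hy, X.symm y z] at h
      obtain ⟨b, hb⟩ := exists_form_eq_cyc X (q ^ k) hz y
      have hb' := (key b hb).1 hzy
      have h2 : IsUnit ((2 : ℕ) : ZMod (q ^ k)) := by
        rw [ZMod.isUnit_iff_coprime]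
        exact Nat.Coprime.pow_right _ ((Nat.coprime_primes Nat.prime_two hq.out).2 (Ne.symm hq2))
      have h3 := (zmod_isUnit_iff hk _).1 (h2.mul hb')
      rw [hb, zero_add, add_zero, ← map_nsmul, ← map_add, cyc_eq_zero_iff] at h
      apply h3
      simp only [nsmul_eq_mul, Nat.cast_pow] at h
      push_cast
      linear_combination h
    obtain ⟨b, hb⟩ := exists_form_eq_cyc X (2 ^ k) hz y
    have even : ∀ {x : X.T}, 2 ^ k • x = 0 → ∃ a, X.form x x = cyc (2 ^ k) (2 * a) := by
      intro x hx
      obtain ⟨a, ha⟩ := exists_form_eq_cyc X (2 ^ k) hx x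
      rcases zmod_isUnit_or a with h | ⟨a, rfl⟩
      · exact absurd (hc x hx) ((key a ha).2 h)
      · exact ⟨a, by simpa using ha⟩
    obtain ⟨a, ha⟩ := even hz
    obtain ⟨c, hc'⟩ := even hy
    obtain ⟨ε, Y, hY⟩ := exists_cls_eq_evenForm_add X z y hz hy ((key b hb).1 hzy) ha hb hc'
    exact ⟨Y, Or.inr ⟨k, ε, hk, hY⟩⟩

/-- Induction principle for finite linking forms: every form is an orthogonal sum of cyclic forms
of prime power order and even binary forms. -/
theorem FormClass.induction_pieces {P : FormClass → Prop} (zero : P 0)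
    (cyc : ∀ (q k : ℕ) [Fact q.Prime] (a : (ZMod (q ^ k))ˣ) (y : FormClass), k ≠ 0 → P y →
      P ((cyclic (q ^ k) a).cls + y))
    (even : ∀ (k : ℕ) (ε : Bool) (y : FormClass), k ≠ 0 → P y → P ((evenForm k ε).cls + y))
    (x : FormClass) : P x := by
  induction hn : card x using Nat.strong_induction_on generalizing x with | h n ih => ?_
  induction x using FormClass.ind with | h X => ?_
  subst hn
  by_cases h1 : Nat.card X.T = 1
  · have : Subsingleton X.T := (Nat.card_eq_one_iff_unique.1 h1).1
    rw [cls_eq_zero_of_subsingleton]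
    exact zero
  · obtain ⟨q, hq, hqX⟩ := Nat.exists_prime_and_dvd h1
    have := Fact.mk hq
    have lt : ∀ {Z Y : FiniteForm} {m : ℕ}, card Z.cls = m → 1 < m → X.cls = Z.cls + Y.cls →
        P Y.cls := by
      intro Z Y m hm h1m h
      refine ih _ ?_ _ rfl
      rw [h, isMult_card.add, hm]
      exact lt_mul_of_one_lt_left (Nat.pos_of_ne_zero (card_ne_zero _)) h1m
    obtain ⟨Y, ⟨k, a, hk, h⟩ | ⟨k, ε, hk, h⟩⟩ := exists_cls_eq_piece_add X q hqX
    · rw [h]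
      exact cyc q k a _ hk (lt (card_cyclic _ a) (Nat.one_lt_pow hk hq.one_lt) h)
    · rw [h]
      exact even k ε _ hk (lt (card_evenForm k ε)
        (Nat.one_lt_pow two_ne_zero (Nat.one_lt_pow hk one_lt_two)) h)

/-! ### Cyclic forms of odd prime power order -/

/-- A homomorphism that preserves non-degenerate forms on groups of equal order is an isometry. -/
theorem cls_eq_of_isometry {X Y : FiniteForm} (φ : X.T →+ Y.T)
    (hφ : ∀ x y, Y.form (φ x) (φ y) = X.form x y) (hc : Nat.card X.T = Nat.card Y.T) :
    X.cls = Y.cls := by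
  have hinj : Function.Injective φ := by
    rw [injective_iff_map_eq_zero]
    intro x hx
    exact X.nondeg x fun y => by rw [← hφ, hx]; simp
  exact cls_eq_iff.2 ⟨AddEquiv.ofBijective φ
    ((Nat.bijective_iff_injective_and_card φ).2 ⟨hinj, hc⟩), hφ⟩

theorem cls_cyclic_mul_sq (n : ℕ) [NeZero n] (a s : (ZMod n)ˣ) :
    (cyclic n (a * s ^ 2)).cls = (cyclic n a).cls := by
  refine cls_eq_of_isometry (X := cyclic n (a * s ^ 2)) (Y := cyclic n a)
    (AddMonoidHom.mulLeft (s : ZMod n)) (fun x y => ?_) rfl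
  rw [cyclic_form, cyclic_form]
  congr 1
  simp only [AddMonoidHom.coe_mulLeft, Units.val_mul, Units.val_pow_eq_pow_val]
  ring

/-- For `r = x² + y²`, the similitude with matrix `(x y; -y x)` carries two copies of the form with
coefficient `r` to two copies of the standard form. -/
theorem cls_cyclic_add_self (n : ℕ) [NeZero n] (r : (ZMod n)ˣ) {x y : ZMod n}
    (hr : (r : ZMod n) = x ^ 2 + y ^ 2) :
    (cyclic n r).cls + (cyclic n r).cls = (cyclic n 1).cls + (cyclic n 1).cls := by
  rw [← cls_prod, ← cls_prod]
  let φ : ZMod n × ZMod n →+ ZMod n × ZMod n :=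
    ((AddMonoidHom.mulLeft x).coprod (AddMonoidHom.mulLeft y)).prod
      ((AddMonoidHom.mulLeft (-y)).coprod (AddMonoidHom.mulLeft x))
  refine cls_eq_of_isometry (X := (cyclic n r).prod (cyclic n r))
    (Y := (cyclic n 1).prod (cyclic n 1)) φ (fun u v => ?_) rfl
  change ZMod n × ZMod n at u v
  change cyc n ((1 : (ZMod n)ˣ) * (x * u.1 + y * u.2) * (x * v.1 + y * v.2)) +
    cyc n ((1 : (ZMod n)ˣ) * (-y * u.1 + x * u.2) * (-y * v.1 + x * v.2)) =
    cyc n (r * u.1 * v.1) + cyc n (r * u.2 * v.2)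
  rw [← map_add, ← map_add, hr]
  congr 1
  push_cast
  ring

theorem exists_nonresidue (q : ℕ) [Fact q.Prime] (hq : q ≠ 2) :
    ∃ r x y : ℤ, r = x ^ 2 + y ^ 2 ∧ ¬ IsSquare (r : ZMod q) := by
  obtain ⟨a, ha⟩ := FiniteField.exists_nonsquare (F := ZMod q) (by rwa [ZMod.ringChar_zmod_n])
  obtain ⟨x', y', h⟩ := ZMod.sq_add_sq q a
  obtain ⟨x, rfl⟩ := ZMod.intCast_surjective x'
  obtain ⟨y, rfl⟩ := ZMod.intCast_surjective y'
  refine ⟨_, x, y, rfl, ?_⟩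
  push_cast
  rwa [h]

open Classical in
/-- An integer that is a sum of two squares and a quadratic nonresidue modulo the odd
prime `q`. -/
def nonres (q : ℕ) : ℤ :=
  if h : ∃ r x y : ℤ, r = x ^ 2 + y ^ 2 ∧ ¬ IsSquare (r : ZMod q) then h.choose else 1

theorem nonres_spec (q : ℕ) [Fact q.Prime] (hq : q ≠ 2) :
    ∃ x y : ℤ, nonres q = x ^ 2 + y ^ 2 ∧ ¬ IsSquare (nonres q : ZMod q) := by
  have h := exists_nonresidue q hq
  rw [nonres, dif_pos h]
  exact h.choose_spec

open Classical in
/-- The class of `nonres q` in the unit group of `ℤ/qᵏ`. -/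
def nonresUnit (q k : ℕ) : (ZMod (q ^ k))ˣ :=
  if h : IsUnit (nonres q : ZMod (q ^ k)) then h.unit else 1

theorem nonresUnit_val (q k : ℕ) [Fact q.Prime] (hq : q ≠ 2) :
    (nonresUnit q k : ZMod (q ^ k)) = (nonres q : ZMod (q ^ k)) := by
  obtain ⟨x, y, -, h⟩ := nonres_spec q hq
  have h1 : IsUnit (nonres q : ZMod (q ^ k)) := by
    rcases zmod_isUnit_or (nonres q : ZMod (q ^ k)) with h1 | ⟨b, hb⟩
    · exact h1
    · rcases Nat.eq_zero_or_pos k with rfl | hk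
      · exact ⟨1, Subsingleton.elim (α := ZMod 1) _ _⟩
      · have := congrArg (ZMod.castHom (dvd_pow_self q hk.ne') (ZMod q)) hb
        rw [map_intCast, map_mul, map_natCast, ZMod.natCast_self, zero_mul] at this
        rw [this] at h
        exact absurd (IsSquare.zero) h
  rw [nonresUnit, dif_pos h1]
  rfl

theorem nonresUnit_not_isSquare (q k : ℕ) [Fact q.Prime] (hq : q ≠ 2) (hk : k ≠ 0) :
    ¬ IsSquare (nonresUnit q k) := by
  rintro ⟨s, hs⟩
  obtain ⟨x, y, -, h⟩ := nonres_spec q hq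
  have h1 : (nonres q : ZMod (q ^ k)) = s * s := by
    rw [← nonresUnit_val q k hq, hs]; rfl
  have := congrArg (ZMod.castHom (dvd_pow_self q hk) (ZMod q)) h1
  rw [map_intCast, map_mul] at this
  exact h ⟨_, this⟩

/-- Modulo a power of an odd prime every unit is a square or a fixed nonresidue times a
square. -/
theorem unit_eq_sq_or (q k : ℕ) [hq' : Fact q.Prime] (hq : q ≠ 2) (hk : k ≠ 0)
    (a : (ZMod (q ^ k))ˣ) : ∃ s, a = 1 * s ^ 2 ∨ a = nonresUnit q k * s ^ 2 := by
  have := ZMod.isCyclic_units_of_prime_pow q hq'.out hq k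
  obtain ⟨ζ, hζ⟩ := IsCyclic.exists_generator (α := (ZMod (q ^ k))ˣ)
  obtain ⟨i, hi⟩ := hζ (nonresUnit q k)
  obtain ⟨j, rfl⟩ := hζ a
  change ζ ^ i = _ at hi
  change ∃ s, ζ ^ j = _ ∨ ζ ^ j = _
  have hio : Odd i := by
    rw [← Int.not_even_iff_odd]
    rintro ⟨l, rfl⟩
    exact nonresUnit_not_isSquare q k hq hk ⟨ζ ^ l, by rw [← hi, zpow_add]⟩
  rcases Int.even_or_odd j with ⟨l, rfl⟩ | hj
  · exact ⟨ζ ^ l, Or.inl (by rw [zpow_add, one_mul, sq])⟩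
  · obtain ⟨l, hl⟩ := hj.sub_odd hio
    refine ⟨ζ ^ l, Or.inr ?_⟩
    rw [← hi, sq, ← zpow_add, ← zpow_add, ← hl]
    congr 1
    ring

/-- The two cyclic forms `x y / qᵏ` and `r x y / qᵏ` of order `qᵏ`, with `r` a nonresidue
modulo `q`. -/
def signForm (q k : ℕ) [Fact q.Prime] (ε : Bool) : FiniteForm :=
  cyclic (q ^ k) (if ε then nonresUnit q k else 1)

theorem card_signForm (q k : ℕ) [Fact q.Prime] (ε : Bool) : card (signForm q k ε).cls = q ^ k :=
  card_cyclic _ _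

theorem exists_cls_cyclic_eq (q k : ℕ) [Fact q.Prime] (hq : q ≠ 2) (hk : k ≠ 0)
    (a : (ZMod (q ^ k))ˣ) : ∃ ε, (cyclic (q ^ k) a).cls = (signForm q k ε).cls := by
  obtain ⟨s, rfl | rfl⟩ := unit_eq_sq_or q k hq hk a
  · exact ⟨false, cls_cyclic_mul_sq _ _ _⟩
  · exact ⟨true, cls_cyclic_mul_sq _ _ _⟩

theorem signForm_add_self (q k : ℕ) [Fact q.Prime] (hq : q ≠ 2) :
    (signForm q k true).cls + (signForm q k true).cls =
      (signForm q k false).cls + (signForm q k false).cls := by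
  obtain ⟨x, y, h, -⟩ := nonres_spec q hq
  refine cls_cyclic_add_self _ (nonresUnit q k) (x := x) (y := y) ?_
  rw [nonresUnit_val q k hq, h]
  push_cast
  rfl

/-! ### Gauss sums of cyclic forms -/

theorem gauss_cyclic (c n : ℕ) [NeZero n] (a : (ZMod n)ˣ) :
    gauss c (cyclic n a).cls = (n : ℂ)⁻¹ * ∑ x : ZMod n, e ((c • cyc n) (a * (x * x))) := by
  rw [gauss_cls]
  change (Nat.card (ZMod n) : ℂ)⁻¹ * ∑ᶠ x : ZMod n, e (c • cyc n (a * x * x)) = _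
  rw [Nat.card_zmod, finsum_eq_sum_of_fintype]
  simp [mul_assoc]

theorem nsmul_cyc_comp_eq_zero_iff (c n : ℕ) [NeZero n] (h : ZMod n) :
    (c • cyc n).comp (AddMonoidHom.mulLeft h) = 0 ↔ (c : ZMod n) * h = 0 := by
  rw [← cyc_eq_zero_iff, ← nsmul_eq_mul, map_nsmul]
  refine ⟨fun h1 => by simpa using DFunLike.congr_fun h1 1, fun h1 => AddMonoidHom.ext fun x => ?_⟩
  obtain ⟨k, rfl⟩ := ZMod.intCast_surjective x
  rw [AddMonoidHom.comp_apply, AddMonoidHom.coe_mulLeft, mul_comm, ← zsmul_eq_mul, map_zsmul,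
    AddMonoidHom.nsmul_apply, h1]
  simp

open Classical in
/-- The absolute value of a quadratic Gauss sum of odd modulus. -/
theorem gauss_sum_mul_conj (c n : ℕ) [NeZero n] (h2 : IsUnit (2 : ZMod n)) (a : (ZMod n)ˣ) :
    (∑ x : ZMod n, e ((c • cyc n) (a * (x * x)))) *
      (starRingEnd ℂ) (∑ x : ZMod n, e ((c • cyc n) (a * (x * x)))) =
      n * Fintype.card {h : ZMod n // (c : ZMod n) * h = 0} := by
  have step : ∀ h : ZMod n, ∑ y : ZMod n, e ((c • cyc n) (a * ((y + h) * (y + h)))) *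
      e (-(c • cyc n) (a * (y * y))) = if (c : ZMod n) * h = 0 then (n : ℂ) else 0 := by
    intro h
    have e1 : ∀ y : ZMod n, e ((c • cyc n) (a * ((y + h) * (y + h)))) *
        e (-(c • cyc n) (a * (y * y))) = e ((c • cyc n) (a * (h * h))) *
        e ((c • cyc n).comp (AddMonoidHom.mulLeft (2 * a * h)) y) := by
      intro y
      rw [← e_add, ← e_add, AddMonoidHom.comp_apply, ← map_neg, ← map_add, ← map_add,
        AddMonoidHom.coe_mulLeft]
      ring_nf
    simp_rw [e1]
    rw [← Finset.mul_sum, sum_e]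
    have hiff : (c • cyc n).comp (AddMonoidHom.mulLeft (2 * a * h)) = 0 ↔ (c : ZMod n) * h = 0 := by
      rw [nsmul_cyc_comp_eq_zero_iff, mul_left_comm]
      exact (h2.mul a.isUnit).mul_right_eq_zero
    by_cases hc : (c : ZMod n) * h = 0
    · rw [if_pos (hiff.2 hc), if_pos hc, ZMod.card]
      have h3 : (c • cyc n) (a * (h * h)) = 0 := by
        have := DFunLike.congr_fun ((nsmul_cyc_comp_eq_zero_iff c n h).2 hc) (a * h)
        rw [AddMonoidHom.comp_apply, AddMonoidHom.coe_mulLeft] at this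
        rw [mul_left_comm]
        exact this
      rw [h3, e_zero, one_mul]
    · rw [if_neg (fun h => hc (hiff.1 h)), if_neg hc, mul_zero]
  rw [map_sum, Finset.sum_mul_sum, Finset.sum_comm]
  simp_rw [star_e]
  have e2 : ∀ y : ZMod n, ∑ x : ZMod n, e ((c • cyc n) (a * (x * x))) *
      e (-(c • cyc n) (a * (y * y))) = ∑ h : ZMod n, e ((c • cyc n) (a * ((y + h) * (y + h)))) *
      e (-(c • cyc n) (a * (y * y))) :=
    fun y => (Fintype.sum_equiv (Equiv.addLeft y) _ _ fun h => rfl).symm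
  simp_rw [e2]
  rw [Finset.sum_comm]
  simp_rw [step]
  rw [← Finset.sum_filter, Finset.sum_const, nsmul_eq_mul, mul_comm, Fintype.card_subtype]

theorem gauss_cyclic_ne_zero (c n : ℕ) [NeZero n] (h2 : IsUnit (2 : ZMod n)) (a : (ZMod n)ˣ) :
    gauss c (cyclic n a).cls ≠ 0 := by
  classical
  have hn : (n : ℂ) ≠ 0 := by exact_mod_cast NeZero.ne n
  rw [gauss_cyclic]
  refine mul_ne_zero (inv_ne_zero hn) fun h => ?_
  have := gauss_sum_mul_conj c n h2 a
  rw [h, zero_mul] at this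
  have h1 : Fintype.card {h : ZMod n // (c : ZMod n) * h = 0} ≠ 0 :=
    (Fintype.card_pos_iff.2 ⟨⟨0, mul_zero _⟩⟩).ne'
  exact mul_ne_zero hn (by exact_mod_cast h1) this.symm

theorem norm_gauss_cyclic_lt_one (c n : ℕ) [NeZero n] (h2 : IsUnit (2 : ZMod n))
    (hc : (c : ZMod n) ≠ 0) (a : (ZMod n)ˣ) : ‖gauss c (cyclic n a).cls‖ < 1 := by
  classical
  have hn : (0 : ℝ) < n := by exact_mod_cast Nat.pos_of_ne_zero (NeZero.ne n)
  have h := congrArg norm (gauss_sum_mul_conj c n h2 a)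
  rw [norm_mul, RCLike.norm_conj, norm_mul, Complex.norm_natCast, Complex.norm_natCast] at h
  have h1 : Fintype.card {h : ZMod n // (c : ZMod n) * h = 0} < n := by
    have := Fintype.card_subtype_lt (p := fun h : ZMod n => (c : ZMod n) * h = 0) (x := 1)
      (by simpa using hc)
    rwa [ZMod.card] at this
  have h1' : (Fintype.card {h : ZMod n // (c : ZMod n) * h = 0} : ℝ) < n := by exact_mod_cast h1
  rw [gauss_cyclic, norm_mul, norm_inv, Complex.norm_natCast, inv_mul_lt_iff₀ hn, mul_one]
  refine lt_of_mul_self_lt_mul_self₀ hn.le ?_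
  rw [h]
  exact mul_lt_mul_of_pos_left h1' hn

theorem gauss_cyclic_eq_one {c n : ℕ} [NeZero n] (hc : (c : ZMod n) = 0) (a : (ZMod n)ˣ) :
    gauss c (cyclic n a).cls = 1 := by
  have hn : (n : ℂ) ≠ 0 := by exact_mod_cast NeZero.ne n
  rw [gauss_cyclic]
  have h0 : ∀ x : ZMod n, (c • cyc n) x = 0 := by
    intro x
    rw [AddMonoidHom.nsmul_apply, ← map_nsmul, nsmul_eq_mul, hc, zero_mul, map_zero]
  simp [h0, e_zero, hn]

/-- The Gauss sums of all unit multiples of a cyclic form of order `pᵏ`, for the character of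
conductor `p`, add up to zero. -/
theorem sum_gauss_cyclic_units (p k : ℕ) [Fact p.Prime] (hk : k ≠ 0) :
    ∑ a : (ZMod (p ^ k))ˣ, gauss (p ^ (k - 1)) (cyclic (p ^ k) a).cls = 0 := by
  classical
  simp_rw [gauss_cyclic]
  rw [← Finset.mul_sum]
  refine mul_eq_zero_of_right _ ?_
  set β := p ^ (k - 1) • cyc (p ^ k) with hβ
  have key : ∀ c : ZMod (p ^ k), (∑ x, e (β (c * x))) =
      if IsUnit c then 0 else ((p ^ k : ℕ) : ℂ) := by
    intro c
    have h := sum_e (β.comp (AddMonoidHom.mulLeft c))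
    have hiff := nsmul_cyc_comp_eq_zero_iff (p ^ (k - 1)) (p ^ k) c
    rw [Nat.cast_pow, ← not_iff_not, ← ne_eq (_ * c), ← zmod_isUnit_iff hk] at hiff
    rw [ZMod.card] at h
    refine h.trans ?_
    by_cases hc : IsUnit c
    · rw [if_pos hc, if_neg (hiff.2 hc)]
    · rw [if_neg hc, if_pos (not_not.1 fun h => hc (hiff.1 h))]
  -- Sum over all residues `c` in two ways.
  have h1 : ∑ c : ZMod (p ^ k), ∑ x : ZMod (p ^ k), e (β (c * (x * x))) =
      ∑ x : ZMod (p ^ k), if IsUnit x then 0 else ((p ^ k : ℕ) : ℂ) := by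
    rw [Finset.sum_comm]
    refine Finset.sum_congr rfl fun x _ => ?_
    simp_rw [mul_comm _ (x * x)]
    rw [key]
    simp only [IsUnit.mul_iff, and_self]
  have h2 : ∀ c : ZMod (p ^ k), ¬ IsUnit c →
      ∑ x : ZMod (p ^ k), e (β (c * (x * x))) = ((p ^ k : ℕ) : ℂ) := by
    intro c hc
    have h0 : ∀ x, β (c * x) = 0 := by
      rw [zmod_isUnit_iff hk, not_not] at hc
      have := (nsmul_cyc_comp_eq_zero_iff (p ^ (k - 1)) (p ^ k) c).2 (by push_cast; exact hc)
      exact fun x => DFunLike.congr_fun this x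
    simp [h0, e_zero]
  rw [← Finset.sum_filter_add_sum_filter_not _ (fun c => IsUnit c),
    ← Finset.sum_filter_add_sum_filter_not (s := (Finset.univ : Finset (ZMod (p ^ k))))
      (f := fun x => if IsUnit x then (0 : ℂ) else ((p ^ k : ℕ) : ℂ))
      (p := fun c => IsUnit c)] at h1
  rw [Finset.sum_congr rfl (fun c hc => h2 c (Finset.mem_filter.1 hc).2),
    Finset.sum_congr rfl (g := fun _ => ((p ^ k : ℕ) : ℂ))
      (fun c hc => if_neg (Finset.mem_filter.1 hc).2),
    add_left_inj, Finset.sum_congr rfl (g := fun _ => (0 : ℂ))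
      (fun c hc => if_pos (Finset.mem_filter.1 hc).2), Finset.sum_const_zero] at h1
  rw [← h1]
  refine Finset.sum_bij (fun a _ => (a : ZMod (p ^ k))) (fun a _ => by simp)
    (fun a _ b _ h => Units.ext h) (fun b hb => ?_) (fun a _ => rfl)
  obtain ⟨u, hu⟩ := (Finset.mem_filter.1 hb).2
  exact ⟨u, Finset.mem_univ _, hu⟩

theorem isUnit_two_zmod (p k : ℕ) [hp : Fact p.Prime] (hp2 : p ≠ 2) :
    IsUnit (2 : ZMod (p ^ k)) := by
  have := (ZMod.isUnit_iff_coprime 2 (p ^ k)).2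
    (Nat.Coprime.pow_right _ ((Nat.coprime_primes Nat.prime_two hp.out).2 (Ne.symm hp2)))
  exact_mod_cast this

/-- The Gauss sum of conductor `p` distinguishes the two cyclic forms of order `pᵏ`. -/
theorem gauss_signForm_true (p k : ℕ) [Fact p.Prime] (hp2 : p ≠ 2) (hk : k ≠ 0) :
    gauss (p ^ (k - 1)) (signForm p k true).cls =
      - gauss (p ^ (k - 1)) (signForm p k false).cls := by
  have h := congrArg (gauss (p ^ (k - 1))) (signForm_add_self p k hp2)
  rw [(isMult_gauss _).add, (isMult_gauss _).add] at h
  refine (mul_self_eq_mul_self_iff.1 h).resolve_left fun heq => ?_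
  have h0 := sum_gauss_cyclic_units p k hk
  have hall : ∀ a : (ZMod (p ^ k))ˣ, gauss (p ^ (k - 1)) (cyclic (p ^ k) a).cls =
      gauss (p ^ (k - 1)) (signForm p k false).cls := by
    intro a
    obtain ⟨ε, hε⟩ := exists_cls_cyclic_eq p k hp2 hk a
    rw [hε]
    cases ε
    · rfl
    · exact heq
  simp_rw [hall] at h0
  rw [Finset.sum_const, nsmul_eq_mul] at h0
  refine mul_ne_zero ?_ (gauss_cyclic_ne_zero _ _ (isUnit_two_zmod p k hp2) _) h0
  exact_mod_cast Finset.card_ne_zero_of_mem (Finset.mem_univ 1)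

/-! ### Classification at an odd prime -/

/-- The form on a `p`-group with `k m` summands `x y / pᵐ` for every `m`, and a further summand
`r x y / pᵐ` for every `m` in `S`, where `r` is a nonresidue. -/
def primaryForm (p : ℕ) [Fact p.Prime] (k : ℕ+ →₀ ℕ) (S : Finset ℕ+) : FormClass :=
  k.sum (fun m n => n • (signForm p m false).cls) + ∑ m ∈ S, (signForm p m true).cls

theorem FormClass.IsMult.primaryForm {R : Type*} [CommMonoid R] {w : FormClass → R}
    (hw : IsMult w) (p : ℕ) [Fact p.Prime] (k : ℕ+ →₀ ℕ) (S : Finset ℕ+) :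
    w (primaryForm p k S) =
      k.prod (fun m n => w (signForm p m false).cls ^ n) * ∏ m ∈ S, w (signForm p m true).cls := by
  rw [AbelianTQFT.primaryForm, hw.add, Finsupp.sum, hw.sum, hw.sum, Finsupp.prod]
  simp_rw [hw.nsmul]

theorem card_primaryForm (p : ℕ) [Fact p.Prime] (k : ℕ+ →₀ ℕ) (S : Finset ℕ+) :
    ∃ N, card (primaryForm p k S) = p ^ N := by
  rw [isMult_card.primaryForm]
  simp_rw [card_signForm, Finsupp.prod, ← pow_mul]
  rw [Finset.prod_pow_eq_pow_sum, Finset.prod_pow_eq_pow_sum, ← pow_add]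
  exact ⟨_, rfl⟩

theorem exists_eq_primaryForm_add (p : ℕ) [hp : Fact p.Prime] (hp2 : p ≠ 2) (x : FormClass) :
    ∃ (k : ℕ+ →₀ ℕ) (S : Finset ℕ+) (y : FormClass), (card y).Coprime p ∧
      x = primaryForm p k S + y := by
  classical
  induction x using FormClass.induction_pieces with
  | zero => exact ⟨0, ∅, 0, by rw [isMult_card.zero]; exact Nat.coprime_one_left p, by
      simp [primaryForm]⟩
  | cyc q m a y hm ih =>
    rename_i hq
    obtain ⟨k, S, y, hy, rfl⟩ := ih
    by_cases hqp : q = p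
    · subst hqp
      obtain ⟨ε, hε⟩ := exists_cls_cyclic_eq q m hp2 hm a
      rw [hε]
      lift m to ℕ+ using Nat.pos_of_ne_zero hm
      have hadd : ∀ n : ℕ, primaryForm q (k + Finsupp.single m n) S =
          n • (signForm q m false).cls + primaryForm q k S := by
        intro n
        rw [primaryForm, Finsupp.sum_add_index', Finsupp.sum_single_index, primaryForm]
        · abel
        · simp
        · simp
        · intros; rw [add_smul]
      cases ε
      · refine ⟨k + Finsupp.single m 1, S, y, hy, ?_⟩
        rw [hadd, one_smul, add_assoc]
      · by_cases hmS : m ∈ S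
        · refine ⟨k + Finsupp.single m 2, S.erase m, y, hy, ?_⟩
          have h1 : ∀ k, primaryForm q k S =
              (signForm q m true).cls + primaryForm q k (S.erase m) := by
            intro k
            rw [primaryForm, primaryForm, ← Finset.add_sum_erase S _ hmS]
            abel
          have h2 := h1 (k + Finsupp.single m 2)
          rw [← add_assoc, h1, ← add_assoc, signForm_add_self q m hp2, primaryForm, primaryForm,
            Finsupp.sum_add_index', Finsupp.sum_single_index, two_smul]
          · abel
          · simp
          · simp
          · intros; rw [add_smul]
        · refine ⟨k, insert m S, y, hy, ?_⟩
          rw [primaryForm, primaryForm, Finset.sum_insert hmS]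
          abel
    · refine ⟨k, S, (cyclic (q ^ m) a).cls + y, ?_, by abel⟩
      rw [isMult_card.add, card_cyclic]
      exact Nat.Coprime.mul_left (Nat.Coprime.pow_left _
        ((Nat.coprime_primes hq.out hp.out).2 hqp)) hy
  | even m ε y hm ih =>
    obtain ⟨k, S, y, hy, rfl⟩ := ih
    refine ⟨k, S, (evenForm m ε).cls + y, ?_, by abel⟩
    rw [isMult_card.add, card_evenForm]
    exact Nat.Coprime.mul_left (Nat.Coprime.pow_left _ (Nat.Coprime.pow_left _
      ((Nat.coprime_primes Nat.prime_two hp.out).2 (Ne.symm hp2)))) hy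

theorem pow_mul_neg_pow_injective {x : ℂ} (hx : x ≠ 0) (hx1 : ‖x‖ < 1) {a b : ℕ} {s t : Prop}
    [Decidable s] [Decidable t]
    (h : x ^ a * (if s then -x else 1) = x ^ b * (if t then -x else 1)) : a = b ∧ (s ↔ t) := by
  have hinj : Function.Injective fun n : ℕ => ‖x‖ ^ n :=
    pow_right_injective₀ (norm_pos_iff.2 hx) hx1.ne
  have hne : ∀ c : ℂ, c ≠ 0 → c ≠ -c := fun c hc h => hc (self_eq_neg.1 h)
  have key : ∀ {a b : ℕ}, x ^ a = x ^ b → a = b := fun h => hinj (by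
    simpa using congrArg norm h)
  have key' : ∀ {a b : ℕ}, x ^ a ≠ x ^ b * -x := by
    intro a b h
    have h1 : a = b + 1 := hinj (by simpa [pow_succ] using congrArg norm h)
    rw [h1, pow_succ, mul_neg] at h
    exact hne _ (mul_ne_zero (pow_ne_zero _ hx) hx) h
  split_ifs at h with hs ht ht
  · exact ⟨key (mul_right_cancel₀ (neg_ne_zero.2 hx) h), by tauto⟩
  · rw [mul_one] at h; exact absurd h.symm key'
  · rw [mul_one] at h; exact absurd h key'
  · rw [mul_one, mul_one] at h; exact ⟨key h, by tauto⟩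

/-- The invariants `k`, `S` of a form on a `p`-group are determined by its class: at the largest
`m` where two choices differ, the Gauss sums of level `m - 1` differ. -/
theorem primaryForm_injective (p : ℕ) [hp : Fact p.Prime] (hp2 : p ≠ 2) {k k' : ℕ+ →₀ ℕ}
    {S S' : Finset ℕ+} (h : primaryForm p k S = primaryForm p k' S') : k = k' ∧ S = S' := by
  classical
  let U : Finset ℕ+ := k.support ∪ S ∪ (k'.support ∪ S')
  let B : Finset ℕ+ := U.filter fun m => ¬ (k m = k' m ∧ (m ∈ S ↔ m ∈ S'))
  have hB : B = ∅ → k = k' ∧ S = S' := by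
    intro hB
    have h1 : ∀ m, k m = k' m ∧ (m ∈ S ↔ m ∈ S') := by
      intro m
      by_cases hm : m ∈ U
      · by_contra hc
        have : m ∈ B := Finset.mem_filter.2 ⟨hm, hc⟩
        simp [hB] at this
      · simp only [U, Finset.mem_union, Finsupp.mem_support_iff, not_or, not_not] at hm
        obtain ⟨⟨h1, h2⟩, h3, h4⟩ := hm
        exact ⟨h1.trans h3.symm, by tauto⟩
    exact ⟨Finsupp.ext fun m => (h1 m).1, Finset.ext fun m => (h1 m).2⟩
  by_contra hne
  have hBne : B.Nonempty := Finset.nonempty_iff_ne_empty.2 fun h => hne (hB h)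
  obtain ⟨m₀, hm₀, hmax⟩ := B.exists_max_image id hBne
  let G : Bool → ℕ+ → ℂ := fun ε m => gauss (p ^ ((m₀ : ℕ) - 1)) (signForm p m ε).cls
  have hG0 : ∀ ε m, G ε m ≠ 0 := fun ε m => gauss_cyclic_ne_zero _ _ (isUnit_two_zmod p m hp2) _
  have hprod : ∀ (k : ℕ+ →₀ ℕ) (S : Finset ℕ+), k.support ⊆ U → S ⊆ U →
      gauss (p ^ ((m₀ : ℕ) - 1)) (primaryForm p k S) =
        ∏ m ∈ U, (G false m ^ k m * if m ∈ S then G true m else 1) := by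
    intro k S hk hS
    rw [(isMult_gauss _).primaryForm, Finset.prod_mul_distrib, Finset.prod_ite_mem,
      Finset.inter_eq_right.2 hS]
    congr 1
    exact Finsupp.prod_of_support_subset _ hk _ fun i _ => pow_zero _
  have h1 := congrArg (gauss (p ^ ((m₀ : ℕ) - 1))) h
  rw [hprod k S (fun m hm => by simp only [U, Finset.mem_union]; tauto)
      (fun m hm => by simp only [U, Finset.mem_union]; tauto),
    hprod k' S' (fun m hm => by simp only [U, Finset.mem_union]; tauto)
      (fun m hm => by simp only [U, Finset.mem_union]; tauto)] at h1
  have hU := (Finset.mem_filter.1 hm₀).1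
  rw [← Finset.mul_prod_erase _ _ hU, ← Finset.mul_prod_erase _ _ hU] at h1
  -- Away from `m₀` the factors agree: below `m₀` they are `1`, above it the invariants agree.
  have hrest : ∀ m ∈ U.erase m₀, (G false m ^ k m * if m ∈ S then G true m else 1) =
      G false m ^ k' m * if m ∈ S' then G true m else 1 := by
    intro m hm
    obtain ⟨hne, hmU⟩ := Finset.mem_erase.1 hm
    rcases lt_or_gt_of_ne hne with hlt | hgt
    · have h1 : ∀ ε, G ε m = 1 := fun ε => by
        refine gauss_cyclic_eq_one ?_ _
        rw [ZMod.natCast_eq_zero_iff]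
        exact pow_dvd_pow p (by have : (m : ℕ) < m₀ := hlt; omega)
      simp [h1]
    · have hmB : ¬ m ∈ B := fun h => absurd (hmax m h) (not_le.2 hgt)
      have : k m = k' m ∧ (m ∈ S ↔ m ∈ S') := by
        by_contra hc
        exact hmB (Finset.mem_filter.2 ⟨hmU, hc⟩)
      rw [this.1]
      simp only [this.2]
  rw [Finset.prod_congr rfl hrest] at h1
  have h2 := mul_right_cancel₀ (Finset.prod_ne_zero_iff.2 fun m _ => mul_ne_zero
    (pow_ne_zero _ (hG0 _ _)) (by split_ifs; exacts [hG0 _ _, one_ne_zero])) h1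
  have hG1 : G true m₀ = - G false m₀ := gauss_signForm_true p m₀ hp2 m₀.ne_zero
  have hlt : ‖G false m₀‖ < 1 := by
    refine norm_gauss_cyclic_lt_one _ _ (isUnit_two_zmod p m₀ hp2) ?_ _
    rw [Ne, ZMod.natCast_eq_zero_iff, Nat.pow_dvd_pow_iff_le_right hp.out.one_lt]
    have := m₀.pos
    omega
  rw [hG1] at h2
  exact (Finset.mem_filter.1 hm₀).2 (pow_mul_neg_pow_injective (hG0 _ _) hlt h2)

/-- For an odd prime `p`, a finite linking form is a `p`-primary form, with the invariants of
`primaryForm`, plus a form of order prime to `p`, in exactly one way. -/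
theorem bijective_primaryForm_add (p : ℕ) [hp : Fact p.Prime] (hp2 : p ≠ 2) :
    Function.Bijective fun t : ((ℕ+ →₀ ℕ) × Finset ℕ+) × {y : FormClass // (card y).Coprime p} =>
      primaryForm p t.1.1 t.1.2 + t.2.1 := by
  constructor
  · rintro ⟨⟨k, S⟩, y, hy⟩ ⟨⟨k', S'⟩, y', hy'⟩ h
    obtain ⟨N, hN⟩ := card_primaryForm p k S
    obtain ⟨N', hN'⟩ := card_primaryForm p k' S'
    obtain ⟨h1, h2⟩ := add_eq_add_of_coprime h (by rw [hN]; exact (hy'.pow_right _).symm)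
      (by rw [hN']; exact (hy.pow_right _).symm)
    obtain ⟨rfl, rfl⟩ := primaryForm_injective p hp2 h1
    obtain rfl : y = y' := h2
    rfl
  · intro x
    obtain ⟨k, S, y, hy, rfl⟩ := exists_eq_primaryForm_add p hp2 x
    exact ⟨⟨⟨k, S⟩, y, hy⟩, rfl⟩

/-! ### A generating family -/

/-- Index set of a family of forms that generates the monoid of all forms: signed cyclic forms of
prime power order, all cyclic forms of two-power order, even binary forms. -/
abbrev PieceIndex : Type :=
  ({q : ℕ // q.Prime} × ℕ × Bool) ⊕ (Σ k : ℕ, (ZMod (2 ^ (k + 1)))ˣ) ⊕ (ℕ × Bool)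

/-- The generator with a given index. -/
def piece : PieceIndex → FormClass
  | .inl (q, k, ε) => haveI := Fact.mk q.2; (signForm q (k + 1) ε).cls
  | .inr (.inl ⟨k, a⟩) => (cyclic (2 ^ (k + 1)) a).cls
  | .inr (.inr (k, ε)) => (evenForm (k + 1) ε).cls

theorem exists_sum_piece (x : FormClass) :
    ∃ f : PieceIndex →₀ ℕ, f.sum (fun i n => n • piece i) = x := by
  classical
  have add : ∀ (i : PieceIndex) (y : FormClass),
      (∃ f : PieceIndex →₀ ℕ, f.sum (fun i n => n • piece i) = y) →
      ∃ f : PieceIndex →₀ ℕ, f.sum (fun i n => n • piece i) = piece i + y := by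
    rintro i _ ⟨f, rfl⟩
    refine ⟨Finsupp.single i 1 + f, ?_⟩
    rw [Finsupp.sum_add_index', Finsupp.sum_single_index, one_smul]
    · simp
    · simp
    · intros; rw [add_smul]
  induction x using FormClass.induction_pieces with
  | zero => exact ⟨0, by simp⟩
  | cyc q k a y hk ih =>
    rename_i hq
    obtain ⟨k, rfl⟩ := Nat.exists_eq_succ_of_ne_zero hk
    by_cases hq2 : q = 2
    · subst hq2
      exact add (.inr (.inl ⟨k, a⟩)) _ ih
    · obtain ⟨ε, hε⟩ := exists_cls_cyclic_eq q (k + 1) hq2 hk a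
      have := add (.inl (⟨q, hq.out⟩, k, ε)) _ ih
      rw [hε]
      exact this
  | even k ε y hk ih =>
    obtain ⟨k, rfl⟩ := Nat.exists_eq_succ_of_ne_zero hk
    exact add (.inr (.inr (k, ε))) _ ih

open Matrix

/-! ### Integral presentations of linking forms -/

/-- The symmetric integer matrix `J` presents the form `X`: the group is the cokernel of `J`, via
`π`, and the form is `J⁻¹` modulo `ℤ`. -/
structure IsPresentation {ι : Type} [Fintype ι] (J : Matrix ι ι ℤ) (X : FiniteForm)
    (π : (ι → ℤ) →+ X.T) : Prop where
  isSymm : J.IsSymm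
  surj : Function.Surjective π
  ker_eq : ∀ u, π u = 0 ↔ ∃ w, J *ᵥ w = u
  form_eq : ∀ (u v w : ι → ℤ) (n : ℤ), n ≠ 0 → J *ᵥ w = n • u →
    X.form (π u) (π v) = (((w ⬝ᵥ v : ℤ) / n : ℚ) : QZ)

/-- A finite linking form presented by some symmetric integer matrix. -/
def Presentable (X : FiniteForm) : Prop :=
  ∃ (ι : Type) (_ : Fintype ι) (J : Matrix ι ι ℤ) (π : (ι → ℤ) →+ X.T), IsPresentation J X π

theorem Presentable.of_iso {X Y : FiniteForm} (h : X.Iso Y) : Presentable X → Presentable Y := by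
  obtain ⟨φ, hφ⟩ := h
  rintro ⟨ι, _, J, π, hJ⟩
  refine ⟨ι, _, J, φ.toAddMonoidHom.comp π, hJ.isSymm, φ.surjective.comp hJ.surj, fun u => ?_, ?_⟩
  · rw [← hJ.ker_eq]
    exact map_eq_zero_iff φ φ.injective
  · intro u v w n hn h
    rw [← hJ.form_eq u v w n hn h]
    exact hφ _ _

theorem Presentable.zero : Presentable FiniteForm.zero :=
  ⟨Empty, inferInstance, 0, 0, Matrix.isSymm_zero, fun _ => ⟨0, rfl⟩,
    fun u => ⟨fun _ => ⟨u, Subsingleton.elim _ _⟩, fun _ => rfl⟩, fun u v w n _ _ => by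
      change (0 : QZ) = _
      simp⟩

theorem Presentable.prod {X Y : FiniteForm} :
    Presentable X → Presentable Y → Presentable (X.prod Y) := by
  rintro ⟨ι, _, J, π, hJ⟩ ⟨ι', _, J', π', hJ'⟩
  let l : (ι ⊕ ι' → ℤ) →+ (ι → ℤ) := ⟨⟨fun u i => u (.inl i), rfl⟩, fun _ _ => rfl⟩
  let r : (ι ⊕ ι' → ℤ) →+ (ι' → ℤ) := ⟨⟨fun u i => u (.inr i), rfl⟩, fun _ _ => rfl⟩
  have hl : ∀ w, l (fromBlocks J 0 0 J' *ᵥ w) = J *ᵥ l w := by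
    intro w
    rw [fromBlocks_mulVec]
    ext i
    simp [l, Function.comp_def]
  have hr : ∀ w, r (fromBlocks J 0 0 J' *ᵥ w) = J' *ᵥ r w := by
    intro w
    rw [fromBlocks_mulVec]
    ext i
    simp [r, Function.comp_def]
  refine ⟨ι ⊕ ι', inferInstance, fromBlocks J 0 0 J', (π.comp l).prod (π'.comp r), ?_, ?_, ?_, ?_⟩
  · exact Matrix.IsSymm.fromBlocks hJ.isSymm (by simp) hJ'.isSymm
  · rintro ⟨x, y⟩
    obtain ⟨u, rfl⟩ := hJ.surj x
    obtain ⟨v, rfl⟩ := hJ'.surj y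
    exact ⟨Sum.elim u v, rfl⟩
  · intro u
    constructor
    · intro h
      obtain ⟨w, hw⟩ := (hJ.ker_eq (l u)).1 (congrArg Prod.fst h)
      obtain ⟨w', hw'⟩ := (hJ'.ker_eq (r u)).1 (congrArg Prod.snd h)
      refine ⟨Sum.elim w w', ?_⟩
      funext i
      rcases i with i | i
      · exact congrFun ((hl (Sum.elim w w')).trans hw) i
      · exact congrFun ((hr (Sum.elim w w')).trans hw') i
    · rintro ⟨w, rfl⟩
      exact Prod.ext ((hJ.ker_eq _).2 ⟨_, (hl w).symm⟩) ((hJ'.ker_eq _).2 ⟨_, (hr w).symm⟩)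
  · intro u v w n hn h
    have h1 := hJ.form_eq (l u) (l v) (l w) n hn (by rw [← hl, h, map_zsmul])
    have h2 := hJ'.form_eq (r u) (r v) (r w) n hn (by rw [← hr, h, map_zsmul])
    change X.form (π (l u)) (π (l v)) + Y.form (π' (r u)) (π' (r v)) = _
    rw [h1, h2, ← AddCircle.coe_add, ← add_div]
    congr 2
    simp only [dotProduct, Fintype.sum_sum_type]
    push_cast
    rfl

/-- Sufficient condition for a presentation, when `W / n` is the inverse of `J`. -/
theorem isPresentation_of_inverse {ι : Type} [Fintype ι] {J W : Matrix ι ι ℤ}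
    {X : FiniteForm} {π : (ι → ℤ) →+ X.T} {n : ℤ} (hn : n ≠ 0) (hJ : J.IsSymm)
    (hJW : ∀ u, J *ᵥ (W *ᵥ u) = n • u) (hWJ : ∀ u, W *ᵥ (J *ᵥ u) = n • u)
    (hπ : Function.Surjective π)
    (hform : ∀ u v, X.form (π u) (π v) = (((W *ᵥ u ⬝ᵥ v : ℤ) / n : ℚ) : QZ)) :
    IsPresentation J X π := by
  classical
  refine ⟨hJ, hπ, fun u => ⟨fun h => ?_, ?_⟩, fun u v w k hk h => ?_⟩
  · have hdvd : ∀ i, ∃ w, (W *ᵥ u) i = n * w := by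
      intro i
      have := hform u (Pi.single i 1)
      rw [h, map_zero, AddMonoidHom.zero_apply, eq_comm, coe_div_eq_zero_iff hn] at this
      rwa [dotProduct_single, mul_one] at this
    choose w hw using hdvd
    refine ⟨w, ?_⟩
    have h1 : W *ᵥ u = n • w := funext fun i => by rw [hw, Pi.smul_apply, smul_eq_mul]
    have h2 := hJW u
    rw [h1, mulVec_smul] at h2
    exact smul_right_injective _ hn h2
  · rintro ⟨w, rfl⟩
    refine X.nondeg _ fun y => ?_
    obtain ⟨v, rfl⟩ := hπ y
    rw [hform, hWJ, coe_div_eq_zero_iff hn, smul_dotProduct]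
    exact ⟨_, rfl⟩
  · rw [hform]
    congr 1
    have h1 := hWJ w
    rw [h, mulVec_smul] at h1
    have h2 := congrArg (· ⬝ᵥ v) h1
    simp only [smul_dotProduct, smul_eq_mul] at h2
    have hn' : (n : ℚ) ≠ 0 := by exact_mod_cast hn
    have hk' : (k : ℚ) ≠ 0 := by exact_mod_cast hk
    rw [div_eq_div_iff hn' hk']
    have h3 : ((W *ᵥ u ⬝ᵥ v * k : ℤ) : ℚ) = ((w ⬝ᵥ v * n : ℤ) : ℚ) := by
      rw [mul_comm, h2, mul_comm]
    push_cast at h3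
    exact h3

/-! ### Linear plumbings -/

/-- A symmetric integer matrix `J` with cyclic cokernel of order `n`, generated by the basis vector
`i₀`, for which the `i₀` column of `J⁻¹` is `h / n`, with `i₀` entry `a / n`. -/
def HasPlumbing (n a : ℤ) : Prop :=
  ∃ (ι : Type) (_ : Fintype ι) (_ : DecidableEq ι) (i₀ : ι) (J : Matrix ι ι ℤ) (h : ι → ℤ),
    J.IsSymm ∧ J *ᵥ h = n • Pi.single i₀ 1 ∧ h i₀ = a ∧ (∀ u, J *ᵥ u = 0 → u = 0) ∧
      ∀ u, n ∣ h ⬝ᵥ u → ∃ w, J *ᵥ w = u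

theorem HasPlumbing.base {n a : ℤ} (hn : n ≠ 0) (ha : a * a = 1) : HasPlumbing n a := by
  have ha0 : a ≠ 0 := by rintro rfl; simp at ha
  refine ⟨Unit, inferInstance, inferInstance, (), fun _ _ => n * a, fun _ => a, rfl, ?_, rfl,
    ?_, ?_⟩
  · ext i
    simp [mulVec, dotProduct]
    rw [mul_assoc, ha, mul_one]
  · intro u hu
    ext i
    have := congrFun hu ()
    simpa [mulVec, dotProduct, hn, ha0] using this
  · rintro u ⟨w, hw⟩
    refine ⟨fun _ => w, ?_⟩
    ext i
    simp only [dotProduct, Finset.univ_unique, Finset.sum_singleton] at hw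
    simp only [mulVec, dotProduct, Finset.univ_unique, Finset.sum_singleton]
    calc n * a * w = a * (n * w) := by ring
      _ = a * (a * u default) := by rw [hw]
      _ = u i := by rw [← mul_assoc, ha, one_mul]

/-- Extending the plumbing by one vertex of weight `b` performs one step
`n / a = b - r / a` of a continued fraction expansion. -/
theorem HasPlumbing.step {a r : ℤ} (b : ℤ) (ha : a ≠ 0) (hn : b * a - r ≠ 0) :
    HasPlumbing a r → HasPlumbing (b * a - r) a := by
  rintro ⟨ι, _, _, i₀, J, h, hJ, hh, hr, hinj, hker⟩
  let M : Matrix (Option ι) (Option ι) ℤ := fun i j => match i, j with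
    | none, none => b
    | none, some j => if j = i₀ then 1 else 0
    | some i, none => if i = i₀ then 1 else 0
    | some i, some j => J i j
  have M1 : ∀ v, (M *ᵥ v) none = b * v none + v (some i₀) := by
    intro v
    simp [M, mulVec, dotProduct, Fintype.sum_option]
  have M2 : ∀ v i, (M *ᵥ v) (some i) = (v none • (Pi.single i₀ 1 : ι → ℤ) +
      J *ᵥ fun j => v (some j)) i := by
    intro v i
    simp [M, mulVec, dotProduct, Fintype.sum_option, Pi.single_apply]
  -- Pairing with `h` recovers the `i₀` coordinate of a preimage under `J`.
  have hpair : ∀ y, h ⬝ᵥ (J *ᵥ y) = a * y i₀ := by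
    intro y
    rw [dotProduct_mulVec, ← mulVec_transpose, hJ, hh, smul_dotProduct, single_dotProduct]
    simp
  have hsingle : ∀ x : ℤ, h ⬝ᵥ (x • Pi.single i₀ 1) = x * r := by
    intro x
    rw [dotProduct_smul, dotProduct_single, hr]
    simp
  refine ⟨Option ι, inferInstance, inferInstance, none, M,
    fun i => i.elim a fun j => -h j, ?_, ?_, rfl, ?_, ?_⟩
  · ext i j
    rcases i with _ | i <;> rcases j with _ | j
    · rfl
    · rfl
    · rfl
    · exact congrFun (congrFun hJ i) j
  · ext i
    rcases i with _ | i
    · rw [M1]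
      simp [hr]
      ring
    · rw [M2]
      have : (fun j => -h j) = -h := rfl
      simp [this, mulVec_neg, hh]
  · intro u hu
    have h1 := congrFun hu none
    rw [M1] at h1
    have h2 : u none • Pi.single i₀ 1 + J *ᵥ (fun j => u (some j)) = 0 :=
      funext fun i => (M2 u i).symm.trans (congrFun hu (some i))
    have h3 := congrArg (h ⬝ᵥ ·) h2
    simp only [dotProduct_add, hpair, hsingle, dotProduct_zero] at h3
    have h0 : u none = 0 := by
      refine (mul_eq_zero.1 (?_ : (b * a - r) * u none = 0)).resolve_left hn
      simp only [Pi.zero_apply] at h1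
      linear_combination a * h1 - h3
    rw [h0, zero_smul, zero_add] at h2
    have h4 := hinj _ h2
    ext i
    rcases i with _ | i
    · exact h0
    · exact congrFun h4 i
  · rintro u ⟨x, hx⟩
    rw [dotProduct, Fintype.sum_option] at hx
    simp only [Option.elim] at hx
    have hx' : a * u none - h ⬝ᵥ (fun j => u (some j)) = (b * a - r) * x := by
      rw [← hx]
      simp [dotProduct, sub_eq_add_neg]
    have h1 : h ⬝ᵥ ((fun j => u (some j)) - x • Pi.single i₀ 1) = a * (u none - b * x) := by
      rw [dotProduct_sub, hsingle]
      linear_combination -hx'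
    obtain ⟨y, hy⟩ := hker _ ⟨_, h1⟩
    have hy0 : y i₀ = u none - b * x := by
      refine mul_left_cancel₀ ha ?_
      rw [← h1, ← hy, hpair]
    refine ⟨fun i => i.elim x y, ?_⟩
    ext i
    rcases i with _ | i
    · rw [M1]
      simp [hy0]
    · rw [M2]
      have := congrFun hy i
      simp only [Pi.sub_apply] at this
      simp only [Option.elim, Pi.add_apply]
      change _ + (J *ᵥ y) i = _
      rw [this]
      ring

/-- By induction along the continued fraction expansion of `n / a`. -/
theorem hasPlumbing_of_coprime (n a : ℤ) (hn : n ≠ 0) (ha : a ≠ 0) (h : IsCoprime a n) :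
    HasPlumbing n a := by
  induction hk : a.natAbs using Nat.strong_induction_on generalizing n a with | h k ih => ?_
  by_cases h1 : IsUnit a
  · refine HasPlumbing.base hn ?_
    rcases Int.isUnit_iff.1 h1 with rfl | rfl <;> rfl
  · have hdiv := Int.mul_ediv_add_emod (-n) a
    set r := (-n) % a with hr_def
    set b := -((-n) / a) with hb
    have hnr : n = b * a - r := by rw [hb]; linear_combination hdiv
    have hcop : IsCoprime r a := by
      obtain ⟨s, t, hst⟩ := h
      exact ⟨-t, s + t * b, by rw [hnr] at hst; linear_combination hst⟩
    have hr0 : r ≠ 0 := by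
      rintro h0
      rw [h0, isCoprime_zero_left] at hcop
      exact h1 hcop
    have hlt : r.natAbs < k := by
      have h2 := Int.emod_nonneg (-n) ha
      have h3 := Int.emod_lt_abs (-n) ha
      rw [Int.abs_eq_natAbs] at h3
      omega
    rw [hnr] at hn ⊢
    exact HasPlumbing.step b ha hn (ih _ hlt a r ha hr0 hcop rfl)

theorem presentable_cyclic (n : ℕ) [NeZero n] (hn1 : n ≠ 1) (a : (ZMod n)ˣ) :
    Presentable (cyclic n a) := by
  have hn : (n : ℤ) ≠ 0 := by exact_mod_cast NeZero.ne n
  obtain ⟨a₀, ha₀⟩ := ZMod.intCast_surjective (a : ZMod n)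
  obtain ⟨a', ha'⟩ := ZMod.intCast_surjective ((a⁻¹ : (ZMod n)ˣ) : ZMod n)
  have haa : ((a' * a₀ : ℤ) : ZMod n) = ((1 : ℤ) : ZMod n) := by
    push_cast
    rw [ha₀, ha']
    simp
  obtain ⟨t, ht⟩ : (n : ℤ) ∣ a' * a₀ - 1 := by
    rw [← ZMod.intCast_zmod_eq_zero_iff_dvd, Int.cast_sub, haa, sub_self]
  have hcop : IsCoprime a₀ n := ⟨a', -t, by linear_combination ht⟩
  have ha0 : a₀ ≠ 0 := by
    rintro rfl
    rw [isCoprime_zero_left, Int.isUnit_iff] at hcop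
    omega
  obtain ⟨ι, _, _, i₀, J, h, hJ, hh, hr, hinj, hker⟩ := hasPlumbing_of_coprime n a₀ hn ha0 hcop
  have hpair : ∀ y, h ⬝ᵥ (J *ᵥ y) = n * y i₀ := by
    intro y
    rw [dotProduct_mulVec, ← mulVec_transpose, hJ, hh, smul_dotProduct, single_dotProduct]
    simp
  have hker' : ∀ u, (n : ℤ) ∣ h ⬝ᵥ u ↔ ∃ w, J *ᵥ w = u := by
    refine fun u => ⟨hker u, ?_⟩
    rintro ⟨w, rfl⟩
    rw [hpair]
    exact ⟨_, rfl⟩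
  let π : (ι → ℤ) →+ ZMod n := AddMonoidHom.mk' (fun u => ((a' * h ⬝ᵥ u : ℤ) : ZMod n)) (by
    intro u v
    rw [dotProduct_add, mul_add]
    push_cast
    rfl)
  have hπ : ∀ u, π u = ((a' * h ⬝ᵥ u : ℤ) : ZMod n) := fun u => rfl
  refine ⟨ι, _, J, π, hJ, fun x => ?_, fun u => ?_, fun u v w k hk hw => ?_⟩
  · obtain ⟨x, rfl⟩ := ZMod.intCast_surjective (x : ZMod n)
    refine ⟨x • Pi.single i₀ 1, ?_⟩
    rw [hπ, dotProduct_smul, dotProduct_single, hr, smul_eq_mul, mul_one]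
    calc ((a' * (x * a₀) : ℤ) : ZMod n) = x * ((a' * a₀ : ℤ) : ZMod n) := by push_cast; ring
      _ = x := by rw [haa]; simp
  · rw [← hker']
    refine (ZMod.intCast_zmod_eq_zero_iff_dvd _ n).trans ?_
    exact ⟨fun h => (IsCoprime.symm ⟨a₀, -t, by linear_combination ht⟩ :
      IsCoprime (n : ℤ) a').dvd_of_dvd_mul_left h, fun h => h.mul_left _⟩
  · -- `u` is congruent to `s` times the generator modulo the image of `J`.
    set s := a' * h ⬝ᵥ u with hs
    obtain ⟨y, hy⟩ := hker (u - s • Pi.single i₀ 1) (by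
      rw [dotProduct_sub, dotProduct_smul, dotProduct_single, hr, hs]
      exact ⟨-t * h ⬝ᵥ u, by simp only [smul_eq_mul]; linear_combination (-(h ⬝ᵥ u)) * ht⟩)
    have hw' : (n : ℤ) • (w - k • y) = (k * s) • h := by
      rw [← sub_eq_zero]
      refine hinj _ ?_
      rw [mulVec_sub, mulVec_smul, mulVec_smul, mulVec_sub, mulVec_smul, hw, hh, hy]
      ext i
      simp
      ring
    have hv := congrArg (· ⬝ᵥ v) hw'
    simp only [smul_dotProduct, sub_dotProduct, smul_eq_mul] at hv
    change cyc n (a * π u * π v) = _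
    rw [hπ, hπ, ← hs, ← ha₀]
    have e1 : (a₀ : ZMod n) * (s : ℤ) * ((a' * h ⬝ᵥ v : ℤ) : ZMod n) =
        ((s * h ⬝ᵥ v : ℤ) : ZMod n) := by
      calc _ = ((a' * a₀ : ℤ) : ZMod n) * ((s * h ⬝ᵥ v : ℤ) : ZMod n) := by push_cast; ring
        _ = _ := by rw [haa]; simp
    rw [e1, cyc_intCast]
    have hk' : (k : ℚ) ≠ 0 := by exact_mod_cast hk
    have hn' : (n : ℚ) ≠ 0 := by exact_mod_cast NeZero.ne n
    have hv' : (n : ℚ) * ((w ⬝ᵥ v : ℤ) - k * (y ⬝ᵥ v : ℤ)) = k * s * (h ⬝ᵥ v : ℤ) := by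
      exact_mod_cast hv
    have e2 : ((w ⬝ᵥ v : ℤ) / k : ℚ) = ((s * h ⬝ᵥ v : ℤ) : ℚ) / n + ((y ⬝ᵥ v : ℤ) : ℚ) := by
      push_cast
      field_simp
      linear_combination hv'
    rw [e2, AddCircle.coe_add, coe_intCast_eq_zero, add_zero]

/-! ### Presentation of all forms -/

theorem presentable_evenForm_false (k : ℕ) : Presentable (evenForm k false) := by
  have hn : ((2 ^ k : ℕ) : ℤ) ≠ 0 := by positivity
  let π : (Fin 2 → ℤ) →+ ZMod (2 ^ k) × ZMod (2 ^ k) :=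
    AddMonoidHom.mk' (fun u => (u 0, u 1)) (by intro u v; simp)
  refine ⟨Fin 2, inferInstance, !![0, 2 ^ k; 2 ^ k, 0], π,
    isPresentation_of_inverse (W := !![0, 1; 1, 0]) (n := (2 ^ k : ℕ)) hn ?_ ?_ ?_ ?_ ?_⟩
  · ext i j; fin_cases i <;> fin_cases j <;> rfl
  · intro u; ext i; fin_cases i <;> simp [Matrix.mulVec, dotProduct, Fin.sum_univ_two]
  · intro u; ext i; fin_cases i <;> simp [Matrix.mulVec, dotProduct, Fin.sum_univ_two]
  · rintro ⟨x, y⟩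
    obtain ⟨x, rfl⟩ := ZMod.intCast_surjective (x : ZMod (2 ^ k))
    obtain ⟨y, rfl⟩ := ZMod.intCast_surjective (y : ZMod (2 ^ k))
    exact ⟨![x, y], rfl⟩
  · intro u v
    change cyc (2 ^ k) ((0 * (u 0 : ZMod (2 ^ k)) + 1 * (u 1 : ZMod (2 ^ k))) * (v 0 : ZMod (2 ^ k)) +
      (1 * (u 0 : ZMod (2 ^ k)) + 0 * (u 1 : ZMod (2 ^ k))) * (v 1 : ZMod (2 ^ k))) = _
    have : ((0 * (u 0 : ZMod (2 ^ k)) + 1 * (u 1 : ZMod (2 ^ k))) * (v 0 : ZMod (2 ^ k)) +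
      (1 * (u 0 : ZMod (2 ^ k)) + 0 * (u 1 : ZMod (2 ^ k))) * (v 1 : ZMod (2 ^ k))) =
      ((!![0, 1; 1, 0] *ᵥ u ⬝ᵥ v : ℤ) : ZMod (2 ^ k)) := by
      simp [Matrix.mulVec, dotProduct, Fin.sum_univ_two]
    rw [this, cyc_intCast, Int.cast_natCast]

theorem exists_two_pow_eq (k : ℕ) : ∃ t ε : ℤ, (2 : ℤ) ^ k = 3 * t + ε ∧ ε * ε = 1 := by
  induction k with
  | zero => exact ⟨0, 1, by simp, by simp⟩
  | succ k ih =>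
    obtain ⟨t, ε, h, hε⟩ := ih
    exact ⟨2 * t + ε, -ε, by rw [pow_succ, h]; ring, by linear_combination hε⟩

/-- With `2ᵏ = 3 t + ε` and `ε = ±1`, the inverse of the integral matrix below has upper left block
`(2 1; 1 2) / 2ᵏ`. -/
theorem presentable_evenForm_true (k : ℕ) : Presentable (evenForm k true) := by
  have hn : ((2 ^ k : ℕ) : ℤ) ≠ 0 := by positivity
  obtain ⟨t, ε, ht, hε⟩ := exists_two_pow_eq k
  have ht' : (3 * t + ε : ZMod (2 ^ k)) = 0 := by
    have h0 : ((2 ^ k : ℕ) : ZMod (2 ^ k)) = 0 := ZMod.natCast_self _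
    have h1 := congrArg (Int.cast : ℤ → ZMod (2 ^ k)) ht
    push_cast at h0 h1
    rw [← h1, h0]
  have hε' : (ε * ε : ZMod (2 ^ k)) = 1 := by
    exact_mod_cast congrArg (Int.cast : ℤ → ZMod (2 ^ k)) hε
  let π : (Fin 3 → ℤ) →+ ZMod (2 ^ k) × ZMod (2 ^ k) :=
    AddMonoidHom.mk' (fun u => (u 0 + t * u 2, u 1 + t * u 2)) (by
      intro u v
      refine Prod.ext ?_ ?_ <;> simp <;> ring)
  refine ⟨Fin 3, inferInstance, !![2 * t + ε, -t, 1; -t, 2 * t + ε, 1; 1, 1, 3 * ε], π,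
    isPresentation_of_inverse (W := !![2, 1, -ε; 1, 2, -ε; -ε, -ε, 1 + ε * t])
      (n := (2 ^ k : ℕ)) hn ?_ ?_ ?_ ?_ ?_⟩
  · ext i j; fin_cases i <;> fin_cases j <;> rfl
  · intro u; ext i
    fin_cases i <;> simp [Matrix.mulVec, dotProduct, Fin.sum_univ_three, ht]
    · linear_combination (-u 2) * hε
    · linear_combination (-u 2) * hε
    · linear_combination (-2 * u 2 + 3 * t * u 2 + 2 * u 2 - 3 * u 0 - 3 * u 1) * hε
  · intro u; ext i
    fin_cases i <;> simp [Matrix.mulVec, dotProduct, Fin.sum_univ_three, ht]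
    · linear_combination (-3 * u 2) * hε
    · linear_combination (-3 * u 2) * hε
    · linear_combination (-(u 0 + u 1)) * hε + (3 * t * u 2) * hε
  · rintro ⟨x, y⟩
    obtain ⟨x, rfl⟩ := ZMod.intCast_surjective (x : ZMod (2 ^ k))
    obtain ⟨y, rfl⟩ := ZMod.intCast_surjective (y : ZMod (2 ^ k))
    refine ⟨![x, y, 0], Prod.ext ?_ ?_⟩
    · change (x : ZMod (2 ^ k)) + t * ((0 : ℤ) : ZMod (2 ^ k)) = x
      simp
    · change (y : ZMod (2 ^ k)) + t * ((0 : ℤ) : ZMod (2 ^ k)) = y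
      simp
  · intro u v
    have : (2 * (u 0 + t * u 2 : ZMod (2 ^ k)) + 1 * (u 1 + t * u 2)) * (v 0 + t * v 2) +
        (1 * (u 0 + t * u 2) + 2 * (u 1 + t * u 2)) * (v 1 + t * v 2) =
        ((!![2, 1, -ε; 1, 2, -ε; -ε, -ε, 1 + ε * t] *ᵥ u ⬝ᵥ v : ℤ) : ZMod (2 ^ k)) := by
      simp [Matrix.mulVec, dotProduct, Fin.sum_univ_three]
      linear_combination ((u 0 : ZMod (2 ^ k)) * v 2 + u 1 * v 2 + u 2 * v 0 + u 2 * v 1 +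
        2 * t * u 2 * v 2 - ε * u 2 * v 2) * ht' + (u 2 * v 2 : ZMod (2 ^ k)) * hε'
    refine (congrArg (cyc (2 ^ k)) this).trans ?_
    rw [cyc_intCast, Int.cast_natCast]

/-- Every finite linking form is presented by a symmetric integer matrix. -/
theorem presentable (X : FiniteForm) : Presentable X := by
  have key : ∀ x : FormClass, ∀ X : FiniteForm, X.cls = x → Presentable X := by
    have prod : ∀ {P : FiniteForm} {y : FormClass}, Presentable P →
        (∀ X : FiniteForm, X.cls = y → Presentable X) →
        ∀ X : FiniteForm, X.cls = P.cls + y → Presentable X := by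
      intro P y hP ih X hX
      induction y using FormClass.ind with | h Y => ?_
      exact Presentable.of_iso (cls_eq_iff.1 hX.symm) (hP.prod (ih Y rfl))
    intro x
    induction x using FormClass.induction_pieces with
    | zero => exact fun X hX => Presentable.of_iso (cls_eq_iff.1 hX.symm) Presentable.zero
    | cyc q k a y hk ih =>
      rename_i hq
      exact prod (presentable_cyclic _ (Nat.one_lt_pow hk hq.out.one_lt).ne' a) ih
    | even k ε y hk ih =>
      cases ε
      · exact prod (presentable_evenForm_false k) ih
      · exact prod (presentable_evenForm_true k) ih
  exact key _ X rfl

/-! ### Rank and torsion of a pair `(A, ℓ)` -/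

theorem finite_torsion_of_fg (A : Type) [AddCommGroup A] [AddGroup.FG A] :
    Finite (AddCommGroup.torsion A) := by
  have h : Finite (Submodule.torsion ℤ A) :=
    Module.finite_of_fg_torsion _ (Submodule.torsion_isTorsion)
  rw [← Submodule.torsion_int]
  exact h

/-- A finitely generated abelian group is the direct sum of a free group and its torsion
subgroup. -/
theorem exists_torsion_splitting (A : Type) [AddCommGroup A] [AddGroup.FG A] :
    ∃ Φ : ((Fin (Module.finrank ℤ A) → ℤ) × AddCommGroup.torsion A) ≃+ A,
      ∀ t : AddCommGroup.torsion A, Φ (0, t) = t := by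
  let N := AddSubgroup.toIntSubmodule (AddCommGroup.torsion A)
  have hN : N = Submodule.torsion ℤ A := by
    rw [show N = AddSubgroup.toIntSubmodule (AddCommGroup.torsion A) from rfl,
      ← Submodule.torsion_int, Submodule.toAddSubgroup_toIntSubmodule]
  have hfree : Module.Free ℤ (A ⧸ N) := by rw [hN]; infer_instance
  obtain ⟨s, hs⟩ := LinearMap.exists_rightInverse_of_surjective N.mkQ N.range_mkQ
  have hs' : ∀ x, N.mkQ (s x) = x := fun x => LinearMap.congr_fun hs x
  have hrank : Module.finrank ℤ (A ⧸ N) = Module.finrank ℤ A := finrank_quotient_torsion_eq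
  let b : (A ⧸ N) ≃ₗ[ℤ] (Fin (Module.finrank ℤ A) → ℤ) :=
    (Module.finBasisOfFinrankEq ℤ (A ⧸ N) hrank).equivFun
  let ψ : ((Fin (Module.finrank ℤ A) → ℤ) × AddCommGroup.torsion A) →+ A :=
    (s.toAddMonoidHom.comp b.symm.toAddEquiv.toAddMonoidHom).coprod (AddCommGroup.torsion A).subtype
  have hψ : ∀ u t, ψ (u, t) = s (b.symm u) + t := fun _ _ => rfl
  have hmk : ∀ t : AddCommGroup.torsion A, N.mkQ (t : A) = 0 := fun t =>
    (Submodule.Quotient.mk_eq_zero N).2 t.2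
  refine ⟨AddEquiv.ofBijective ψ ⟨?_, fun a => ?_⟩, fun t => ?_⟩
  · rw [injective_iff_map_eq_zero]
    rintro ⟨u, t⟩ h
    rw [hψ] at h
    have h1 := congrArg N.mkQ h
    rw [map_add, hs', hmk, add_zero, map_zero] at h1
    have h2 : u = 0 := by simpa using h1
    subst h2
    rw [map_zero, map_zero, zero_add] at h
    exact Prod.ext rfl (Subtype.ext h)
  · have hmem : a - s (N.mkQ a) ∈ N := by
      rw [← Submodule.Quotient.mk_eq_zero, ← Submodule.mkQ_apply, map_sub, hs', sub_self]
    refine ⟨(b (N.mkQ a), ⟨_, hmem⟩), ?_⟩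
    rw [hψ]
    simp
  · change ψ (0, t) = t
    rw [hψ]
    simp

namespace LinkedGroup

/-- The linking form of a pair, as a form on a finite group. -/
def tors (X : LinkedGroup) : FiniteForm where
  T := AddCommGroup.torsion X.A
  fin := by
    have := X.fg
    exact finite_torsion_of_fg X.A
  form := X.form
  symm := X.symm
  nondeg := X.nondeg

/-- The rank of the group of a pair. -/
def rank (X : LinkedGroup) : ℕ := Module.finrank ℤ X.A

theorem exists_splitting (X : LinkedGroup) : ∃ Φ : ((Fin X.rank → ℤ) × X.tors.T) ≃+ X.A,
    ∀ t : AddCommGroup.torsion X.A, Φ (0, t) = t := by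
  have := X.fg
  exact exists_torsion_splitting X.A

theorem equivalent_iff (X Y : LinkedGroup) :
    Equivalent X Y ↔ X.rank = Y.rank ∧ X.tors.cls = Y.tors.cls := by
  constructor
  · rintro ⟨φ, hφ⟩
    refine ⟨LinearEquiv.finrank_eq φ.toIntLinearEquiv, ?_⟩
    have h1 : ∀ x : AddCommGroup.torsion X.A, φ x ∈ AddCommGroup.torsion Y.A :=
      fun x => mem_torsion_map φ x.2
    have h2 : ∀ x : AddCommGroup.torsion Y.A, φ.symm x ∈ AddCommGroup.torsion X.A :=
      fun x => mem_torsion_map φ.symm x.2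
    refine cls_eq_iff.2 ⟨⟨⟨fun x : AddCommGroup.torsion X.A =>
      (⟨φ x, h1 x⟩ : AddCommGroup.torsion Y.A), fun x : AddCommGroup.torsion Y.A =>
      (⟨φ.symm x, h2 x⟩ : AddCommGroup.torsion X.A), fun x => ?_, fun x => ?_⟩, fun x y => ?_⟩,
      fun x y => hφ _ _ _ _ rfl rfl⟩
    · exact Subtype.ext (φ.symm_apply_apply _)
    · exact Subtype.ext (φ.apply_symm_apply _)
    · exact Subtype.ext (map_add φ _ _)
  · rintro ⟨hr, hT⟩
    obtain ⟨ψ, hψ⟩ := cls_eq_iff.1 hT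
    obtain ⟨Φ, hΦ⟩ := X.exists_splitting
    have hY := Y.exists_splitting
    rw [← hr] at hY
    obtain ⟨Φ', hΦ'⟩ := hY
    refine ⟨Φ.symm.trans (((AddEquiv.refl _).prodCongr ψ).trans Φ'), fun x y x' y' hx hy => ?_⟩
    have key : ∀ (x : AddCommGroup.torsion X.A) (x' : AddCommGroup.torsion Y.A),
        (x' : Y.A) = Φ' (((AddEquiv.refl _).prodCongr ψ) (Φ.symm x)) → x' = ψ x := by
      intro x x' hx
      have h1 : Φ.symm x = (0, x) := (AddEquiv.symm_apply_eq Φ).2 (hΦ x).symm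
      rw [h1] at hx
      exact Subtype.ext (hx.trans (hΦ' _))
    rw [key x x' hx, key y y' hy]
    exact hψ x y

/-- The pair `(ℤʳ ⊕ T, ℓ)` attached to a finite linking form `(T, ℓ)`. -/
def ofForm (r : ℕ) (F : FiniteForm) : LinkedGroup where
  A := (Fin r → ℤ) × F.T
  fg := Module.Finite.iff_addGroup_fg.1 inferInstance
  form := (F.form.comp ((AddMonoidHom.snd _ _).comp (AddSubgroup.subtype _))).flip.comp
    ((AddMonoidHom.snd _ _).comp (AddSubgroup.subtype _)) |>.flip
  symm x y := F.symm _ _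
  nondeg x h := by
    have hfst : x.1.1 = 0 := by
      obtain ⟨n, hn, h0⟩ := (isOfFinAddOrder_iff_nsmul_eq_zero).1 x.2
      exact (smul_eq_zero.1 (congrArg Prod.fst h0)).resolve_left hn.ne'
    refine Subtype.ext (Prod.ext hfst (F.nondeg _ fun y => ?_))
    refine h ⟨(0, y), ?_⟩
    obtain ⟨n, hn, h0⟩ := (isOfFinAddOrder_iff_nsmul_eq_zero).1 (isOfFinAddOrder_of_finite y)
    exact (isOfFinAddOrder_iff_nsmul_eq_zero).2 ⟨n, hn, Prod.ext (smul_zero n) h0⟩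

theorem mem_torsion_ofForm (r : ℕ) (F : FiniteForm) (x : (Fin r → ℤ) × F.T) :
    x ∈ AddCommGroup.torsion ((Fin r → ℤ) × F.T) ↔ x.1 = 0 := by
  constructor
  · intro hx
    obtain ⟨n, hn, h0⟩ := (isOfFinAddOrder_iff_nsmul_eq_zero).1 hx
    exact (smul_eq_zero.1 (congrArg Prod.fst h0)).resolve_left hn.ne'
  · intro hx
    obtain ⟨n, hn, h0⟩ := (isOfFinAddOrder_iff_nsmul_eq_zero).1 (isOfFinAddOrder_of_finite x.2)
    exact (isOfFinAddOrder_iff_nsmul_eq_zero).2 ⟨n, hn, Prod.ext (by simp [hx]) h0⟩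

theorem rank_ofForm (r : ℕ) (F : FiniteForm) : (ofForm r F).rank = r := by
  have h : Module.IsTorsion ℤ F.T := by
    intro x
    obtain ⟨n, hn, h0⟩ := (isOfFinAddOrder_iff_nsmul_eq_zero).1 (isOfFinAddOrder_of_finite x)
    exact ⟨⟨n, mem_nonZeroDivisors_of_ne_zero (by exact_mod_cast hn.ne')⟩, by
      change (n : ℤ) • x = 0
      rwa [natCast_zsmul]⟩
  change Module.finrank ℤ ((Fin r → ℤ) × F.T) = r
  have e : (((Fin r → ℤ) × F.T) ⧸ LinearMap.ker (LinearMap.fst ℤ (Fin r → ℤ) F.T)) ≃ₗ[ℤ]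
      (Fin r → ℤ) := (LinearMap.fst ℤ (Fin r → ℤ) F.T).quotKerEquivOfSurjective
        LinearMap.fst_surjective
  rw [← finrank_quotient_eq_of_le_torsion (M' := LinearMap.ker (LinearMap.fst ℤ (Fin r → ℤ) F.T)),
    e.finrank_eq]
  · simp
  · intro x hx
    obtain ⟨n, hn⟩ := @h x.2
    exact ⟨n, Prod.ext (by rw [Prod.smul_fst, show x.1 = 0 from hx, smul_zero]; rfl) hn⟩

theorem cls_tors_ofForm (r : ℕ) (F : FiniteForm) : (ofForm r F).tors.cls = F.cls := by
  refine cls_eq_iff.2 ⟨⟨⟨fun x => x.1.2, fun y => ⟨(0, y), (mem_torsion_ofForm r F _).2 rfl⟩,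
    fun x => ?_, fun x => rfl⟩, fun x y => rfl⟩, fun x y => rfl⟩
  exact Subtype.ext (Prod.ext ((mem_torsion_ofForm r F _).1 x.2).symm rfl)

end LinkedGroup

/-- Equivalence classes of pairs are classified by the rank and the class of the linking form. -/
def linkedClassEquiv : LinkedClass ≃ ℕ × FormClass :=
  Equiv.ofBijective (fun X => (X.rep.rank, X.rep.tors.cls)) (by
    constructor
    · intro X Y h
      have h1 : LinkedGroup.Equivalent X.rep Y.rep :=
        (LinkedGroup.equivalent_iff _ _).2 ⟨congrArg Prod.fst h, congrArg Prod.snd h⟩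
      exact Quotient.out_equiv_out.1 h1
    · rintro ⟨r, x⟩
      induction x using FormClass.ind with | h F => ?_
      refine ⟨Quotient.mk _ (LinkedGroup.ofForm r F), ?_⟩
      have h1 : LinkedGroup.Equivalent (LinkedClass.rep (Quotient.mk _ (LinkedGroup.ofForm r F)))
          (LinkedGroup.ofForm r F) := Quotient.mk_out (s := LinkedGroup.setoid) _
      obtain ⟨h2, h3⟩ := (LinkedGroup.equivalent_iff _ _).1 h1
      exact Prod.ext (h2.trans (LinkedGroup.rank_ofForm r F))
        (h3.trans (LinkedGroup.cls_tors_ofForm r F)))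

theorem linkedClassEquiv_apply (X : LinkedClass) :
    linkedClassEquiv X = (X.rep.rank, X.rep.tors.cls) := rfl

/-- The number of classes of pairs with group of order `n` is the number of finite linking forms
of order `n`. -/
theorem numForms_eq (n : ℕ) (hn : n ≠ 0) : numForms n = Nat.card {x : FormClass // card x = n} := by
  have hcard : ∀ X : LinkedClass, Nat.card X.rep.A = n ↔
      X.rep.rank = 0 ∧ card X.rep.tors.cls = n := by
    intro X
    obtain ⟨Φ, -⟩ := X.rep.exists_splitting
    rw [← Nat.card_congr Φ.toEquiv, Nat.card_prod, Nat.card_fun, Nat.card_fin, card_cls]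
    rcases Nat.eq_zero_or_pos X.rep.rank with h | h
    · simp [h]
    · simp only [Nat.card_eq_zero_of_infinite, zero_pow h.ne', zero_mul]
      constructor
      · intro h0; exact absurd h0.symm hn
      · rintro ⟨h0, -⟩; omega
  rw [numForms]
  refine Nat.card_congr ⟨fun X => ⟨X.1.rep.tors.cls, ((hcard X.1).1 X.2).2⟩,
    fun x => ⟨linkedClassEquiv.symm (0, x.1), ?_⟩, fun X => ?_, fun x => ?_⟩
  · have h := linkedClassEquiv.apply_symm_apply (0, x.1)
    rw [hcard]
    exact ⟨congrArg Prod.fst h, (congrArg (fun t => card t.2) h).trans x.2⟩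
  · refine Subtype.ext ((Equiv.symm_apply_eq _).2 ?_)
    exact Prod.ext ((hcard X.1).1 X.2).1.symm rfl
  · exact Subtype.ext (congrArg Prod.snd (linkedClassEquiv.apply_symm_apply (0, x.1)))

/-! ### Existence of surgery presentations -/

/-- Every triple `(A, ℓ, f)` has a surgery presentation. -/
theorem nonempty_surgeryPresentation (X : LinkedGroup) {g : ℕ} (f : Fin g → X.A) :
    Nonempty (SurgeryPresentation X f) := by
  classical
  obtain ⟨ι, _, J, π, hJ⟩ := presentable X.tors
  obtain ⟨Φ, hΦ⟩ := X.exists_splitting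
  let m := Fintype.card (Fin X.rank ⊕ ι)
  let σ : Fin m ≃ Fin X.rank ⊕ ι := (Fintype.equivFin _).symm
  let l : (Fin m → ℤ) →+ (Fin X.rank → ℤ) := ⟨⟨fun u i => u (σ.symm (.inl i)), rfl⟩, fun _ _ => rfl⟩
  let r : (Fin m → ℤ) →+ (ι → ℤ) := ⟨⟨fun u i => u (σ.symm (.inr i)), rfl⟩, fun _ _ => rfl⟩
  have hlr : ∀ u v : Fin m → ℤ, l u = l v → r u = r v → u = v := by
    intro u v h1 h2
    funext i
    obtain ⟨i, rfl⟩ := σ.symm.surjective i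
    rcases i with i | i
    · exact congrFun h1 i
    · exact congrFun h2 i
  have hex : ∀ (a : Fin X.rank → ℤ) (b : ι → ℤ), ∃ u, l u = a ∧ r u = b := by
    intro a b
    refine ⟨fun i => Sum.elim a b (σ i), ?_, ?_⟩ <;> funext i <;> simp [l, r]
  let J' : Matrix (Fin m) (Fin m) ℤ := (fromBlocks 0 0 0 J).submatrix σ σ
  have hl : ∀ w, l (J' *ᵥ w) = 0 := by
    intro w
    rw [submatrix_mulVec_equiv, fromBlocks_mulVec]
    ext i
    simp [l]
  have hr : ∀ w, r (J' *ᵥ w) = J *ᵥ r w := by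
    intro w
    rw [submatrix_mulVec_equiv, fromBlocks_mulVec]
    ext i
    simp [r, Function.comp_def]
  let proj : (Fin m → ℤ) →+ X.A := Φ.toAddMonoidHom.comp (l.prod (π.comp r))
  have hproj : ∀ u, proj u = Φ (l u, π (r u)) := fun u => rfl
  have hsurj : Function.Surjective proj := by
    intro a
    obtain ⟨⟨x, t⟩, rfl⟩ := Φ.surjective a
    obtain ⟨y, rfl⟩ := hJ.surj t
    obtain ⟨u, rfl, rfl⟩ := hex x y
    exact ⟨u, rfl⟩
  have htor : ∀ (u : Fin m → ℤ) (x : AddCommGroup.torsion X.A), proj u = x →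
      l u = 0 ∧ π (r u) = x := by
    intro u x h
    rw [hproj, ← hΦ, Φ.injective.eq_iff] at h
    exact ⟨congrArg Prod.fst h, congrArg Prod.snd h⟩
  choose F hF using fun k => hsurj (f k)
  let L : Matrix (Fin (m + g)) (Fin (m + g)) ℤ :=
    (fromBlocks J' (fun i k => F k i) (fun k i => F k i) 0).submatrix
      finSumFinEquiv.symm finSumFinEquiv.symm
  have hJ'symm : J'.IsSymm := by
    refine Matrix.IsSymm.submatrix ?_ σ
    exact Matrix.IsSymm.fromBlocks (Matrix.isSymm_zero) (by simp) hJ.isSymm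
  have hLJ : L.submatrix (Fin.castAdd g) (Fin.castAdd g) = J' := by
    ext i j
    simp only [L, submatrix_apply, finSumFinEquiv_symm_apply_castAdd]
    rfl
  refine ⟨⟨m, L, ?_, proj, hsurj, fun u => ?_, fun k => ?_, ?_⟩⟩
  · refine Matrix.IsSymm.submatrix ?_ _
    exact Matrix.IsSymm.fromBlocks hJ'symm rfl Matrix.isSymm_zero
  · rw [hLJ, hproj, map_eq_zero_iff Φ Φ.injective]
    constructor
    · intro h
      obtain ⟨w, hw⟩ := (hJ.ker_eq (r u)).1 (congrArg Prod.snd h)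
      obtain ⟨w', -, rfl⟩ := hex 0 w
      exact ⟨w', hlr _ _ ((hl w').trans (congrArg Prod.fst h).symm) ((hr w').trans hw)⟩
    · rintro ⟨w, rfl⟩
      exact Prod.ext (hl w) ((hJ.ker_eq _).2 ⟨_, (hr w).symm⟩)
  · rw [← hF k]
    congr 1
    ext i
    simp only [L, submatrix_apply, finSumFinEquiv_symm_apply_castAdd,
      finSumFinEquiv_symm_apply_natAdd]
    rfl
  · intro x y u v w n hu hv hn h
    rw [hLJ] at h
    obtain ⟨-, hu2⟩ := htor u x hu
    obtain ⟨hv1, hv2⟩ := htor v y hv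
    have h1 := hJ.form_eq (r u) (r v) (r w) n hn (by rw [← hr, h, map_zsmul])
    rw [hu2, hv2] at h1
    refine h1.trans ?_
    congr 3
    simp only [dotProduct]
    rw [← σ.symm.sum_comp, Fintype.sum_sum_type]
    have hv0 : ∀ i, v (σ.symm (.inl i)) = 0 := fun i => congrFun hv1 i
    simp [hv0, r]

/-! ### The surgery formula for Dijkgraaf–Witten theory -/

/-- For symmetric `L` the form `L ⊗ q` pairs the `G*`-components with the `G`-components through `L`,
so it is linear in each of the two. -/
theorem tensorForm_dwForm {G : Type} [AddCommGroup G] {n : ℕ} (L : Matrix (Fin n) (Fin n) ℤ)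
    (hL : L.IsSymm) (z : Fin n → DWGroup G) :
    tensorForm L (dwForm G) z = ∑ i, ∑ j, L i j • (z i).2 (z j).1 := by
  have hpol : ∀ i j, polar (dwForm G) (z i) (z j) = (z i).2 (z j).1 + (z j).2 (z i).1 := by
    intro i j
    simp only [polar, dwForm, Prod.fst_add, Prod.snd_add, map_add, AddMonoidHom.add_apply]
    abel
  have hIoi : ∀ i, ∑ j ∈ Finset.Ioi i, L i j • polar (dwForm G) (z i) (z j) =
      (∑ j, if i < j then L i j • (z i).2 (z j).1 else 0) +
        ∑ j, if i < j then L j i • (z j).2 (z i).1 else 0 := by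
    intro i
    rw [← Finset.sum_add_distrib, ← Finset.filter_lt_eq_Ioi, Finset.sum_filter]
    refine Finset.sum_congr rfl fun j _ => ?_
    split_ifs
    · rw [hpol, smul_add, hL.apply]
    · rw [add_zero]
  rw [tensorForm]
  simp_rw [hIoi]
  rw [Finset.sum_add_distrib, Finset.sum_comm (f := fun i j => if i < j then L j i • _ else 0),
    ← Finset.sum_add_distrib, ← Finset.sum_add_distrib]
  refine Finset.sum_congr rfl fun i _ => ?_
  rw [← Finset.sum_add_distrib]
  have hd : L i i • dwForm G (z i) = ∑ j, if i = j then L i j • (z i).2 (z j).1 else 0 := by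
    rw [Finset.sum_ite_eq Finset.univ i, if_pos (Finset.mem_univ _)]
    rfl
  rw [hd, ← Finset.sum_add_distrib]
  refine Finset.sum_congr rfl fun j _ => ?_
  rcases lt_trichotomy i j with h | h | h
  · simp [h, h.ne, h.not_gt]
  · simp [h]
  · simp [h, h.ne', h.not_gt]

/-- Homomorphisms `A → C` that vanish on the elements `f k`. -/
abbrev VanishingHom (A C : Type) [AddCommGroup A] [AddCommGroup C] {g : ℕ} (f : Fin g → A) : Type :=
  {φ : A →+ C // ∀ k, φ (f k) = 0}

/-- In terms of a surgery presentation, homomorphisms `A → C` vanishing on `f` are vectors killed by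
the rows of the linking matrix that meet the surgery link. -/
theorem card_vanishingHom {X : LinkedGroup} {g : ℕ} {f : Fin g → X.A} (P : SurgeryPresentation X f)
    (C : Type) [AddCommGroup C] : Nat.card (VanishingHom X.A C f) =
      Nat.card {α : Fin P.m → C //
        (∀ j, ∑ i, P.L (Fin.castAdd g i) (Fin.castAdd g j) • α i = 0) ∧
        ∀ k, ∑ i, P.L (Fin.castAdd g i) (Fin.natAdd P.m k) • α i = 0} := by
  have hsum : ∀ (φ : (Fin P.m → ℤ) →+ C) (u : Fin P.m → ℤ),
      φ u = ∑ i, u i • φ (Pi.single i 1) := by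
    intro φ u
    conv_lhs => rw [← Finset.univ_sum_single u]
    rw [map_sum]
    refine Finset.sum_congr rfl fun i _ => ?_
    rw [← map_zsmul, ← Pi.single_smul, smul_eq_mul, mul_one]
  have hcol : ∀ j : Fin P.m, P.proj (fun i => P.L (Fin.castAdd g i) (Fin.castAdd g j)) = 0 := by
    intro j
    rw [P.ker_eq]
    refine ⟨Pi.single j 1, ?_⟩
    ext i
    simp
  refine Nat.card_congr (Equiv.ofBijective (fun φ => ⟨fun i => φ.1 (P.proj (Pi.single i 1)),
    fun j => ?_, fun k => ?_⟩) ⟨fun φ ψ h => ?_, fun α => ?_⟩)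
  · have := hsum (φ.1.comp P.proj) (fun i => P.L (Fin.castAdd g i) (Fin.castAdd g j))
    rw [AddMonoidHom.comp_apply, hcol, map_zero] at this
    exact this.symm
  · have := hsum (φ.1.comp P.proj) (fun i => P.L (Fin.castAdd g i) (Fin.natAdd P.m k))
    rw [AddMonoidHom.comp_apply, P.link_eq, φ.2] at this
    exact this.symm
  · refine Subtype.ext (AddMonoidHom.ext fun a => ?_)
    obtain ⟨u, rfl⟩ := P.surj a
    have h1 := hsum (φ.1.comp P.proj) u
    have h2 := hsum (ψ.1.comp P.proj) u
    have h3 : ∀ i, φ.1 (P.proj (Pi.single i 1)) = ψ.1 (P.proj (Pi.single i 1)) := fun i =>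
      congrFun (congrArg Subtype.val h) i
    simp only [AddMonoidHom.comp_apply, h3] at h1 h2
    rw [h1, h2]
  · obtain ⟨α, hα, hα'⟩ := α
    let χ : (Fin P.m → ℤ) →+ C := AddMonoidHom.mk' (fun u => ∑ i, u i • α i) (by
      intro u v
      rw [← Finset.sum_add_distrib]
      exact Finset.sum_congr rfl fun i _ => add_smul _ _ _)
    have hχ : ∀ u, χ u = ∑ i, u i • α i := fun _ => rfl
    have hker : P.proj.ker ≤ χ.ker := by
      intro u hu
      obtain ⟨w, rfl⟩ := (P.ker_eq u).1 hu
      rw [AddMonoidHom.mem_ker, hχ]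
      simp only [mulVec, dotProduct, submatrix_apply, Finset.sum_smul]
      rw [Finset.sum_comm]
      refine Finset.sum_eq_zero fun j _ => ?_
      simp_rw [mul_comm _ (w j), mul_smul, ← Finset.smul_sum, hα, smul_zero]
    let φ : X.A →+ C := AddMonoidHom.liftOfSurjective P.proj P.surj ⟨χ, hker⟩
    have hφ : ∀ u, φ (P.proj u) = χ u := fun u =>
      AddMonoidHom.liftOfRightInverse_comp_apply P.proj _ _ ⟨χ, hker⟩ u
    refine ⟨⟨φ, fun k => ?_⟩, Subtype.ext (funext fun i => ?_)⟩
    · rw [← P.link_eq, hφ]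
      exact hα' k
    · change φ (P.proj (Pi.single i 1)) = α i
      rw [hφ, hχ, Finset.sum_eq_single i]
      · simp
      · intro j _ hj; simp [hj]
      · intro h; exact absurd (Finset.mem_univ i) h

instance (n : ℕ) [NeZero n] : Finite (ZMod n →+ QZ) :=
  Nat.finite_of_card_ne_zero (by rw [card_dual_zmod]; exact NeZero.ne n)

theorem card_dwGroup (n : ℕ) [NeZero n] : Nat.card (DWGroup (ZMod n)) = n ^ 2 := by
  rw [Nat.card_prod, card_dual_zmod, Nat.card_zmod, sq]

theorem sqrt_card_dwGroup (n : ℕ) [NeZero n] : Real.sqrt (Nat.card (DWGroup (ZMod n))) = n := by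
  rw [card_dwGroup, Nat.cast_pow, Real.sqrt_sq (Nat.cast_nonneg n)]

open Classical in
/-- Summing the phases first over the `G`-components turns the surgery formula into a count of
homomorphisms `A → G*` that vanish on `f`. -/
theorem sum_phases (n : ℕ) [NeZero n] {X : LinkedGroup} {g : ℕ} {f : Fin g → X.A}
    (P : SurgeryPresentation X f) :
    ∑ᶠ c : Fin g → neumann (ZMod n), ∑ᶠ x : Fin P.m → DWGroup (ZMod n),
      e (-tensorForm P.L (dwForm (ZMod n)) (Fin.append x fun i => (c i : DWGroup (ZMod n)))) =
      (n : ℂ) ^ (P.m + g) * Nat.card (VanishingHom X.A (ZMod n →+ QZ) f) := by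
  let : Fintype (ZMod n →+ QZ) := Fintype.ofFinite _
  let N : (ZMod n) ≃ neumann (ZMod n) := ⟨fun a => ⟨(a, 0), ⟨trivial, rfl⟩⟩, fun c => c.1.1,
    fun a => rfl, fun c => Subtype.ext (Prod.ext rfl c.2.2.symm)⟩
  let : Fintype (neumann (ZMod n)) := Fintype.ofEquiv _ N
  simp_rw [finsum_eq_sum_of_fintype]
  rw [← (Equiv.arrowCongr (Equiv.refl (Fin g)) N).sum_comp]
  have hx : ∀ c : Fin g → neumann (ZMod n), ∑ x : Fin P.m → DWGroup (ZMod n),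
      e (-tensorForm P.L (dwForm (ZMod n)) (Fin.append x fun i => (c i : DWGroup (ZMod n)))) =
      ∑ α : Fin P.m → (ZMod n →+ QZ), ∑ a : Fin P.m → ZMod n, e (-tensorForm P.L (dwForm (ZMod n))
        (Fin.append (fun i => (a i, α i)) fun i => (c i : DWGroup (ZMod n)))) := by
    intro c
    rw [Finset.sum_comm, ← Finset.sum_product']
    exact Fintype.sum_equiv (Equiv.arrowProdEquivProdArrow (Fin P.m) (fun _ => ZMod n)
      (fun _ => ZMod n →+ QZ))
      _ _ fun x => rfl
  simp_rw [hx]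
  rw [Finset.sum_comm]
  -- For fixed `α` the phase is a character of `Gᵍ × Gᵐ`.
  let β : (Fin P.m → (ZMod n →+ QZ)) → ((Fin g → ZMod n) × (Fin P.m → ZMod n) →+ QZ) := fun α =>
    AddMonoidHom.mk' (fun y =>
      -(∑ j, (∑ i, P.L (Fin.castAdd g i) (Fin.castAdd g j) • α i) (y.2 j) +
        ∑ k, (∑ i, P.L (Fin.castAdd g i) (Fin.natAdd P.m k) • α i) (y.1 k))) (by
      intro y y'
      simp only [Prod.fst_add, Prod.snd_add, Pi.add_apply, map_add, Finset.sum_add_distrib]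
      abel)
  have hβ : ∀ α y, β α y = -(∑ j, (∑ i, P.L (Fin.castAdd g i) (Fin.castAdd g j) • α i) (y.2 j) +
        ∑ k, (∑ i, P.L (Fin.castAdd g i) (Fin.natAdd P.m k) • α i) (y.1 k)) := fun _ _ => rfl
  have hphase : ∀ (α : Fin P.m → (ZMod n →+ QZ)) (c : Fin g → ZMod n) (a : Fin P.m → ZMod n),
      -tensorForm P.L (dwForm (ZMod n)) (Fin.append (fun i => (a i, α i))
        fun i => ((Equiv.arrowCongr (Equiv.refl (Fin g)) N) c i : DWGroup (ZMod n))) =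
      β α (c, a) := by
    intro α c a
    have hc : ∀ k, ((Equiv.arrowCongr (Equiv.refl (Fin g)) N) c k : DWGroup (ZMod n)) = (c k, 0) :=
      fun k => rfl
    rw [tensorForm_dwForm _ P.isSymm, Fin.sum_univ_add, hβ]
    simp only [Fin.sum_univ_add, Fin.append_left, Fin.append_right, hc, AddMonoidHom.zero_apply,
      smul_zero, Finset.sum_const_zero, add_zero, AddMonoidHom.finsetSum_apply,
      AddMonoidHom.zsmul_apply, Finset.sum_add_distrib]
    rw [Finset.sum_comm, Finset.sum_comm (f := fun (i : Fin P.m) (k : Fin g) =>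
      P.L (Fin.castAdd g i) (Fin.natAdd P.m k) • (α i) (c k))]
  simp_rw [hphase]
  have hsum : ∀ α, ∑ c : Fin g → ZMod n, ∑ a : Fin P.m → ZMod n, e (β α (c, a)) =
      if β α = 0 then (n : ℂ) ^ (P.m + g) else 0 := by
    intro α
    rw [← Finset.sum_product' (f := fun c a => e (β α (c, a)))]
    refine (sum_e (β α)).trans ?_
    rw [Fintype.card_prod, Fintype.card_fun, Fintype.card_fun, Fintype.card_fin, Fintype.card_fin,
      ZMod.card, ← pow_add, add_comm]
    push_cast
    rfl
  simp_rw [hsum]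
  have hzero : ∀ α, β α = 0 ↔ (∀ j, ∑ i, P.L (Fin.castAdd g i) (Fin.castAdd g j) • α i = 0) ∧
        ∀ k, ∑ i, P.L (Fin.castAdd g i) (Fin.natAdd P.m k) • α i = 0 := by
    intro α
    constructor
    · intro h
      refine ⟨fun j => AddMonoidHom.ext fun a => ?_, fun k => AddMonoidHom.ext fun a => ?_⟩
      · have h1 := DFunLike.congr_fun h (0, Pi.single j a)
        rw [hβ, AddMonoidHom.zero_apply, neg_eq_zero, Finset.sum_eq_single j] at h1
        · simpa using h1
        · intro i _ hi
          refine (congrArg _ (?_ : _ = (0 : ZMod n))).trans (map_zero _)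
          exact (Pi.single_apply (M := ZMod n) j a i).trans (if_neg hi)
        · intro h; exact absurd (Finset.mem_univ j) h
      · have h1 := DFunLike.congr_fun h (Pi.single k a, 0)
        rw [hβ, AddMonoidHom.zero_apply, neg_eq_zero,
          Finset.sum_eq_single (s := (Finset.univ : Finset (Fin g))) k] at h1
        · simpa using h1
        · intro i _ hi
          refine (congrArg _ (?_ : _ = (0 : ZMod n))).trans (map_zero _)
          exact (Pi.single_apply (M := ZMod n) k a i).trans (if_neg hi)
        · intro h; exact absurd (Finset.mem_univ k) h
    · rintro ⟨h1, h2⟩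
      refine AddMonoidHom.ext fun y => ?_
      rw [hβ]
      simp [h1, h2]
  rw [← Finset.sum_filter, Finset.sum_const, nsmul_eq_mul, mul_comm, card_vanishingHom P,
    ← Fintype.card_subtype, ← Nat.card_eq_fintype_card]
  congr 2
  exact Nat.card_congr (Equiv.subtypeEquivRight hzero)

/-- The sum of the partition functions over the boundary labels is independent of the surgery
presentation: it is `nᵍ⁻¹` times the number of homomorphisms `A → G*` that vanish on `f`. -/
theorem sum_partitionFunction (n : ℕ) [NeZero n] (X : LinkedGroup) {g : ℕ} (f : Fin g → X.A) :
    ∑ᶠ c : Fin g → neumann (ZMod n),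
      partitionFunction X f (dwForm (ZMod n)) (fun i => (c i : DWGroup (ZMod n))) =
      ((n ^ g / n * Nat.card (VanishingHom X.A (ZMod n →+ QZ) f) : ℝ) : ℂ) := by
  have hn : (n : ℂ) ≠ 0 := by exact_mod_cast NeZero.ne n
  have hne := nonempty_surgeryPresentation X f
  have hfin : Finite (neumann (ZMod n)) := inferInstance
  simp_rw [partitionFunction, dif_pos hne, SurgeryPresentation.partitionFunction]
  refine (mul_finsum' _ _ (Set.toFinite _)).symm.trans ?_
  rw [sum_phases, sqrt_card_dwGroup]
  push_cast
  rw [pow_add, pow_add]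
  field_simp

/-! ### Summation over `f` -/

/-- The zero homomorphism vanishes on all `f`; a nonzero homomorphism to a group of prime order `p`
vanishes on a proportion `p⁻ᵍ` of them. -/
theorem sum_card_vanishingHom_finite (T C : Type) [AddCommGroup T] [Fintype T] [AddCommGroup C]
    [Finite C] {p : ℕ} (hp : p.Prime) (hC : Nat.card C = p) (g : ℕ) :
    (∑ f : Fin g → T, (Nat.card (VanishingHom T C f) : ℝ)) =
      (Nat.card T : ℝ) ^ g * (1 + (Nat.card (T →+ C) - 1) / (p : ℝ) ^ g) := by
  classical
  have hp0 : (p : ℝ) ≠ 0 := by exact_mod_cast hp.ne_zero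
  have : Finite (T →+ C) := Finite.of_injective _ DFunLike.coe_injective
  let : Fintype (T →+ C) := Fintype.ofFinite _
  have h1 : ∀ f : Fin g → T, (Nat.card (VanishingHom T C f) : ℝ) =
      ∑ φ : T →+ C, if ∀ k, φ (f k) = 0 then 1 else 0 := by
    intro f
    rw [Nat.card_eq_fintype_card, Fintype.card_subtype, Finset.sum_boole]
  simp_rw [h1]
  rw [Finset.sum_comm]
  have h2 : ∀ φ : T →+ C, (∑ f : Fin g → T, if ∀ k, φ (f k) = 0 then (1 : ℝ) else 0) =
      (Nat.card φ.ker : ℝ) ^ g := by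
    intro φ
    rw [Finset.sum_boole, ← Fintype.card_subtype, ← Nat.card_eq_fintype_card,
      Nat.card_congr (Equiv.subtypePiEquivPi (p := fun (_ : Fin g) (t : T) => φ t = 0)),
      Nat.card_fun, Nat.card_fin]
    push_cast
    rfl
  -- A nonzero homomorphism is surjective, because the order of `C` is prime.
  have h3 : ∀ φ : T →+ C, φ ≠ 0 → (Nat.card φ.ker : ℝ) = Nat.card T / p := by
    intro φ hφ
    have hr : Nat.card φ.range = p := by
      have hdvd := AddSubgroup.card_addSubgroup_dvd_card φ.range
      rw [hC] at hdvd
      refine ((Nat.dvd_prime hp).1 hdvd).resolve_left fun h1 => hφ ?_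
      have := (Nat.card_eq_one_iff_unique.1 h1).1
      ext t
      exact congrArg Subtype.val (Subsingleton.elim (⟨φ t, ⟨t, rfl⟩⟩ : φ.range) 0)
    rw [eq_div_iff hp0, ← hr, ← AddSubgroup.index_ker]
    exact_mod_cast AddSubgroup.card_mul_index φ.ker
  simp_rw [h2]
  rw [← Finset.add_sum_erase _ _ (Finset.mem_univ (0 : T →+ C)),
    Finset.sum_congr rfl (fun φ hφ => by rw [h3 φ (Finset.ne_of_mem_erase hφ)]),
    Finset.sum_const, Finset.card_erase_of_mem (Finset.mem_univ _), Finset.card_univ,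
    ← Nat.card_eq_fintype_card, nsmul_eq_mul, Nat.cast_sub Nat.card_pos]
  have hker : Nat.card (0 : T →+ C).ker = Nat.card T := by
    rw [AddMonoidHom.ker_zero, AddSubgroup.card_top]
  rw [hker, div_pow]
  push_cast
  ring

namespace LinkedGroup

/-- The inclusion of the torsion subgroup. -/
def incl (X : LinkedGroup) : X.tors.T →+ X.A := (AddCommGroup.torsion X.A).subtype

theorem incl_injective (X : LinkedGroup) : Function.Injective X.incl := Subtype.coe_injective

theorem incl_mem (X : LinkedGroup) (t : X.tors.T) : X.incl t ∈ AddCommGroup.torsion X.A :=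
  Subtype.property (p := fun a => a ∈ AddCommGroup.torsion X.A) t

/-- A homomorphism on `A ≅ ℤʳ ⊕ Tor A` is arbitrary on the free part. -/
theorem card_vanishingHom_tors (X : LinkedGroup) (C : Type) [AddCommGroup C] {g : ℕ}
    (f : Fin g → X.tors.T) :
    Nat.card (VanishingHom X.A C (fun k => X.incl (f k))) =
      Nat.card C ^ X.rank * Nat.card (VanishingHom X.tors.T C f) := by
  classical
  obtain ⟨Φ, hΦ⟩ := X.exists_splitting
  let i₁ : (Fin X.rank → ℤ) →+ X.A := Φ.toAddMonoidHom.comp (AddMonoidHom.inl _ _)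
  let i₂ : X.tors.T →+ X.A := Φ.toAddMonoidHom.comp (AddMonoidHom.inr _ _)
  have h2 : ∀ t, i₂ t = X.incl t := hΦ
  let E : ((Fin X.rank → ℤ) →+ C) ≃ (Fin X.rank → C) :=
    { toFun := fun φ i => φ (Pi.single i 1)
      invFun := fun c => AddMonoidHom.mk' (fun u => ∑ i, u i • c i) (by
        intro u v
        rw [← Finset.sum_add_distrib]
        exact Finset.sum_congr rfl fun i _ => add_smul _ _ _)
      left_inv := fun φ => by
        refine AddMonoidHom.ext fun u => ?_
        change ∑ i, u i • φ (Pi.single i 1) = φ u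
        conv_rhs => rw [← Finset.univ_sum_single u, map_sum]
        refine Finset.sum_congr rfl fun i _ => ?_
        rw [← map_zsmul, ← Pi.single_smul, smul_eq_mul, mul_one]
      right_inv := fun c => by
        funext i
        change ∑ j, (Pi.single i 1 : Fin X.rank → ℤ) j • c j = c i
        rw [Finset.sum_eq_single i]
        · simp
        · intro j _ hj; simp [hj]
        · intro h; exact absurd (Finset.mem_univ i) h }
  rw [show Nat.card C ^ X.rank = Nat.card (Fin X.rank → C) by rw [Nat.card_fun, Nat.card_fin],
    ← Nat.card_congr E, ← Nat.card_prod]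
  refine Nat.card_congr ⟨fun φ => (φ.1.comp i₁, ⟨φ.1.comp i₂, fun k => ?_⟩),
    fun ψ => ⟨(ψ.1.coprod ψ.2.1).comp Φ.symm.toAddMonoidHom, fun k => ?_⟩, fun φ => ?_, fun ψ => ?_⟩
  · exact (congrArg φ.1 (h2 (f k))).trans (φ.2 k)
  · have h3 : Φ.symm (X.incl (f k)) = (0, f k) :=
      (AddEquiv.symm_apply_eq Φ).2 (hΦ (f k)).symm
    change (ψ.1.coprod ψ.2.1) (Φ.symm (X.incl (f k))) = 0
    rw [h3, AddMonoidHom.coprod_apply, map_zero, zero_add]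
    exact ψ.2.2 k
  · refine Subtype.ext (AddMonoidHom.ext fun a => ?_)
    obtain ⟨⟨u, t⟩, rfl⟩ := Φ.surjective a
    change φ.1 (Φ ((Φ.symm (Φ (u, t))).1, 0)) + φ.1 (Φ (0, (Φ.symm (Φ (u, t))).2)) = _
    rw [← map_add, ← map_add, AddEquiv.symm_apply_apply]
    simp
  · refine Prod.ext (AddMonoidHom.ext fun u => ?_) (Subtype.ext (AddMonoidHom.ext fun t => ?_))
    · change ψ.1 (Φ.symm (Φ (u, 0))).1 + ψ.2.1 (Φ.symm (Φ (u, 0))).2 = _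
      rw [AddEquiv.symm_apply_apply]
      simp
    · change ψ.1 (Φ.symm (Φ (0, t))).1 + ψ.2.1 (Φ.symm (Φ (0, t))).2 = _
      rw [AddEquiv.symm_apply_apply]
      simp

end LinkedGroup

/-- The contribution of a triple, as a real number. -/
def tripleWeight (p : ℕ) (lam s : ℝ) {g : ℕ} (X : LinkedGroup) (f : Fin g → X.A) : ℝ :=
  torsionMeasure lam s X f * ((p : ℝ) ^ g / p * Nat.card (VanishingHom X.A (ZMod p →+ QZ) f))

/-- The contribution of a triple is a real number. -/
theorem tripleTerm_eq (p : ℕ) [NeZero p] (lam s : ℝ) {g : ℕ} (X : LinkedGroup) (f : Fin g → X.A) :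
    tripleTerm (dwForm (ZMod p)) (neumann (ZMod p)) g (torsionMeasure lam s) X f =
      (tripleWeight p lam s X f : ℂ) := by
  rw [tripleTerm, sum_partitionFunction, tripleWeight,
    Complex.ofReal_mul (torsionMeasure lam s X f)]

theorem torsionMeasure_nonneg {lam : ℝ} (hlam : 0 ≤ lam) (s : ℝ) {g : ℕ} (X : LinkedGroup)
    (f : Fin g → X.A) : 0 ≤ torsionMeasure lam s X f := by
  refine mul_nonneg (by positivity) (Finset.prod_nonneg fun i _ => ?_)
  split_ifs <;> norm_num

theorem tripleWeight_nonneg (p : ℕ) {lam : ℝ} (hlam : 0 ≤ lam) (s : ℝ) {g : ℕ} (X : LinkedGroup)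
    (f : Fin g → X.A) : 0 ≤ tripleWeight p lam s X f :=
  mul_nonneg (torsionMeasure_nonneg hlam s X f) (by positivity)

/-- The contribution of all `f` for a pair of rank `r` and torsion class `x`. -/
def classWeight (p g : ℕ) (lam s : ℝ) (r : ℕ) (x : FormClass) : ℝ :=
  (lam * p) ^ r * ((card x : ℝ) ^ (-(s - g)) *
    ((p : ℝ)⁻¹ * ((p : ℝ) ^ g - 1) + (p : ℝ)⁻¹ * homCard (ZMod p →+ QZ) x))

theorem hasSum_tripleWeight (p : ℕ) [hp : Fact p.Prime] (lam s : ℝ) (g : ℕ) (X : LinkedGroup) :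
    HasSum (fun f : Fin g → X.A => tripleWeight p lam s X f)
      (classWeight p g lam s X.rank X.tors.cls) := by
  classical
  let : Fintype X.tors.T := Fintype.ofFinite _
  let ι : (Fin g → X.tors.T) → (Fin g → X.A) := fun f k => X.incl (f k)
  have hι : Function.Injective ι := fun f f' h => funext fun k => X.incl_injective (congrFun h k)
  have hout : ∀ f ∉ Set.range ι, tripleWeight p lam s X f = 0 := by
    intro f hf
    have : ∃ k, f k ∉ AddCommGroup.torsion X.A := by
      by_contra! h
      exact hf ⟨fun k => (⟨f k, h k⟩ : AddCommGroup.torsion X.A), rfl⟩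
    obtain ⟨k, hk⟩ := this
    rw [tripleWeight, torsionMeasure, Finset.prod_eq_zero (Finset.mem_univ k) (if_neg hk)]
    ring
  rw [← hι.hasSum_iff hout]
  have hval : ∀ f, (fun f : Fin g → X.A => tripleWeight p lam s X f) (ι f) =
      lam ^ X.rank * (Nat.card X.tors.T : ℝ) ^ (-s) * ((p : ℝ) ^ g / p) * (p : ℝ) ^ X.rank *
        Nat.card (VanishingHom X.tors.T (ZMod p →+ QZ) f) := by
    intro f
    have h1 : (∏ i, if ι f i ∈ AddCommGroup.torsion X.A then (1 : ℝ) else 0) = 1 :=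
      Finset.prod_eq_one fun i _ => if_pos (X.incl_mem (f i))
    have h2 : Nat.card (VanishingHom X.A (ZMod p →+ QZ) (ι f)) = _ :=
      X.card_vanishingHom_tors (ZMod p →+ QZ) f
    have h3 : torsionMeasure lam s X (ι f) = lam ^ X.rank * (Nat.card X.tors.T : ℝ) ^ (-s) := by
      rw [torsionMeasure]
      refine (congrArg _ ?_).trans (mul_one _)
      convert h1
    simp only [tripleWeight]
    rw [h2, h3, card_dual_zmod]
    push_cast
    ring
  convert hasSum_fintype (fun f => lam ^ X.rank * (Nat.card X.tors.T : ℝ) ^ (-s) *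
    ((p : ℝ) ^ g / p) * (p : ℝ) ^ X.rank *
        (Nat.card (VanishingHom X.tors.T (ZMod p →+ QZ) f) : ℝ)) using 1
  · exact funext hval
  · rw [← Finset.mul_sum, sum_card_vanishingHom_finite _ _ hp.out (card_dual_zmod p), classWeight,
      card_cls, homCard_cls]
    have hp0 : (p : ℝ) ≠ 0 := by exact_mod_cast hp.out.ne_zero
    have hT : (0 : ℝ) < Nat.card X.tors.T := by exact_mod_cast Nat.card_pos
    rw [neg_sub, sub_eq_add_neg, add_comm, Real.rpow_add hT, Real.rpow_natCast, mul_pow]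
    field_simp
    ring

open Filter Topology

/-! ### Infinite products -/

section Products

variable {I : Type*} {y : I → ℝ}

theorem summable_div_one_sub (hy : ∀ i, 0 ≤ y i) (hs : Summable y) :
    Summable fun i => y i / (1 - y i) := by
  have hev : ∀ᶠ i in cofinite, y i < 1 / 2 :=
    hs.tendsto_cofinite_zero.eventually (gt_mem_nhds (by norm_num))
  refine Summable.of_norm_bounded_eventually (g := fun i => 2 * y i) (hs.mul_left 2) ?_
  filter_upwards [hev] with i hi
  have : 0 < 1 - y i := by linarith
  rw [Real.norm_of_nonneg (div_nonneg (hy i) this.le), div_le_iff₀ this]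
  nlinarith [hy i]

/-- The monomials in a summable family of numbers in `[0, 1)` are summable. -/
theorem summable_finsupp_prod_pow (hy : ∀ i, 0 ≤ y i) (h1 : ∀ i, y i < 1) (hs : Summable y) :
    Summable fun k : I →₀ ℕ => k.prod fun i n => y i ^ n := by
  classical
  have hz : Summable fun t : I × ℕ => y t.1 ^ (t.2 + 1) := by
    refine (summable_prod_of_nonneg fun t => pow_nonneg (hy _) _).2 ⟨fun i => ?_, ?_⟩
    · simpa only [pow_succ] using
        (summable_geometric_of_lt_one (hy i) (h1 i)).mul_right (y i)
    · refine (summable_div_one_sub hy hs).congr fun i => ?_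
      simp only [pow_succ, tsum_mul_right, tsum_geometric_of_lt_one (hy i) (h1 i)]
      rw [div_eq_mul_inv, mul_comm]
  -- A multi-index is encoded by the finite set of its entries `(i, k i - 1)` with `k i ≠ 0`.
  let enc : (I →₀ ℕ) → Finset (I × ℕ) := fun k => k.support.image fun i => (i, k i - 1)
  have hmem : ∀ (k : I →₀ ℕ) (i : I) (n : ℕ), (i, n) ∈ enc k ↔ k i = n + 1 := by
    intro k i n
    simp only [enc, Finset.mem_image, Finsupp.mem_support_iff, Prod.mk.injEq]
    constructor
    · rintro ⟨j, hj, rfl, h⟩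
      omega
    · intro h
      exact ⟨i, by omega, rfl, by omega⟩
  have hinj : Function.Injective enc := by
    intro k l h
    ext i
    have hn : ∀ n, k i = n + 1 ↔ l i = n + 1 := fun n => by rw [← hmem, ← hmem, h]
    rcases hk : k i with _ | n
    · rcases hl : l i with _ | m
      · rfl
      · have := (hn m).2 hl
        omega
    · exact ((hn n).1 hk).symm
  refine ((summable_finsetProd_of_summable_nonneg
    (fun t : I × ℕ => pow_nonneg (hy t.1) _) hz).comp_injective hinj).congr fun k => ?_
  rw [Function.comp_apply, Finset.prod_image fun a _ b _ h => congrArg Prod.fst h]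
  refine Finset.prod_congr rfl fun i hi => ?_
  have := Finsupp.mem_support_iff.1 hi
  simp only [show k i - 1 + 1 = k i by omega]

theorem multipliable_one_sub (hs : Summable y) : Multipliable fun i => 1 - y i := by
  simpa only [sub_eq_add_neg] using Real.multipliable_one_add_of_summable hs.neg

/-- Multiplying the sum of all monomials by `∏ i ∈ J, (1 - y i)` removes the monomials that involve
a variable with index in `J`. -/
theorem prod_one_sub_mul_tsum (hy : ∀ i, 0 ≤ y i) (h1 : ∀ i, y i < 1) (hs : Summable y)
    (J : Finset I) :
    (∏ i ∈ J, (1 - y i)) * ∑' k : I →₀ ℕ, k.prod (fun i n => y i ^ n) =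
      ∑' k : I →₀ ℕ, Set.indicator {k | ∀ i ∈ J, k i = 0} (fun k => k.prod fun i n => y i ^ n)
        k := by
  classical
  have hsum := summable_finsupp_prod_pow hy h1 hs
  induction J using Finset.induction_on with
  | empty => simp
  | insert a J ha ih =>
    rw [Finset.prod_insert ha, mul_assoc, ih, sub_mul, one_mul, sub_eq_iff_eq_add, ← tsum_mul_left]
    set w : (I →₀ ℕ) → ℝ := fun k => k.prod fun i n => y i ^ n with hw
    have hshift : ∀ k, w (k + Finsupp.single a 1) = y a * w k := fun k => by
      have h := Finsupp.prod_add_index' (f := k) (g := Finsupp.single a 1)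
        (h := fun i n => y i ^ n) (fun i => pow_zero _) (fun i m n => pow_add _ _ _)
      rw [Finsupp.prod_single_index (h := fun i n => y i ^ n) (pow_zero _), pow_one] at h
      exact h.trans (mul_comm _ _)
    have h2 : ∑' k, y a * Set.indicator {k : I →₀ ℕ | ∀ i ∈ J, k i = 0} w k =
        ∑' k, Set.indicator {k : I →₀ ℕ | (∀ i ∈ J, k i = 0) ∧ k a ≠ 0} w k := by
      refine Eq.trans (tsum_congr fun k => ?_)
        ((add_left_injective (Finsupp.single a 1 : I →₀ ℕ)).tsum_eq ?_)
      · have hk : (∀ i ∈ J, (k + Finsupp.single a 1 : I →₀ ℕ) i = 0) ↔ ∀ i ∈ J, k i = 0 :=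
          forall₂_congr fun i hi => by
            rw [Finsupp.add_apply, Finsupp.single_apply, if_neg (fun h : a = i => ha (h ▸ hi)),
              add_zero]
        by_cases h : ∀ i ∈ J, k i = 0
        · rw [Set.indicator_of_mem (s := {k : I →₀ ℕ | ∀ i ∈ J, k i = 0}) h,
            Set.indicator_of_mem (s := {k : I →₀ ℕ | (∀ i ∈ J, k i = 0) ∧ k a ≠ 0})
              ⟨hk.2 h, by simp⟩,
            hshift]
        · rw [Set.indicator_of_notMem (s := {k : I →₀ ℕ | ∀ i ∈ J, k i = 0}) h,
            Set.indicator_of_notMem (s := {k : I →₀ ℕ | (∀ i ∈ J, k i = 0) ∧ k a ≠ 0})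
              fun h' => h (hk.1 h'.1), mul_zero]
      · intro k hk
        have hka : k a ≠ 0 := by
          exact (Set.mem_of_indicator_ne_zero hk).2
        refine ⟨k - Finsupp.single a 1, ?_⟩
        exact tsub_add_cancel_of_le (Finsupp.single_le_iff.2 (Nat.one_le_iff_ne_zero.2 hka))
    rw [h2, ← Summable.tsum_add (hsum.indicator _) (hsum.indicator _)]
    refine tsum_congr fun k => ?_
    by_cases h : ∀ i ∈ J, k i = 0 <;> by_cases h' : k a = 0 <;>
      simp [Set.indicator_apply, h, h']

/-- The Euler product: the sum of all monomials in the `y i` is the inverse of `∏ (1 - y i)`. -/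
theorem tprod_one_sub_mul_tsum (hy : ∀ i, 0 ≤ y i) (h1 : ∀ i, y i < 1) (hs : Summable y) :
    (∏' i, (1 - y i)) * ∑' k : I →₀ ℕ, k.prod (fun i n => y i ^ n) = 1 := by
  classical
  have hsum := summable_finsupp_prod_pow hy h1 hs
  set w : (I →₀ ℕ) → ℝ := fun k => k.prod fun i n => y i ^ n with hw
  have hw0 : ∀ k, 0 ≤ w k := fun k => Finset.prod_nonneg fun i _ => pow_nonneg (hy i) _
  have hl : Tendsto (fun J : Finset I => (∏ i ∈ J, (1 - y i)) * ∑' k, w k) atTop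
      (𝓝 ((∏' i, (1 - y i)) * ∑' k, w k)) :=
    Tendsto.mul_const _ (multipliable_one_sub hs).hasProd
  have hr : Tendsto (fun J : Finset I => ∑' k, Set.indicator {k | ∀ i ∈ J, k i = 0} w k) atTop
      (𝓝 (∑' k, Set.indicator {0} w k)) := by
    refine tendsto_tsum_of_dominated_convergence (bound := w) hsum (fun k => ?_)
      (Eventually.of_forall fun J k => ?_)
    · by_cases hk : k = 0
      · subst hk
        simp
      · obtain ⟨i, hi⟩ := Finsupp.ne_iff.1 hk
        refine tendsto_const_nhds.congr' ?_
        filter_upwards [eventually_ge_atTop {i}] with J hJ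
        rw [Set.indicator_of_notMem (by exact hk), Set.indicator_of_notMem]
        exact fun h => hi (h i (hJ (Finset.mem_singleton_self i)))
    · rw [Real.norm_of_nonneg (Set.indicator_nonneg (fun k _ => hw0 k) k)]
      exact Set.indicator_le_self' (fun k _ => hw0 k) k
  refine (tendsto_nhds_unique hl (hr.congr fun J =>
    (prod_one_sub_mul_tsum hy h1 hs J).symm)).trans ?_
  rw [tsum_eq_single (0 : I →₀ ℕ) fun k hk => Set.indicator_of_notMem (by exact hk) _]
  simp [hw]

theorem hasProd_inv_one_sub (hy : ∀ i, 0 ≤ y i) (h1 : ∀ i, y i < 1) (hs : Summable y) :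
    HasProd (fun i => (1 - y i)⁻¹) (∑' k : I →₀ ℕ, k.prod fun i n => y i ^ n) := by
  have h := tprod_one_sub_mul_tsum hy h1 hs
  rw [← inv_eq_of_mul_eq_one_right h]
  refine ((multipliable_one_sub hs).hasProd.inv₀ (left_ne_zero_of_mul_eq_one h)).congr
    fun J => ?_
  rw [Finset.prod_inv_distrib]

theorem hasProd_one_add (hy : ∀ i, 0 ≤ y i) (hs : Summable y) :
    HasProd (fun i => 1 + y i) (∑' S : Finset I, ∏ i ∈ S, y i) := by
  have h := summable_finsetProd_of_summable_nonneg hy hs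
  rw [← tprod_one_add h]
  exact (multipliable_one_add_of_summable_prod h).hasProd

theorem tsum_finsupp_prod_pow_pos (hy : ∀ i, 0 ≤ y i) (h1 : ∀ i, y i < 1) (hs : Summable y) :
    0 < ∑' k : I →₀ ℕ, k.prod fun i n => y i ^ n :=
  (summable_finsupp_prod_pow hy h1 hs).tsum_pos
    (fun k => Finset.prod_nonneg fun i _ => pow_nonneg (hy i) _) 0 (by simp)

theorem tsum_finset_prod_pos (hy : ∀ i, 0 ≤ y i) (hs : Summable y) :
    0 < ∑' S : Finset I, ∏ i ∈ S, y i :=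
  (summable_finsetProd_of_summable_nonneg hy hs).tsum_pos
    (fun S => Finset.prod_nonneg fun i _ => hy i) ∅ (by simp)

end Products

/-! ### Dirichlet series of linking forms -/

theorem summable_nat_pow_succ_rpow {u : ℝ} (hu : 1 < u) :
    Summable fun t : {q : ℕ // q.Prime} × ℕ => ((t.1.1 ^ (t.2 + 1) : ℕ) : ℝ) ^ (-u) := by
  have h := Real.summable_nat_rpow.2 (show -u < -1 by linarith)
  refine h.comp_injective (i := fun t : {q : ℕ // q.Prime} × ℕ => t.1.1 ^ (t.2 + 1)) ?_
  rintro ⟨⟨q, hq⟩, k⟩ ⟨⟨q', hq'⟩, k'⟩ h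
  obtain ⟨rfl, h⟩ := Nat.Prime.pow_inj hq hq' h
  obtain rfl : k = k' := h
  rfl

theorem pow_rpow_neg {a : ℝ} (ha : 0 < a) (k : ℕ) (u : ℝ) : (a ^ k) ^ (-u) = (a ^ (-u)) ^ k := by
  rw [← Real.rpow_natCast, ← Real.rpow_natCast, ← Real.rpow_mul ha.le, ← Real.rpow_mul ha.le,
    mul_comm]

theorem one_lt_card_piece (i : PieceIndex) : 1 < card (piece i) := by
  rcases i with ⟨q, k, ε⟩ | ⟨k, a⟩ | ⟨k, ε⟩
  · have := Fact.mk q.2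
    exact (card_signForm q.1 (k + 1) ε).symm ▸ one_lt_pow₀ q.2.one_lt k.succ_ne_zero
  · exact (card_cyclic (2 ^ (k + 1)) a).symm ▸ one_lt_pow₀ one_lt_two k.succ_ne_zero
  · exact (card_evenForm (k + 1) ε).symm ▸
      one_lt_pow₀ (one_lt_pow₀ one_lt_two k.succ_ne_zero) two_ne_zero

theorem summable_card_piece {u : ℝ} (hu : 1 < u) :
    Summable fun i : PieceIndex => (card (piece i) : ℝ) ^ (-u) := by
  have hgeom : Summable fun k : ℕ => ((2 : ℝ) ^ (1 - u)) ^ (k + 1) :=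
    (summable_nat_add_iff 1).2 (summable_geometric_of_lt_one (by positivity)
      (Real.rpow_lt_one_of_one_lt_of_neg one_lt_two (by linarith)))
  refine Summable.sum _ ?_ (Summable.sum _ ?_ ?_)
  · have h := (summable_nat_pow_succ_rpow hu).mul_of_nonneg (g := fun _ : Bool => (1 : ℝ))
      Summable.of_finite (fun _ => by positivity) (fun _ => zero_le_one)
    refine ((Equiv.prodAssoc _ _ _).summable_iff).1 (h.congr fun t => ?_)
    obtain ⟨⟨q, k⟩, ε⟩ := t
    have := Fact.mk q.2
    change _ = (card (signForm q.1 (k + 1) ε).cls : ℝ) ^ (-u)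
    rw [card_signForm, mul_one]
  · refine (summable_sigma_of_nonneg fun t => Real.rpow_nonneg (Nat.cast_nonneg _) _).2
      ⟨fun k => Summable.of_finite, ?_⟩
    -- There are at most `2 ^ (k + 1)` units modulo `2 ^ (k + 1)`.
    refine Summable.of_nonneg_of_le
      (fun k => tsum_nonneg fun _ => Real.rpow_nonneg (Nat.cast_nonneg _) _) (fun k => ?_) hgeom
    have h1 : ∀ a : (ZMod (2 ^ (k + 1)))ˣ,
        (fun t => (card (piece t) : ℝ) ^ (-u)) (.inr (.inl ⟨k, a⟩)) =
          (((2 : ℝ) ^ (k + 1)) ^ (-u)) := fun a => by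
      change (card (cyclic (2 ^ (k + 1)) a).cls : ℝ) ^ (-u) = _
      rw [card_cyclic]
      push_cast
      rfl
    simp only at h1 ⊢
    rw [tsum_congr h1, tsum_const, nsmul_eq_mul]
    have h2 : (Nat.card (ZMod (2 ^ (k + 1)))ˣ : ℝ) ≤ 2 ^ (k + 1) := by
      have := Nat.card_le_card_of_injective _ (Units.val_injective (α := ZMod (2 ^ (k + 1))))
      rw [Nat.card_zmod] at this
      exact_mod_cast this
    refine (mul_le_mul_of_nonneg_right h2 (by positivity)).trans_eq ?_
    rw [pow_rpow_neg two_pos, ← mul_pow, sub_eq_add_neg, Real.rpow_add two_pos, Real.rpow_one]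
  · have h : Summable fun k : ℕ => ((2 : ℝ) ^ (-u)) ^ (k + 1) :=
      (summable_nat_add_iff 1).2 (summable_geometric_of_lt_one (by positivity)
        (Real.rpow_lt_one_of_one_lt_of_neg one_lt_two (by linarith)))
    have h := h.mul_of_nonneg (g := fun _ : Bool => (1 : ℝ))
      Summable.of_finite (fun _ => by positivity) (fun _ => zero_le_one)
    refine Summable.of_nonneg_of_le (fun _ => Real.rpow_nonneg (Nat.cast_nonneg _) _) ?_ h
    rintro ⟨k, ε⟩
    change (card (evenForm (k + 1) ε).cls : ℝ) ^ (-u) ≤ _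
    rw [card_evenForm]
    push_cast
    rw [mul_one, pow_rpow_neg (by positivity), pow_rpow_neg two_pos]
    refine pow_le_of_le_one (by positivity) (pow_le_one₀ (by positivity) ?_) two_ne_zero
    exact (Real.rpow_lt_one_of_one_lt_of_neg one_lt_two (by linarith)).le

/-- The Dirichlet series of finite linking forms converges to the right of `1`: it is dominated by
the sum of all monomials in the orders of the generators. -/
theorem summable_card {u : ℝ} (hu : 1 < u) :
    Summable fun x : FormClass => (card x : ℝ) ^ (-u) := by
  choose f hf using exists_sum_piece
  have hinj : Function.Injective f := fun x y h => by rw [← hf x, ← hf y, h]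
  refine ((summable_finsupp_prod_pow (y := fun i => (card (piece i) : ℝ) ^ (-u))
    (fun i => by positivity) (fun i => ?_) (summable_card_piece hu)).comp_injective hinj).congr
    fun x => ?_
  · exact Real.rpow_lt_one_of_one_lt_of_neg (by exact_mod_cast one_lt_card_piece i) (by linarith)
  · have hx : card x = (f x).prod fun i n => card (piece i) ^ n := by
      conv_lhs => rw [← hf x]
      rw [Finsupp.sum, isMult_card.sum, Finsupp.prod]
      simp_rw [isMult_card.nsmul]
    rw [hx, Finsupp.prod, Nat.cast_prod, ← Real.finsetProd_rpow _ _ fun i _ => by positivity]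
    refine Finset.prod_congr rfl fun i _ => ?_
    push_cast
    exact (pow_rpow_neg (by exact_mod_cast one_pos.trans (one_lt_card_piece i)) _ _).symm

section Weighted

variable (C : Type) [AddCommGroup C]

/-- The order of a form to the power `-u`, weighted by the number of homomorphisms to `C`. -/
def homWeight (u : ℝ) (x : FormClass) : ℝ := (card x : ℝ) ^ (-u) * homCard C x

theorem isMult_homWeight (u : ℝ) : IsMult (homWeight C u) where
  zero := by simp [homWeight, isMult_card.zero, (isMult_homCard C).zero]
  add x y := by
    simp only [homWeight, isMult_card.add, (isMult_homCard C).add]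
    push_cast
    rw [Real.mul_rpow (by positivity) (by positivity)]
    ring

variable {C} {p : ℕ}

theorem homWeight_signForm [hp : Fact p.Prime] (hC : ∀ c : C, p • c = 0) (u : ℝ) (m : ℕ+)
    (ε : Bool) :
    homWeight C u (signForm p m ε).cls = Nat.card C * ((p : ℝ) ^ (-u)) ^ (m : ℕ) := by
  have h : homCard C (signForm p m ε).cls = Nat.card C := by
    change Nat.card (ZMod (p ^ (m : ℕ)) →+ C) = _
    rw [Nat.card_congr (homZModEquiv _ _)]
    refine Nat.card_congr (Equiv.subtypeUnivEquiv fun c => ?_)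
    obtain ⟨m, hm⟩ := Nat.exists_eq_succ_of_ne_zero m.ne_zero
    rw [hm, pow_succ, mul_smul, hC, smul_zero]
  rw [homWeight, h, card_signForm, mul_comm]
  push_cast
  rw [pow_rpow_neg (by exact_mod_cast hp.out.pos)]

theorem homWeight_of_coprime (hC : ∀ c : C, p • c = 0) (u : ℝ) {y : FormClass}
    (hy : (card y).Coprime p) : homWeight C u y = (card y : ℝ) ^ (-u) := by
  have h : homCard C y = 1 := by
    induction y using FormClass.ind with | h Y => ?_
    rw [homCard_cls, Nat.card_eq_one_iff_unique]
    refine ⟨⟨fun f f' => ?_⟩, ⟨0⟩⟩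
    have h0 : ∀ f : Y.T →+ C, f = 0 := fun f => by
      ext t
      rw [AddMonoidHom.zero_apply, ← AddMonoid.addOrderOf_eq_one_iff, ← Nat.dvd_one,
        ← Nat.Coprime.gcd_eq_one hy]
      refine Nat.dvd_gcd (addOrderOf_dvd_of_nsmul_eq_zero ?_)
        (addOrderOf_dvd_of_nsmul_eq_zero (hC _))
      rw [← map_nsmul, card_cls, card_nsmul_eq_zero', map_zero]
    rw [h0 f, h0 f']
  rw [homWeight, h, Nat.cast_one, mul_one]

/-- The local factor at `p` of the sum of `homWeight`, as a sum over the forms on `p`-groups; the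
unsigned pieces occur with any multiplicity, the signed ones at most once. -/
def localFactor (y : ℕ+ → ℝ) : ℝ :=
  (∑' k : ℕ+ →₀ ℕ, k.prod fun m n => y m ^ n) * ∑' S : Finset ℕ+, ∏ m ∈ S, y m

/-- The contribution of a piece of order `p ^ m` if `C` has order `c`. -/
def localWeight (p : ℕ) (u : ℝ) (c : ℕ) (m : ℕ+) : ℝ := c * ((p : ℝ) ^ (-u)) ^ (m : ℕ)

theorem localWeight_nonneg (u : ℝ) (c : ℕ) (m : ℕ+) : 0 ≤ localWeight p u c m := by
  rw [localWeight]
  positivity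

theorem rpow_neg_lt_one [hp : Fact p.Prime] {u : ℝ} (hu : 1 < u) : (p : ℝ) ^ (-u) < 1 :=
  Real.rpow_lt_one_of_one_lt_of_neg (by exact_mod_cast hp.out.one_lt) (by linarith)

theorem localWeight_lt_one [hp : Fact p.Prime] {u : ℝ} (hu : 1 < u) {c : ℕ} (hc : c ≤ p) (m : ℕ+) :
    localWeight p u c m < 1 := by
  have hp0 : (0 : ℝ) < p := by exact_mod_cast hp.out.pos
  calc localWeight p u c m ≤ p * (p : ℝ) ^ (-u) := by
        refine mul_le_mul (by exact_mod_cast hc) ?_ (by positivity) hp0.le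
        exact pow_le_of_le_one (by positivity) (rpow_neg_lt_one hu).le m.ne_zero
    _ = (p : ℝ) ^ (1 - u) := by rw [sub_eq_add_neg, Real.rpow_add hp0, Real.rpow_one]
    _ < 1 := Real.rpow_lt_one_of_one_lt_of_neg (by exact_mod_cast hp.out.one_lt) (by linarith)

theorem summable_localWeight [Fact p.Prime] {u : ℝ} (hu : 1 < u) (c : ℕ) :
    Summable (localWeight p u c) :=
  ((summable_geometric_of_lt_one (by positivity) (rpow_neg_lt_one hu)).comp_injective
    PNat.coe_injective).mul_left _

/-- The sum of `homWeight` over all forms splits into the local factor at `p` and a sum over the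
forms of order prime to `p`, on which `homWeight` does not depend on `C`. -/
theorem hasSum_homWeight [Fact p.Prime] (hp2 : p ≠ 2) (hC : ∀ c : C, p • c = 0)
    (hcard : Nat.card C ≤ p) {u : ℝ} (hu : 1 < u) :
    HasSum (homWeight C u) (localFactor (localWeight p u (Nat.card C)) *
      ∑' y : {y : FormClass // (card y).Coprime p}, (card y.1 : ℝ) ^ (-u)) := by
  set y := localWeight p u (Nat.card C)
  have hy0 : ∀ m, 0 ≤ y m := localWeight_nonneg u _
  have hy1 : ∀ m, y m < 1 := localWeight_lt_one hu hcard
  have hys : Summable y := summable_localWeight hu _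
  have h1 := (summable_finsupp_prod_pow hy0 hy1 hys).mul_of_nonneg
    (summable_finsetProd_of_summable_nonneg hy0 hys)
    (fun k => Finset.prod_nonneg fun i _ => pow_nonneg (hy0 i) _)
    (fun S => Finset.prod_nonneg fun i _ => hy0 i)
  have h2 := (summable_card hu).comp_injective
    (Subtype.val_injective (p := fun y : FormClass => (card y).Coprime p))
  have h3 := h1.mul_of_nonneg h2
    (fun t => mul_nonneg (Finset.prod_nonneg fun i _ => pow_nonneg (hy0 i) _)
      (Finset.prod_nonneg fun i _ => hy0 i)) (fun y => Real.rpow_nonneg (Nat.cast_nonneg _) _)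
  refine (Equiv.ofBijective _ (bijective_primaryForm_add p hp2)).hasSum_iff.1 ?_
  have hs := (((summable_finsupp_prod_pow hy0 hy1 hys).hasSum.mul
    (summable_finsetProd_of_summable_nonneg hy0 hys).hasSum h1).mul h2.hasSum h3)
  refine hs.congr_fun ?_
  rintro ⟨⟨k, S⟩, x⟩
  change homWeight C u (primaryForm p k S + x.1) = _
  rw [(isMult_homWeight C u).add, (isMult_homWeight C u).primaryForm, homWeight_of_coprime hC u x.2]
  simp_rw [homWeight_signForm hC]
  rfl

end Weighted

/-! ### The infinite product -/

/-- Grouping the classes of finite forms by their order. -/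
theorem hasSum_xiTerm {u : ℝ} (hu : 1 < u) :
    HasSum (xiTerm u) (∑' x : FormClass, (card x : ℝ) ^ (-u)) := by
  let ord : FormClass → ℕ+ := fun x => ⟨card x, Nat.pos_of_ne_zero (card_ne_zero x)⟩
  have h := (Equiv.sigmaFiberEquiv ord).hasSum_iff.2 (summable_card hu).hasSum
  refine (h.sigma fun n => (h.summable.sigma_factor n).hasSum).congr_fun fun n => ?_
  have h1 : ∀ x : {x // ord x = n}, ((fun x : FormClass => (card x : ℝ) ^ (-u)) ∘
      Equiv.sigmaFiberEquiv ord) ⟨n, x⟩ = ((n : ℕ) : ℝ) ^ (-u) := fun x => by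
    obtain ⟨x, rfl⟩ := x
    rfl
  rw [tsum_congr h1, tsum_const, xiTerm, numForms_eq _ n.ne_zero, nsmul_eq_mul]
  congr 2
  exact Nat.card_congr (Equiv.subtypeEquivRight fun x => by rw [← PNat.coe_inj]; rfl)

theorem homWeight_unit (u : ℝ) : homWeight Unit u = fun x => (card x : ℝ) ^ (-u) := by
  funext x
  have h : homCard Unit x = 1 := by
    induction x using FormClass.ind with | h X => ?_
    exact Nat.card_eq_one_iff_unique.2 ⟨⟨fun _ _ => AddMonoidHom.ext fun _ => rfl⟩, ⟨0⟩⟩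
  rw [homWeight, h, Nat.cast_one, mul_one]

section Prime

variable (p : ℕ) [hp : Fact p.Prime]

/-- The infinite product is the quotient of the local factors at `p` for homomorphisms to a group of
order `p` and for no weight. -/
theorem hasProd_localFactor_div {u : ℝ} (hu : 1 < u) :
    HasProd (fun m : ℕ+ =>
      (1 + (p : ℝ) ^ (1 - ((m : ℕ) : ℝ) * u)) / (1 - (p : ℝ) ^ (1 - ((m : ℕ) : ℝ) * u)) *
      ((1 - (p : ℝ) ^ (-(((m : ℕ) : ℝ) * u))) / (1 + (p : ℝ) ^ (-(((m : ℕ) : ℝ) * u)))))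
      (localFactor (localWeight p u p) / localFactor (localWeight p u 1)) := by
  have hp0 : (0 : ℝ) < p := by exact_mod_cast hp.out.pos
  have e0 : ∀ m : ℕ+, (p : ℝ) ^ (-(((m : ℕ) : ℝ) * u)) = localWeight p u 1 m := fun m => by
    rw [localWeight, Nat.cast_one, one_mul, ← Real.rpow_natCast, ← Real.rpow_mul hp0.le]
    ring_nf
  have e1 : ∀ m : ℕ+, (p : ℝ) ^ (1 - ((m : ℕ) : ℝ) * u) = localWeight p u p m := fun m => by
    rw [sub_eq_add_neg, Real.rpow_add hp0, Real.rpow_one, e0, localWeight, localWeight,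
      Nat.cast_one, one_mul]
  have a0 : ∀ m, 0 ≤ localWeight p u 1 m := localWeight_nonneg u _
  have a1 : ∀ m, 0 ≤ localWeight p u p m := localWeight_nonneg u _
  have b0 : ∀ m, localWeight p u 1 m < 1 := localWeight_lt_one hu hp.out.one_lt.le
  have b1 : ∀ m, localWeight p u p m < 1 := localWeight_lt_one hu le_rfl
  have c0 := summable_localWeight (p := p) hu 1
  have c1 := summable_localWeight (p := p) hu p
  have h0 := ((hasProd_one_add a0 c0).mul (hasProd_inv_one_sub a0 b0 c0)).inv₀
    (mul_pos (tsum_finset_prod_pos a0 c0) (tsum_finsupp_prod_pow_pos a0 b0 c0)).ne'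
  have h1 := (hasProd_one_add a1 c1).mul (hasProd_inv_one_sub a1 b1 c1)
  rw [localFactor, localFactor, div_eq_mul_inv, mul_comm (tsum _) (tsum _),
    mul_comm (tsum _) (∑' S : Finset ℕ+, ∏ m ∈ S, localWeight p u 1 m)]
  refine (h1.mul h0).congr_fun fun m => ?_
  rw [e0, e1, mul_inv, inv_inv]
  ring

theorem localFactor_pos {u : ℝ} (hu : 1 < u) : 0 < localFactor (localWeight p u 1) :=
  mul_pos (tsum_finsupp_prod_pow_pos (localWeight_nonneg u _)
      (localWeight_lt_one hu hp.out.one_lt.le) (summable_localWeight hu 1))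
    (tsum_finset_prod_pos (localWeight_nonneg u _) (summable_localWeight hu 1))

/-- Weighting by the number of homomorphisms to the dual of `ℤ/p` multiplies the sum over all forms
by the infinite product. -/
theorem hasSum_homWeight_dual (hp2 : p ≠ 2) {u : ℝ} (hu : 1 < u) :
    HasSum (homWeight (ZMod p →+ QZ) u) (xi u *
      (localFactor (localWeight p u p) / localFactor (localWeight p u 1))) := by
  have h0 := hasSum_homWeight (p := p) (C := Unit) hp2 (fun _ => rfl)
    (by rw [Nat.card_unique]; exact hp.out.one_lt.le) hu
  have h1 := hasSum_homWeight (p := p) (C := ZMod p →+ QZ) hp2 (nsmul_dual_zmod p)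
    (card_dual_zmod p).le hu
  rw [homWeight_unit, Nat.card_unique] at h0
  rw [card_dual_zmod] at h1
  rw [xi, (hasSum_xiTerm hu).tsum_eq, h0.tsum_eq]
  convert h1 using 1
  field_simp [(localFactor_pos p hu).ne']

/-- The sum over the equivalence classes of pairs: a geometric series in the rank times a sum over
finite forms. -/
theorem hasSum_classWeight (hp2 : p ≠ 2) {lam s : ℝ} {g : ℕ} (hlam : 0 ≤ lam)
    (hlam' : lam * p < 1) (hu : 1 < s - g) :
    HasSum (fun X : LinkedClass => classWeight p g lam s X.rep.rank X.rep.tors.cls)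
      ((1 - lam * p)⁻¹ * ((p : ℝ)⁻¹ * ((p : ℝ) ^ g - 1) * xi (s - g) + (p : ℝ)⁻¹ * (xi (s - g) *
        (localFactor (localWeight p (s - g) p) / localFactor (localWeight p (s - g) 1))))) := by
  have hp1 : (1 : ℝ) ≤ p := by exact_mod_cast hp.out.one_lt.le
  have hr := hasSum_geometric_of_lt_one (mul_nonneg hlam (zero_le_one.trans hp1)) hlam'
  have hpg : 0 ≤ (p : ℝ)⁻¹ * ((p : ℝ) ^ g - 1) :=
    mul_nonneg (by positivity) (sub_nonneg.2 (one_le_pow₀ hp1))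
  let F : FormClass → ℝ := fun x => (p : ℝ)⁻¹ * ((p : ℝ) ^ g - 1) * (card x : ℝ) ^ (-(s - g)) +
    (p : ℝ)⁻¹ * homWeight (ZMod p →+ QZ) (s - g) x
  have hx : HasSum F ((p : ℝ)⁻¹ * ((p : ℝ) ^ g - 1) * xi (s - g) + (p : ℝ)⁻¹ * (xi (s - g) *
      (localFactor (localWeight p (s - g) p) / localFactor (localWeight p (s - g) 1)))) := by
    refine HasSum.add (HasSum.mul_left _ ?_)
      (HasSum.mul_left _ (hasSum_homWeight_dual p hp2 hu))
    rw [xi, (hasSum_xiTerm hu).tsum_eq]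
    exact (summable_card hu).hasSum
  have hF0 : ∀ x, 0 ≤ F x := fun x => add_nonneg
    (mul_nonneg hpg (Real.rpow_nonneg (Nat.cast_nonneg _) _))
    (mul_nonneg (by positivity)
      (mul_nonneg (Real.rpow_nonneg (Nat.cast_nonneg _) _) (Nat.cast_nonneg _)))
  have hs := hr.summable.mul_of_nonneg hx.summable
    (fun r => pow_nonneg (mul_nonneg hlam (zero_le_one.trans hp1)) r) hF0
  refine ((Equiv.hasSum_iff linkedClassEquiv).2 (hr.mul hx hs)).congr_fun fun X => ?_
  rw [Function.comp_apply, linkedClassEquiv_apply]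
  simp only [classWeight, F, homWeight]
  ring

end Prime

end AbelianTQFT

end

theorem mainTheorem5 (p : ℕ) (hp : p.Prime) (hp2 : p ≠ 2) (g : ℕ) (lam s : ℝ)
    (hlam : 0 ≤ lam)
    (hlam' : lam < (Real.sqrt (Nat.card (AbelianTQFT.DWGroup (ZMod p))))⁻¹)
    (hs : (g : ℝ) + 1 < s) :
    -- the sum over all triples `(A, ℓ, f)` converges absolutely
    Summable (fun t : (Σ X : AbelianTQFT.LinkedClass, Fin g → X.rep.A) =>
      ‖AbelianTQFT.tripleTerm (AbelianTQFT.dwForm (ZMod p)) (AbelianTQFT.neumann (ZMod p)) g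
        (AbelianTQFT.torsionMeasure lam s) t.1.rep t.2‖) ∧
    Summable (AbelianTQFT.xiTerm (s - g)) ∧
    Multipliable (fun m : ℕ+ =>
      (1 + (p : ℝ) ^ (1 - ((m : ℕ) : ℝ) * (s - g))) / (1 - (p : ℝ) ^ (1 - ((m : ℕ) : ℝ) * (s - g))) *
      ((1 - (p : ℝ) ^ (-(((m : ℕ) : ℝ) * (s - g)))) /
        (1 + (p : ℝ) ^ (-(((m : ℕ) : ℝ) * (s - g)))))) ∧
    AbelianTQFT.connectedZ (AbelianTQFT.dwForm (ZMod p)) (AbelianTQFT.neumann (ZMod p)) g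
        (AbelianTQFT.torsionMeasure lam s) =
      ((AbelianTQFT.xi (s - g) /
          (1 - lam * Real.sqrt (Nat.card (AbelianTQFT.DWGroup (ZMod p)))) *
        ((p : ℝ)⁻¹ * ((p : ℝ) ^ g - 1) + (p : ℝ)⁻¹ * ∏' m : ℕ+,
          ((1 + (p : ℝ) ^ (1 - ((m : ℕ) : ℝ) * (s - g))) /
              (1 - (p : ℝ) ^ (1 - ((m : ℕ) : ℝ) * (s - g))) *
            ((1 - (p : ℝ) ^ (-(((m : ℕ) : ℝ) * (s - g)))) /
              (1 + (p : ℝ) ^ (-(((m : ℕ) : ℝ) * (s - g))))))) : ℝ) : ℂ) := by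

  have := Fact.mk hp
  rw [AbelianTQFT.sqrt_card_dwGroup] at hlam' ⊢
  have hp0 : (0 : ℝ) < p := by exact_mod_cast hp.pos
  have hlam1 : lam * p < 1 := by rwa [← one_div, lt_div_iff₀ hp0] at hlam'
  have hu : 1 < s - g := by linarith
  have hf := fun X : AbelianTQFT.LinkedClass => AbelianTQFT.hasSum_tripleWeight p lam s g X.rep
  have hX := AbelianTQFT.hasSum_classWeight p hp2 hlam hlam1 hu
  have hprod := AbelianTQFT.hasProd_localFactor_div p hu
  refine ⟨?_, (AbelianTQFT.hasSum_xiTerm hu).summable, hprod.multipliable, ?_⟩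
  · simp_rw [AbelianTQFT.tripleTerm_eq, Complex.norm_real,
      Real.norm_of_nonneg (AbelianTQFT.tripleWeight_nonneg p hlam s _ _)]
    refine (summable_sigma_of_nonneg fun t => AbelianTQFT.tripleWeight_nonneg p hlam s _ _).2
      ⟨fun X => (hf X).summable, ?_⟩
    simp_rw [(hf _).tsum_eq]
    exact hX.summable
  · rw [AbelianTQFT.connectedZ]
    simp_rw [AbelianTQFT.tripleTerm_eq, ← Complex.ofReal_tsum, (hf _).tsum_eq]
    rw [hX.tsum_eq, hprod.tprod_eq]
    congr 1
    rw [div_eq_mul_inv]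
    ring
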